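/- Let $I=[0,1)$ with Lebesgue measure $\lambda$, and let $a:I\to I$ be the von Neumann–Kakutani map, $a(x)=x-(1-3\cdot 2^{-n})$ for $x\in[1-2^{1-n},1-2^{-n})$, $n\ge1$. For a permutation $\pi$ of $\{0,\dots,q-1\}$ let $R_\pi:I\to I$ be the map that carries each interval $[\frac iq,\frac{i+1}q)$ onto $[\frac{\pi(i)}q,\frac{\pi(i)+1}q)$ by a translation, and let $F_\pi=a\circ R_\pi$ be the rotated odometer. **Theorem 1.1.** Let $q\ge2$, let $\pi$ be a permutation of $\{0,\dots,q-1\}$, and let $p\ge q$ be an integer. Then there is a translation surface $L_{\pi,p}$ (a connected surface with an atlas whose transition maps are local translations), obtained from the closed unit square by removing a countable closed set of boundary points that contains the corners, and by identifying, by piecewise translations, the rest of the upper side with the rest of the lower side and the rest of the right side with the rest of the left side, such that the following hold. 1. $L_{\pi,p}$ has finite area, exactly one non-planar end, and at most finitely many planar ends. (An end is planar if it has a neighbourhood of genus zero.) 2. Let $\overline L$ be the metric completion of $L_{\pi,p}$ for the path distance of its flat metric, and call the points of $\overline L\setminus L_{\pi,p}$ singularities. A singularity $\sigma$ is a cone angle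 singularity if, for some $\varepsilon>0$ and some integer $k\ge1$, the punctured ball $B_\varepsilon(\sigma)\setminus\{\sigma\}$ is contained in $L_{\pi,p}$ and is a connected $k$-sheeted translation covering (a covering that is locally a translation) of the punctured disc $\{z\in\mathbb R^2:0<|z|<\varepsilon\}$; it is wild if for no $\varepsilon>0$ the punctured ball is contained in $L_{\pi,p}$ and is a finite or infinite cyclic (that is, connected) translation covering of that punctured disc. Then exactly one singularity is wild, and the others are finitely many cone angle singularities (there may be none). 3. Consider the unit speed flow of slope $q/p$ on $L_{\pi,p}$, in the direction of the vector $(p,q)$. Let $P$ be the set of those points in the image of the open lower side of the square (with the removed points taken out) whose flow line is defined for all times, with the measure $\lambda$ induced by Lebesgue measure on that side. Then every point of $P$ returns to $P$, and the first return map $F:P\to P$ is such that $(P,F,\lambda)$ is measurably isomorphic to $(I,F_\pi,\lambda)$. -/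

import Mathlib

open Set Filter Topology MeasureTheory

noncomputable section

/-! ### Translation surfaces -/

/-- Maps between open subsets of the plane `ℂ` which are translations near every point. -/
def translationPregroupoid : Pregroupoid ℂ where
  property f s := ∀ x ∈ s, ∀ᶠ y in 𝓝 x, f y - f x = y - x
  comp := by
    intro f g u v hf hg _ _ _ x hx
    have h1 := hf x hx.1
    have hc : Tendsto f (𝓝 x) (𝓝 (f x)) := by
      have h2 : Tendsto (fun y : ℂ => y - x + f x) (𝓝 x) (𝓝 (f x)) := by
        have : Continuous fun y : ℂ => y - x + f x := by fun_prop
        simpa using this.tendsto x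
      refine h2.congr' ?_
      filter_upwards [h1] with y hy
      rw [← hy]; ring
    filter_upwards [h1, hc.eventually (hg (f x) hx.2)] with y h3 h4
    simp only [Function.comp_apply]
    rw [h4, h3]
  id_mem := by
    intro x _
    exact Eventually.of_forall fun y => rfl
  locality := by
    intro f u _ h x hx
    obtain ⟨v, _, hxv, hv⟩ := h x hx
    exact hv x ⟨hx, hxv⟩
  congr := by
    intro f g u hu hgf hf x hx
    filter_upwards [hf x hx, hu.mem_nhds hx] with y hy hyu
    rw [hgf y hyu, hgf x hx, hy]

/-- The structure groupoid of local translations of the plane. -/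
def translationGroupoid : StructureGroupoid ℂ := translationPregroupoid.groupoid

/-- A translation surface: a connected, Hausdorff, second countable surface with an atlas
whose transition maps are local translations. -/
structure IsTranslationSurface (M : Type*) [TopologicalSpace M] [ChartedSpace ℂ M] : Prop where
  t2 : T2Space M
  secondCountable : SecondCountableTopology M
  connected : ConnectedSpace M
  translations : HasGroupoid M translationGroupoid

section TranslationSurface

variable {M : Type*} [TopologicalSpace M] [ChartedSpace ℂ M]

/-- `μ` is the area measure of `M`: in every chart it is Lebesgue measure of the plane. -/
def IsAreaMeasure [MeasurableSpace M] (μ : Measure M) : Prop :=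
  ∀ e ∈ atlas ℂ M, ∀ A ⊆ e.source, MeasurableSet A → μ A = volume (e '' A)

/-- `δ` is a development of the path `γ` into the plane: in charts, `γ` and `δ` differ
locally by a translation. -/
def IsDevelopment {x y : M} (γ : Path x y) (δ : unitInterval → ℂ) : Prop :=
  ∀ t : unitInterval, ∃ e ∈ atlas ℂ M, γ t ∈ e.source ∧
    ∀ᶠ s in 𝓝 t, e (γ s) - e (γ t) = δ s - δ t

/-- The path distance of the flat metric: the infimum of the lengths of the paths from `x` to
`y`, where the length of a path is the length (total variation) of its development. -/
def flatEDist (x y : M) : ENNReal :=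
  ⨅ (γ : Path x y) (δ : unitInterval → ℂ) (_ : IsDevelopment γ δ), eVariationOn δ univ

/-- A curve defined for all times that moves with constant velocity `v` in the charts. -/
def IsFlowLine (v : ℂ) (c : ℝ → M) : Prop :=
  ∀ t : ℝ, ∃ e ∈ atlas ℂ M, c t ∈ e.source ∧
    ∀ᶠ s in 𝓝 t, c s ∈ e.source ∧ e (c s) = e (c t) + ((s - t : ℝ) : ℂ) * v

/-- The union of the flow lines of velocity `v` that are defined for all times. -/
def flowDomain (M : Type*) [TopologicalSpace M] [ChartedSpace ℂ M] (v : ℂ) : Set M :=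
  {x | ∃ c : ℝ → M, IsFlowLine v c ∧ c 0 = x}

/-- `y` is the first point of `P` on the flow line that starts at `x`, at positive times. -/
def IsFirstReturn (v : ℂ) (P : Set M) (x y : M) : Prop :=
  ∃ (c : ℝ → M) (τ : ℝ), IsFlowLine v c ∧ c 0 = x ∧ 0 < τ ∧ c τ = y ∧ y ∈ P ∧
    ∀ t ∈ Ioo 0 τ, c t ∉ P

/-- `f : U → V` is a translation covering of a subset `V` of the plane. -/
structure IsTranslationCovering {U : Set M} {V : Set ℂ} (f : U → V) : Prop where
  covering : IsCoveringMap f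
  translation : ∀ x : U, ∃ e ∈ atlas ℂ M, (x : M) ∈ e.source ∧
    ∀ᶠ y : U in 𝓝 x, (f y : ℂ) - f x = e (y : M) - e (x : M)

end TranslationSurface

/-! ### Metric completion and singularities -/

/-- A metric completion of the surface `M` with its path distance (it is unique up to isometry). -/
structure MetricCompletion (M : Type) [TopologicalSpace M] [ChartedSpace ℂ M] where
  /-- the underlying space of the completion -/
  Carrier : Type
  [metric : MetricSpace Carrier]
  [complete : CompleteSpace Carrier]
  /-- the canonical embedding -/
  ι : M → Carrier
  isometry : ∀ x y, edist (ι x) (ι y) = flatEDist x y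
  dense : DenseRange ι

attribute [instance] MetricCompletion.metric MetricCompletion.complete

namespace MetricCompletion

variable {M : Type} [TopologicalSpace M] [ChartedSpace ℂ M] (C : MetricCompletion M)

/-- The points which the completion adds to the surface. -/
def singularities : Set C.Carrier := (range C.ι)ᶜ

/-- The punctured `ε`-ball around `σ` lies in the surface and is a cyclic translation covering,
with `k` sheets, of the once-punctured disc of radius `ε`. As the fundamental group of
the punctured disc is `ℤ`, its cyclic coverings are exactly its connected coverings. -/
def IsCyclicCover (σ : C.Carrier) (ε : ℝ) (k : ℕ∞) : Prop :=
  Metric.ball σ ε \ {σ} ⊆ range C.ι ∧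
  IsConnected (C.ι ⁻¹' (Metric.ball σ ε \ {σ})) ∧
  ∃ f : (C.ι ⁻¹' (Metric.ball σ ε \ {σ}) : Set M) → (Metric.ball (0 : ℂ) ε \ {0} : Set ℂ),
    IsTranslationCovering f ∧ ∀ z, (f ⁻¹' {z}).encard = k

/-- A cone angle singularity of some finite multiplicity `k ≥ 1`, i.e. of cone angle `2πk`. -/
def IsConeSingularity (σ : C.Carrier) : Prop :=
  σ ∈ C.singularities ∧ ∃ ε : ℝ, 0 < ε ∧ ∃ k : ℕ, 1 ≤ k ∧ C.IsCyclicCover σ ε k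

/-- A wild singularity: no punctured ball around it is a finite or infinite cyclic translation
covering of a once-punctured disc. -/
def IsWildSingularity (σ : C.Carrier) : Prop :=
  σ ∈ C.singularities ∧ ¬ ∃ ε : ℝ, 0 < ε ∧ ∃ k : ℕ∞, C.IsCyclicCover σ ε k

end MetricCompletion

/-! ### Genus and ends -/

/-- The genus: the largest number of disjoint simple closed curves whose union does not
separate `X`. -/
def genus (X : Type*) [TopologicalSpace X] : ℕ∞ :=
  ⨆ (n : ℕ) (_ : ∃ c : Fin n → Circle → X, (∀ i, Continuous (c i)) ∧
    (∀ i, Function.Injective (c i)) ∧ (Pairwise fun i j => Disjoint (range (c i)) (range (c j))) ∧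
    IsConnected (⋃ i, range (c i))ᶜ), (n : ℕ∞)

/-- An end of a space: a coherent choice of a connected component of the complement of every
compact set. -/
@[ext]
structure TopEnd (X : Type*) [TopologicalSpace X] where
  /-- the chosen component of the complement of `K` -/
  comp : TopologicalSpace.Compacts X → Set X
  isComponent : ∀ K : TopologicalSpace.Compacts X, ∃ x ∈ (K : Set X)ᶜ, comp K = connectedComponentIn (K : Set X)ᶜ x
  anti : ∀ K K' : TopologicalSpace.Compacts X, K ≤ K' → comp K' ⊆ comp K

/-- An end is planar if it has a neighbourhood of genus zero. -/
def TopEnd.IsPlanar {X : Type*} [TopologicalSpace X] (e : TopEnd X) : Prop :=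
  ∃ K, genus (e.comp K) = 0

/-! ### Gluings of the unit square -/

/-- The closed unit square. -/
def unitSquare : Set ℂ := {z | z.re ∈ Icc (0 : ℝ) 1 ∧ z.im ∈ Icc (0 : ℝ) 1}

/-- Gluing data for the sides of the unit square: a countable closed set of boundary points,
containing the corners, is removed, and the rest of the upper (right) side is identified with the
rest of the lower (left) side by a bijection which is locally a translation, that is, which is
a translation on every component of the side with the points removed. -/
structure SquareGluing where
  /-- the points that are removed -/
  removed : Set ℂ
  removed_subset : removed ⊆ frontier unitSquare
  removed_countable : removed.Countable
  removed_closed : IsClosed removed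
  corners : ∀ z : ℂ, (z.re = 0 ∨ z.re = 1) → (z.im = 0 ∨ z.im = 1) → z ∈ removed
  /-- `(x, 1)` is identified with `(horiz x, 0)` -/
  horiz : ℝ → ℝ
  horiz_bijOn : BijOn horiz {x | x ∈ Ioo 0 1 ∧ Complex.mk x 1 ∉ removed}
    {x | x ∈ Ioo 0 1 ∧ Complex.mk x 0 ∉ removed}
  horiz_translation : ∀ x ∈ Ioo (0 : ℝ) 1, Complex.mk x 1 ∉ removed →
    ∀ᶠ x' in 𝓝 x, horiz x' - horiz x = x' - x
  /-- `(1, y)` is identified with `(0, vert y)` -/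
  vert : ℝ → ℝ
  vert_bijOn : BijOn vert {y | y ∈ Ioo 0 1 ∧ Complex.mk 1 y ∉ removed}
    {y | y ∈ Ioo 0 1 ∧ Complex.mk 0 y ∉ removed}
  vert_translation : ∀ y ∈ Ioo (0 : ℝ) 1, Complex.mk 1 y ∉ removed →
    ∀ᶠ y' in 𝓝 y, vert y' - vert y = y' - y

namespace SquareGluing

variable (G : SquareGluing)

/-- The unit square with the removed points taken out. -/
abbrev Points : Type := (unitSquare \ G.removed : Set ℂ)

/-- The identifications of the boundary points. -/
def Glued (z w : G.Points) : Prop :=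
  (z.1.im = 1 ∧ w.1 = Complex.mk (G.horiz z.1.re) 0) ∨
  (z.1.re = 1 ∧ w.1 = Complex.mk 0 (G.vert z.1.im))

/-- The surface: the quotient of the punctured square by the identifications. -/
def Surface : Type := Quot G.Glued

instance : TopologicalSpace G.Surface := inferInstanceAs (TopologicalSpace (Quot G.Glued))

instance : MeasurableSpace G.Surface := borel G.Surface

instance : BorelSpace G.Surface := ⟨rfl⟩

/-- The projection of the punctured square to the surface. -/
def proj (z : G.Points) : G.Surface := Quot.mk _ z

/-- The atlas of the surface is the one it inherits from the square: the projection is, in the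
charts, locally a translation. This determines the translation structure. -/
def IsInherited [ChartedSpace ℂ G.Surface] : Prop :=
  ∀ e ∈ atlas ℂ G.Surface, ∀ z : G.Points, G.proj z ∈ e.source →
    ∀ᶠ w in 𝓝 z, e (G.proj w) - e (G.proj z) = w.1 - z.1

/-- A point of the open lower side which is not removed. -/
def lowerPoint (x : ℝ) (hx : x ∈ Ioo (0 : ℝ) 1 ∧ Complex.mk x 0 ∉ G.removed) : G.Points :=
  ⟨Complex.mk x 0, ⟨⟨hx.1.1.le, hx.1.2.le⟩, ⟨le_refl 0, zero_le_one⟩⟩, hx.2⟩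

variable [ChartedSpace ℂ G.Surface]

/-- The coordinates of the points of the lower side whose flow line of velocity `v` is defined
for all times. -/
def sectionCoords (v : ℂ) : Set ℝ :=
  {x | ∃ hx : x ∈ Ioo (0 : ℝ) 1 ∧ Complex.mk x 0 ∉ G.removed,
    G.proj (G.lowerPoint x hx) ∈ flowDomain G.Surface v}

/-- The parametrization of the horizontal section by its coordinate. -/
def sectionParam (v : ℂ) (x : G.sectionCoords v) : G.Surface :=
  G.proj (G.lowerPoint x.1 x.2.choose)

/-- The horizontal section: the image in the surface of the lower side of the square,
within the domain of the flow. -/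
def horizontalSection (v : ℂ) : Set G.Surface := range (G.sectionParam v)

/-- The measure on the section that is induced by Lebesgue measure on the lower side. -/
def sectionMeasure (v : ℂ) : Measure (G.horizontalSection v) :=
  Measure.map (rangeFactorization (G.sectionParam v)) (Measure.comap Subtype.val volume)

end SquareGluing

/-! ### Rotated odometers -/

theorem exists_lt_one_sub_pow (x : Ico (0 : ℝ) 1) : ∃ n : ℕ, (x : ℝ) < 1 - (1 / 2) ^ n := by
  obtain ⟨n, hn⟩ := exists_pow_lt_of_lt_one (sub_pos.2 x.2.2) (by norm_num : (1 / 2 : ℝ) < 1)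
  exact ⟨n, by linarith⟩

open Classical in
/-- The index `n ≥ 1` of the interval `[1 - 2^(1-n), 1 - 2^(-n))` that contains `x`. -/
def dyadicIndex (x : Ico (0 : ℝ) 1) : ℕ := Nat.find (exists_lt_one_sub_pow x)

theorem dyadicIndex_spec (x : Ico (0 : ℝ) 1) : ∃ m : ℕ, dyadicIndex x = m + 1 ∧
    1 - (1 / 2) ^ m ≤ (x : ℝ) ∧ (x : ℝ) < 1 - (1 / 2) ^ (m + 1) := by
  classical
  have h := Nat.find_spec (exists_lt_one_sub_pow x)
  have hx := x.2.1
  rcases hm : dyadicIndex x with _ | m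
  · rw [dyadicIndex] at hm
    rw [hm] at h
    norm_num at h
    linarith
  · refine ⟨m, rfl, ?_, ?_⟩
    · have := Nat.find_min (exists_lt_one_sub_pow x) (m := m) (by
        rw [dyadicIndex] at hm; omega)
      exact not_lt.1 this
    · rw [dyadicIndex] at hm
      rwa [hm] at h

/-- The von Neumann-Kakutani map: `x ↦ x - (1 - 3 · 2^(-n))` on `[1 - 2^(1-n), 1 - 2^(-n))`. -/
def vonNeumannKakutani (x : Ico (0 : ℝ) 1) : Ico (0 : ℝ) 1 :=
  ⟨x - (1 - 3 * (1 / 2) ^ dyadicIndex x), by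
    obtain ⟨m, h1, h2, h3⟩ := dyadicIndex_spec x
    have h4 : (0 : ℝ) < (1 / 2) ^ m := by positivity
    have h5 : ((1 : ℝ) / 2) ^ m ≤ 1 := pow_le_one₀ (by norm_num) (by norm_num)
    rw [pow_succ] at h3
    rw [h1, pow_succ]
    constructor <;> linarith⟩

theorem vonNeumannKakutani_apply (n : ℕ) (x : Ico (0 : ℝ) 1)
    (h1 : 1 - (1 / 2) ^ n ≤ (x : ℝ)) (h2 : (x : ℝ) < 1 - (1 / 2) ^ (n + 1)) :
    (vonNeumannKakutani x : ℝ) = x - (1 - 3 * (1 / 2) ^ (n + 1)) := by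
  classical
  have h : dyadicIndex x = n + 1 := by
    rw [dyadicIndex, Nat.find_eq_iff]
    refine ⟨h2, fun k hk => not_lt.2 (le_trans ?_ h1)⟩
    have : ((1 : ℝ) / 2) ^ n ≤ (1 / 2) ^ k :=
      pow_le_pow_of_le_one (by norm_num) (by norm_num) (by omega)
    linarith
  simp [vonNeumannKakutani, h]

/-- The map of `[0, 1)` that carries the interval `[i/q, (i+1)/q)` to the interval
`[π(i)/q, (π(i)+1)/q)` by a translation, for `0 ≤ i < q`. (For `x` in `[0, 1)` and `q ≥ 1`, the
condition always holds.) -/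
def intervalPermutation {q : ℕ} (π : Equiv.Perm (Fin q)) (x : Ico (0 : ℝ) 1) : Ico (0 : ℝ) 1 :=
  if h : ⌊(q : ℝ) * x⌋₊ < q then
    ⟨x + (((π ⟨⌊(q : ℝ) * x⌋₊, h⟩ : ℕ) : ℝ) - ⌊(q : ℝ) * x⌋₊) / q, by
      have hq : (0 : ℝ) < q := by exact_mod_cast Nat.zero_lt_of_lt h
      have h0 : (0 : ℝ) ≤ q * x := mul_nonneg hq.le x.2.1
      have h1 := Nat.floor_le h0
      have h2 := Nat.lt_floor_add_one ((q : ℝ) * x)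
      have h3 : (((π ⟨⌊(q : ℝ) * x⌋₊, h⟩ : ℕ) : ℝ)) + 1 ≤ q := by
        exact_mod_cast (π ⟨⌊(q : ℝ) * x⌋₊, h⟩).2
      have h4 : (0 : ℝ) ≤ ((π ⟨⌊(q : ℝ) * x⌋₊, h⟩ : ℕ) : ℝ) := Nat.cast_nonneg _
      have h5 : (x : ℝ) + (((π ⟨⌊(q : ℝ) * x⌋₊, h⟩ : ℕ) : ℝ) - ⌊(q : ℝ) * x⌋₊) / q
          = (q * x + ((π ⟨⌊(q : ℝ) * x⌋₊, h⟩ : ℕ) : ℝ) - ⌊(q : ℝ) * x⌋₊) / q := by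
        field_simp
        ring
      rw [h5]
      constructor
      · apply div_nonneg _ hq.le
        linarith
      · rw [div_lt_one hq]
        linarith⟩
  else x

/-- Lebesgue measure on `[0, 1)`. -/
def lebesgueIco : Measure (Ico (0 : ℝ) 1) := Measure.comap Subtype.val volume

/-- The rotated odometer `F_π`. -/
def rotatedOdometer {q : ℕ} (π : Equiv.Perm (Fin q)) (x : Ico (0 : ℝ) 1) : Ico (0 : ℝ) 1 :=
  vonNeumannKakutani (intervalPermutation π x)

/-- Two measured dynamical systems are measurably isomorphic: after removing null sets there
is a measure preserving, bimeasurable bijection that intertwines the two maps. -/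
def MeasurablyIsomorphic {α β : Type*} [MeasurableSpace α] [MeasurableSpace β]
    (T : α → α) (μ : Measure α) (S : β → β) (ν : Measure β) : Prop :=
  ∃ (A : Set α) (B : Set β) (hT : MapsTo T A A) (hS : MapsTo S B B) (φ : A ≃ᵐ B),
    MeasurableSet A ∧ MeasurableSet B ∧ μ Aᶜ = 0 ∧ ν Bᶜ = 0 ∧
    MeasurePreserving φ (μ.comap Subtype.val) (ν.comap Subtype.val) ∧
    Function.Semiconj φ (hT.restrict T A A) (hS.restrict S B B)

end

noncomputable section

/-! ### The square -/

theorem unitSquare_eq : unitSquare = Icc (0 : ℝ) 1 ×ℂ Icc (0 : ℝ) 1 := rfl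

theorem isCompact_unitSquare : IsCompact unitSquare := by
  rw [unitSquare_eq]; exact isCompact_Icc.reProdIm isCompact_Icc

theorem isClosed_unitSquare : IsClosed unitSquare := isCompact_unitSquare.isClosed

theorem convex_unitSquare : Convex ℝ unitSquare := by
  exact ((convex_Icc (0 : ℝ) 1).is_linear_preimage Complex.reLm.isLinear).inter
    ((convex_Icc (0 : ℝ) 1).is_linear_preimage Complex.imLm.isLinear)

theorem mem_interior_unitSquare {z : ℂ} :
    z ∈ interior unitSquare ↔ z.re ∈ Ioo (0 : ℝ) 1 ∧ z.im ∈ Ioo (0 : ℝ) 1 := by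
  rw [unitSquare_eq, Complex.interior_reProdIm, interior_Icc]; rfl

theorem mem_frontier_unitSquare {z : ℂ} :
    z ∈ frontier unitSquare ↔ z ∈ unitSquare ∧ (z.re = 0 ∨ z.re = 1 ∨ z.im = 0 ∨ z.im = 1) := by
  rw [frontier, isClosed_unitSquare.closure_eq, Set.mem_sdiff, mem_interior_unitSquare]
  refine and_congr_right fun h => ?_
  obtain ⟨⟨h1, h2⟩, h3, h4⟩ := h
  constructor
  · intro h
    by_contra! hc
    exact h ⟨⟨lt_of_le_of_ne h1 (Ne.symm hc.1), lt_of_le_of_ne h2 hc.2.1⟩,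
      lt_of_le_of_ne h3 (Ne.symm hc.2.2.1), lt_of_le_of_ne h4 hc.2.2.2⟩
  · rintro h ⟨⟨a, b⟩, c, d⟩
    rcases h with h | h | h | h <;> linarith

theorem closure_interior_unitSquare : closure (interior unitSquare) = unitSquare := by
  rw [unitSquare_eq, Complex.interior_reProdIm, Complex.closure_reProdIm, interior_Icc,
    closure_Ioo zero_ne_one]

namespace SquareGluing

variable (G : SquareGluing)

theorem interior_subset_diff : interior unitSquare ⊆ unitSquare \ G.removed := fun _ hz =>
  ⟨interior_subset hz, fun h => (G.removed_subset h).2 hz⟩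

theorem re_mem_Ioo {z : ℂ} (hz : z ∈ unitSquare \ G.removed) (h : z.im = 0 ∨ z.im = 1) :
    z.re ∈ Ioo (0 : ℝ) 1 := by
  obtain ⟨⟨⟨h1, h2⟩, -⟩, h3⟩ := hz
  exact ⟨lt_of_le_of_ne h1 fun h0 => h3 (G.corners z (Or.inl h0.symm) h),
    lt_of_le_of_ne h2 fun h0 => h3 (G.corners z (Or.inr h0) h)⟩

theorem im_mem_Ioo {z : ℂ} (hz : z ∈ unitSquare \ G.removed) (h : z.re = 0 ∨ z.re = 1) :
    z.im ∈ Ioo (0 : ℝ) 1 := by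
  obtain ⟨⟨-, h1, h2⟩, h3⟩ := hz
  exact ⟨lt_of_le_of_ne h1 fun h0 => h3 (G.corners z h (Or.inl h0.symm)),
    lt_of_le_of_ne h2 fun h0 => h3 (G.corners z h (Or.inr h0))⟩

variable {G}

theorem top_mem {z : G.Points} (h : z.1.im = 1) :
    z.1.re ∈ {x | x ∈ Ioo (0 : ℝ) 1 ∧ Complex.mk x 1 ∉ G.removed} := by
  refine ⟨G.re_mem_Ioo z.2 (Or.inr h), ?_⟩
  have : Complex.mk z.1.re 1 = z.1 := Complex.ext rfl h.symm
  rw [this]; exact z.2.2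

theorem right_mem {z : G.Points} (h : z.1.re = 1) :
    z.1.im ∈ {y | y ∈ Ioo (0 : ℝ) 1 ∧ Complex.mk 1 y ∉ G.removed} := by
  refine ⟨G.im_mem_Ioo z.2 (Or.inr h), ?_⟩
  have : Complex.mk 1 z.1.im = z.1 := Complex.ext h.symm rfl
  rw [this]; exact z.2.2

theorem Glued.source {z w : G.Points} (h : G.Glued z w) : z.1.im = 1 ∨ z.1.re = 1 :=
  h.imp And.left And.left

theorem Glued.target {z w : G.Points} (h : G.Glued z w) :
    z.1.im = 1 ∧ w.1.im = 0 ∧ w.1.re = G.horiz z.1.re ∧ w.1.re ∈ Ioo (0 : ℝ) 1 ∧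
      z.1.re ∈ Ioo (0 : ℝ) 1 ∨
    z.1.re = 1 ∧ w.1.re = 0 ∧ w.1.im = G.vert z.1.im ∧ w.1.im ∈ Ioo (0 : ℝ) 1 ∧
      z.1.im ∈ Ioo (0 : ℝ) 1 := by
  rcases h with ⟨h1, h2⟩ | ⟨h1, h2⟩
  · exact Or.inl ⟨h1, by rw [h2], by rw [h2], by rw [h2]; exact (G.horiz_bijOn.mapsTo (top_mem h1)).1,
      (top_mem h1).1⟩
  · exact Or.inr ⟨h1, by rw [h2], by rw [h2], by rw [h2]; exact (G.vert_bijOn.mapsTo (right_mem h1)).1,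
      (right_mem h1).1⟩

theorem Glued.not_glued {z w y : G.Points} (h : G.Glued z w) : ¬ G.Glued w y := by
  intro h'
  rcases h.target with ⟨_, h2, _, ⟨h3, h4⟩, _⟩ | ⟨_, h2, _, ⟨h3, h4⟩, _⟩ <;>
    rcases h'.source with h5 | h5 <;> linarith

theorem Glued.right_unique {z w y : G.Points} (h : G.Glued z w) (h' : G.Glued z y) : w = y := by
  rcases h.target with ⟨h1, h2, h3, h4, h4', h4''⟩ | ⟨h1, h2, h3, h4, h4', h4''⟩ <;>
    rcases h'.target with ⟨h5, h6, h7, h8, h8'⟩ | ⟨h5, h6, h7, h8, h8'⟩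
  · exact Subtype.ext (Complex.ext (h3.trans h7.symm) (h2.trans h6.symm))
  · linarith
  · linarith [h8'.2]
  · exact Subtype.ext (Complex.ext (h2.trans h6.symm) (h3.trans h7.symm))

theorem Glued.left_unique {z w y : G.Points} (h : G.Glued w z) (h' : G.Glued y z) : w = y := by
  rcases h.target with ⟨h1, h2, h3, h4, h4'⟩ | ⟨h1, h2, h3, h4, h4'⟩ <;>
    rcases h'.target with ⟨h5, h6, h7, h8, h8'⟩ | ⟨h5, h6, h7, h8, h8'⟩
  · refine Subtype.ext (Complex.ext ?_ (h1.trans h5.symm))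
    exact G.horiz_bijOn.injOn (top_mem h1) (top_mem h5) (h3.symm.trans h7)
  · linarith [h4.1]
  · linarith [h4.1]
  · refine Subtype.ext (Complex.ext (h1.trans h5.symm) ?_)
    exact G.vert_bijOn.injOn (right_mem h1) (right_mem h5) (h3.symm.trans h7)

/-- Two points of the square have the same image in the surface if and only if they are equal or
one is glued to the other. -/
theorem proj_eq_iff {z w : G.Points} :
    G.proj z = G.proj w ↔ z = w ∨ G.Glued z w ∨ G.Glued w z := by
  constructor
  · intro h
    have h1 := Quot.eqvGen_exact h
    have heq : Equivalence fun z w : G.Points => z = w ∨ G.Glued z w ∨ G.Glued w z := by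
      refine ⟨fun z => Or.inl rfl, ?_, ?_⟩
      · rintro z w (h | h | h)
        · exact Or.inl h.symm
        · exact Or.inr (Or.inr h)
        · exact Or.inr (Or.inl h)
      · rintro z w y (rfl | h | h) (rfl | h' | h')
        · exact Or.inl rfl
        · exact Or.inr (Or.inl h')
        · exact Or.inr (Or.inr h')
        · exact Or.inr (Or.inl h)
        · exact (h.not_glued h').elim
        · exact Or.inl (h.left_unique h')
        · exact Or.inr (Or.inr h)
        · exact Or.inl (h.right_unique h')
        · exact (h'.not_glued h).elim
    exact (heq.eqvGen_iff).1 (h1.mono fun a b h => Or.inr (Or.inl h))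
  · rintro (rfl | h | h)
    · rfl
    · exact Quot.sound h
    · exact (Quot.sound h).symm

theorem proj_surjective : Function.Surjective G.proj := Quot.mk_surjective

/-- A point of the punctured square over a point of the surface. -/
def rep (m : G.Surface) : G.Points := Function.surjInv proj_surjective m

theorem proj_rep (m : G.Surface) : G.proj (rep m) = m := Function.surjInv_eq _ _

theorem isQuotientMap_proj : IsQuotientMap G.proj := isQuotientMap_quot_mk

theorem continuous_proj : Continuous G.proj := isQuotientMap_proj.continuous

/-- The centre of the square. -/
def centre (G : SquareGluing) : G.Points :=
  ⟨⟨1 / 2, 1 / 2⟩, G.interior_subset_diff (mem_interior_unitSquare.2 (by norm_num))⟩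

instance : Nonempty G.Surface := ⟨G.proj G.centre⟩

open Classical in
/-- The projection as a map on the plane, with an arbitrary value outside the punctured square. -/
def projC (G : SquareGluing) (z : ℂ) : G.Surface :=
  if h : z ∈ unitSquare \ G.removed then G.proj ⟨z, h⟩ else G.proj G.centre

theorem projC_of_mem {z : ℂ} (h : z ∈ unitSquare \ G.removed) : G.projC z = G.proj ⟨z, h⟩ :=
  dif_pos h

theorem projC_coe (z : G.Points) : G.projC z = G.proj z := projC_of_mem z.2

theorem continuousOn_projC : ContinuousOn G.projC (unitSquare \ G.removed) := by
  rw [continuousOn_iff_continuous_domRestrict]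
  exact continuous_proj.congr fun z => (projC_coe z).symm

/-! ### Charts -/

/-- The plane open set `B` is developed into the surface by the projection on `B` and on its
translate `B + τ`, which are disjoint and match along the sides of the square. -/
structure FlatPatch (G : SquareGluing) where
  /-- the image of the chart -/
  B : Set ℂ
  /-- the translation vector -/
  τ : ℂ
  isOpen : IsOpen B
  cover : ∀ w ∈ B, w ∈ unitSquare ∨ w + τ ∈ unitSquare
  avoid : ∀ w ∈ B, w ∈ unitSquare → w ∉ G.removed
  avoid' : ∀ w ∈ B, w + τ ∈ unitSquare → w + τ ∉ G.removed
  glue : ∀ w ∈ B, w ∈ unitSquare → w + τ ∈ unitSquare → G.projC w = G.projC (w + τ)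
  sat : ∀ z z' : G.Points, G.proj z = G.proj z' → z.1 ∈ B → z' = z ∨ z'.1 = z.1 + τ
  sat' : ∀ z z' : G.Points, G.proj z = G.proj z' → z.1 - τ ∈ B → z' = z ∨ z'.1 = z.1 - τ
  disj : ∀ w ∈ B, w + τ ∉ B

namespace FlatPatch

variable (D : FlatPatch G)

/-- The points of the punctured square which the chart covers. -/
def domain : Set G.Points := {z | z.1 ∈ D.B ∨ z.1 - D.τ ∈ D.B}

open Classical in
/-- The chart, as a function on the punctured square. -/
def read (z : G.Points) : ℂ := if z.1 ∈ D.B then z.1 else z.1 - D.τ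

open Classical in
/-- The inverse of the chart. -/
def develop (w : ℂ) : G.Surface := if w ∈ unitSquare then G.projC w else G.projC (w + D.τ)

theorem read_of_mem {z : G.Points} (h : z.1 ∈ D.B) : D.read z = z.1 := if_pos h

theorem read_of_mem' {z : G.Points} (h : z.1 - D.τ ∈ D.B) : D.read z = z.1 - D.τ := by
  refine if_neg fun h' => D.disj _ h ?_
  rwa [sub_add_cancel]

theorem isOpen_domain : IsOpen D.domain :=
  (D.isOpen.preimage continuous_subtype_val).union
    (D.isOpen.preimage (continuous_subtype_val.sub continuous_const))

theorem read_mem {z : G.Points} (h : z ∈ D.domain) : D.read z ∈ D.B := by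
  rcases h with h | h
  · rwa [D.read_of_mem h]
  · rwa [D.read_of_mem' h]

theorem proj_congr {z z' : G.Points} (h : G.proj z = G.proj z') (hz : z ∈ D.domain) :
    z' ∈ D.domain ∧ D.read z' = D.read z := by
  rcases hz with hz | hz
  · rcases D.sat z z' h hz with rfl | h'
    · exact ⟨Or.inl hz, rfl⟩
    · have h2 : z'.1 - D.τ ∈ D.B := by rwa [h', add_sub_cancel_right]
      exact ⟨Or.inr h2, by rw [D.read_of_mem hz, D.read_of_mem' h2, h', add_sub_cancel_right]⟩
  · rcases D.sat' z z' h hz with rfl | h'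
    · exact ⟨Or.inr hz, rfl⟩
    · have h2 : z'.1 ∈ D.B := by rwa [h']
      exact ⟨Or.inl h2, by rw [D.read_of_mem' hz, D.read_of_mem h2, h']⟩

theorem preimage_image_domain : G.proj ⁻¹' (G.proj '' D.domain) = D.domain := by
  refine Subset.antisymm ?_ (subset_preimage_image _ _)
  rintro z ⟨w, hw, h⟩
  exact (D.proj_congr h hw).1

theorem continuousOn_read : ContinuousOn D.read D.domain := by
  intro z hz
  refine ContinuousAt.continuousWithinAt ?_
  rcases hz with hz | hz
  · have : ∀ᶠ w in 𝓝 z, D.read w = w.1 := by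
      filter_upwards [(D.isOpen.preimage continuous_subtype_val).mem_nhds hz] with w hw
      exact D.read_of_mem hw
    exact (continuous_subtype_val.continuousAt).congr (this.mono fun _ h => h.symm)
  · have : ∀ᶠ w : G.Points in 𝓝 z, D.read w = w.1 - D.τ := by
      filter_upwards [(D.isOpen.preimage
        (continuous_subtype_val.sub continuous_const)).mem_nhds hz] with w hw
      exact D.read_of_mem' hw
    have hc : Continuous fun w : G.Points => w.1 - D.τ := by fun_prop
    exact hc.continuousAt.congr (this.mono fun _ h => h.symm)

theorem develop_of_mem {w : ℂ} (hw : w ∈ D.B) (h : w ∈ unitSquare) :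
    D.develop w = G.proj ⟨w, h, D.avoid w hw h⟩ := by
  rw [develop, if_pos h, projC_of_mem ⟨h, D.avoid w hw h⟩]

theorem develop_of_mem' {w : ℂ} (hw : w ∈ D.B) (h : w + D.τ ∈ unitSquare) :
    D.develop w = G.proj ⟨w + D.τ, h, D.avoid' w hw h⟩ := by
  by_cases h' : w ∈ unitSquare
  · rw [develop, if_pos h', D.glue w hw h' h, projC_of_mem ⟨h, D.avoid' w hw h⟩]
  · rw [develop, if_neg h', projC_of_mem ⟨h, D.avoid' w hw h⟩]

theorem develop_read {z : G.Points} (h : z ∈ D.domain) : D.develop (D.read z) = G.proj z := by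
  rcases h with h | h
  · rw [D.read_of_mem h, D.develop_of_mem h z.2.1]
  · rw [D.read_of_mem' h, D.develop_of_mem' h (by rw [sub_add_cancel]; exact z.2.1)]
    simp only [sub_add_cancel]

theorem exists_develop {w : ℂ} (hw : w ∈ D.B) :
    ∃ z ∈ D.domain, G.proj z = D.develop w ∧ D.read z = w := by
  rcases D.cover w hw with h | h
  · exact ⟨⟨w, h, D.avoid w hw h⟩, Or.inl hw, (D.develop_of_mem hw h).symm, D.read_of_mem hw⟩
  · have : w + D.τ - D.τ ∈ D.B := by rwa [add_sub_cancel_right]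
    exact ⟨⟨w + D.τ, h, D.avoid' w hw h⟩, Or.inr this, (D.develop_of_mem' hw h).symm,
      (D.read_of_mem' this).trans (add_sub_cancel_right _ _)⟩

theorem continuousOn_develop : ContinuousOn D.develop D.B := by
  have h1 : ContinuousOn D.develop (D.B ∩ unitSquare) := by
    have : ContinuousOn G.projC (D.B ∩ unitSquare) :=
      continuousOn_projC.mono fun w hw => ⟨hw.2, D.avoid w hw.1 hw.2⟩
    exact this.congr fun w hw => if_pos hw.2
  have h2 : ContinuousOn D.develop (D.B ∩ {w | w + D.τ ∈ unitSquare}) := by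
    have : ContinuousOn (fun w => G.projC (w + D.τ)) (D.B ∩ {w | w + D.τ ∈ unitSquare}) :=
      continuousOn_projC.comp (by fun_prop) fun w hw => ⟨hw.2, D.avoid' w hw.1 hw.2⟩
    refine this.congr fun w hw => ?_
    exact (D.develop_of_mem' hw.1 hw.2).trans (projC_of_mem ⟨hw.2, D.avoid' w hw.1 hw.2⟩).symm
  intro w hw
  have h3 : ContinuousWithinAt D.develop (D.B ∩ unitSquare) w := by
    by_cases h : w ∈ unitSquare
    · exact h1 w ⟨hw, h⟩
    · refine continuousWithinAt_of_notMem_closure fun h' => h ?_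
      exact isClosed_unitSquare.closure_subset_iff.2 inter_subset_right h'
  have h4 : ContinuousWithinAt D.develop (D.B ∩ {w | w + D.τ ∈ unitSquare}) w := by
    by_cases h : w + D.τ ∈ unitSquare
    · exact h2 w ⟨hw, h⟩
    · refine continuousWithinAt_of_notMem_closure fun h' => h ?_
      have hc : IsClosed {w | w + D.τ ∈ unitSquare} :=
        isClosed_unitSquare.preimage (continuous_id.add continuous_const)
      exact hc.closure_subset_iff.2 inter_subset_right h'
  refine (h3.union h4).mono fun x hx => ?_
  exact (D.cover x hx).imp (fun h => ⟨hx, h⟩) fun h => ⟨hx, h⟩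

/-- The chart of a patch. -/
def chart : OpenPartialHomeomorph G.Surface ℂ where
  toFun m := D.read (rep m)
  invFun := D.develop
  source := G.proj '' D.domain
  target := D.B
  map_source' := by
    rintro _ ⟨z, hz, rfl⟩
    have h : G.proj z = G.proj (rep (G.proj z)) := (proj_rep _).symm
    exact D.read_mem (D.proj_congr h hz).1
  map_target' := by
    intro w hw
    obtain ⟨z, hz, h, -⟩ := D.exists_develop hw
    exact ⟨z, hz, h⟩
  left_inv' := by
    rintro _ ⟨z, hz, rfl⟩
    have h : G.proj z = G.proj (rep (G.proj z)) := (proj_rep _).symm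
    rw [(D.proj_congr h hz).2, D.develop_read hz]
  right_inv' := by
    intro w hw
    obtain ⟨z, hz, h, h'⟩ := D.exists_develop hw
    rw [← h]
    have h : G.proj z = G.proj (rep (G.proj z)) := (proj_rep _).symm
    rw [(D.proj_congr h hz).2, h']
  open_source := by
    rw [← isQuotientMap_proj.isOpen_preimage, preimage_image_domain]
    exact D.isOpen_domain
  open_target := D.isOpen
  continuousOn_toFun := by
    have ho : IsOpen (G.proj '' D.domain) := by
      rw [← isQuotientMap_proj.isOpen_preimage, preimage_image_domain]
      exact D.isOpen_domain
    rw [isQuotientMap_proj.continuousOn_isOpen_iff ho, preimage_image_domain]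
    refine D.continuousOn_read.congr fun z hz => ?_
    have h : G.proj z = G.proj (rep (G.proj z)) := (proj_rep _).symm
    exact (D.proj_congr h hz).2
  continuousOn_invFun := D.continuousOn_develop

theorem chart_proj {z : G.Points} (hz : z ∈ D.domain) : D.chart (G.proj z) = D.read z := by
  have h : G.proj z = G.proj (rep (G.proj z)) := (proj_rep _).symm
  exact (D.proj_congr h hz).2

theorem mem_chart_source {z : G.Points} : G.proj z ∈ D.chart.source ↔ z ∈ D.domain := by
  conv_rhs => rw [← D.preimage_image_domain]
  rfl

end FlatPatch

end SquareGluing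

namespace SquareGluing

variable {G : SquareGluing}

theorem exists_interior_patch (G : SquareGluing) :
    ∃ D : FlatPatch G, D.B = interior unitSquare := by
  have hsq : ∀ w : ℂ, w ∈ interior unitSquare → w + 10 ∉ unitSquare := by
    intro w hw h
    have a := (mem_interior_unitSquare.1 hw).1.1
    have b := h.1.2
    simp at b
    linarith
  refine ⟨⟨interior unitSquare, 10, isOpen_interior, fun w hw => Or.inl (interior_subset hw),
    fun w hw _ => (G.interior_subset_diff hw).2, fun w hw h => (hsq w hw h).elim,
    fun w hw _ h => (hsq w hw h).elim, ?_, ?_, fun w hw h => hsq w hw (interior_subset h)⟩, rfl⟩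
  · intro z z' h hz
    obtain ⟨⟨a, b⟩, c, d⟩ := mem_interior_unitSquare.1 hz
    rcases proj_eq_iff.1 h with h | h | h
    · exact Or.inl h.symm
    · rcases h.source with h | h <;> linarith
    · rcases h.target with ⟨_, h, _⟩ | ⟨_, h, _⟩ <;> linarith
  · intro z z' _ hz
    have := hsq _ hz
    rw [sub_add_cancel] at this
    exact (this z.2.1).elim

theorem exists_horizontal_patch {x : ℝ} (hx : x ∈ Ioo (0 : ℝ) 1) (hr : Complex.mk x 1 ∉ G.removed) :
    ∃ D : FlatPatch G, Complex.mk (G.horiz x) 0 ∈ D.B ∧ Complex.mk x 1 - D.τ ∈ D.B := by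
  have hy := G.horiz_bijOn.mapsTo (show x ∈ {x | x ∈ Ioo (0 : ℝ) 1 ∧ Complex.mk x 1 ∉ G.removed} from
    ⟨hx, hr⟩)
  obtain ⟨hy, hr'⟩ := hy
  set y := G.horiz x with hydef
  have e1 : ∀ᶠ r : ℝ in 𝓝[>] 0, ∀ s ∈ Metric.ball x r, G.horiz s - y = s - x := by
    obtain ⟨ε, hε, h⟩ := Metric.eventually_nhds_iff_ball.1 (G.horiz_translation x hx hr)
    filter_upwards [Ioo_mem_nhdsGT hε] with r hr' s hs
    exact h s (Metric.ball_subset_ball hr'.2.le hs)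
  have e2 : ∀ z : ℂ, z ∉ G.removed → ∀ᶠ r : ℝ in 𝓝[>] 0, ∀ w ∈ Metric.ball z r, w ∉ G.removed := by
    intro z hz
    obtain ⟨ε, hε, h⟩ := Metric.isOpen_iff.1 G.removed_closed.isOpen_compl z hz
    filter_upwards [Ioo_mem_nhdsGT hε] with r hr' s hs
    exact h (Metric.ball_subset_ball hr'.2.le hs)
  have e3 : ∀ᶠ r : ℝ in 𝓝[>] 0, r < 1 / 2 ∧ r < x ∧ r < 1 - x ∧ r < y ∧ r < 1 - y ∧ 0 < r := by
    have h := hx.1; have h2 := hx.2; have h3 := hy.1; have h4 := hy.2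
    filter_upwards [Ioo_mem_nhdsGT (show (0 : ℝ) < 1 / 2 by norm_num), Ioo_mem_nhdsGT h,
      Ioo_mem_nhdsGT (sub_pos.2 h2), Ioo_mem_nhdsGT h3, Ioo_mem_nhdsGT (sub_pos.2 h4)]
      with r a b c d e
    exact ⟨a.2, b.2, c.2, d.2, e.2, a.1⟩
  obtain ⟨r, h1, h2, h3, h4, h5, h6, h7, h8, h9⟩ :=
    (e1.and ((e2 _ hr).and ((e2 _ hr').and e3))).exists
  set τ : ℂ := Complex.mk (x - y) 1 with hτ
  have tre : τ.re = x - y := rfl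
  have tim : τ.im = 1 := rfl
  have hB : ∀ w ∈ Metric.ball (Complex.mk y 0) r, |w.re - y| < r ∧ |w.im| < r := by
    intro w hw
    rw [Metric.mem_ball, dist_eq_norm] at hw
    have a := (Complex.abs_re_le_norm _).trans_lt hw
    have b := (Complex.abs_im_le_norm _).trans_lt hw
    simp only [Complex.sub_re, Complex.sub_im, sub_zero] at a b
    exact ⟨a, b⟩
  have hT : ∀ w ∈ Metric.ball (Complex.mk y 0) r, w + τ ∈ Metric.ball (Complex.mk x 1) r := by
    intro w hw
    rw [Metric.mem_ball, dist_eq_norm] at hw ⊢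
    have : w + τ - Complex.mk x 1 = w - Complex.mk y 0 := by
      apply Complex.ext <;> (simp [hτ]; try ring)
    rwa [this]
  have hS : ∀ w ∈ Metric.ball (Complex.mk y 0) r, G.horiz (w.re + (x - y)) = w.re := by
    intro w hw
    have := h1 (w.re + (x - y)) (by
      rw [Metric.mem_ball, Real.dist_eq]
      have := (hB w hw).1
      have h10 : w.re + (x - y) - x = w.re - y := by ring
      rwa [h10])
    linarith
  have hsq : ∀ w : ℂ, w ∈ unitSquare → 0 ≤ w.re ∧ w.re ≤ 1 ∧ 0 ≤ w.im ∧ w.im ≤ 1 := fun w hw =>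
    ⟨hw.1.1, hw.1.2, hw.2.1, hw.2.2⟩
  refine ⟨⟨Metric.ball (Complex.mk y 0) r, τ, Metric.isOpen_ball, ?_, fun w hw _ => h3 w hw,
    fun w hw _ => h2 _ (hT w hw), ?_, ?_, ?_, ?_⟩, Metric.mem_ball_self h9, ?_⟩
  · intro w hw
    obtain ⟨a, b⟩ := hB w hw
    rw [abs_lt] at a b
    rcases le_total 0 w.im with h | h
    · left
      exact ⟨⟨by linarith, by linarith⟩, ⟨h, by linarith⟩⟩
    · right
      exact ⟨⟨by rw [Complex.add_re]; linarith, by rw [Complex.add_re]; linarith⟩,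
        by rw [Complex.add_im]; linarith, by rw [Complex.add_im]; linarith⟩
  · intro w hw hw1 hw2
    have hw0 : w.im = 0 := by
      have a := (hsq _ hw2).2.2.2
      have b := (hsq _ hw1).2.2.1
      rw [Complex.add_im, tim] at a
      linarith
    rw [projC_of_mem ⟨hw1, h3 w hw⟩, projC_of_mem ⟨hw2, h2 _ (hT w hw)⟩]
    refine proj_eq_iff.2 (Or.inr (Or.inr (Or.inl ⟨?_, ?_⟩)))
    · change (w + τ).im = 1
      rw [Complex.add_im, hw0, tim, zero_add]
    · change w = Complex.mk (G.horiz (w + τ).re) 0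
      rw [Complex.add_re, tre, hS w hw, ← hw0]
  · intro z z' hzz hz
    obtain ⟨a, b⟩ := hB _ hz
    rw [abs_lt] at a b
    rcases proj_eq_iff.1 hzz with h | h | h
    · exact Or.inl h.symm
    · rcases h.source with h | h <;> linarith
    · rcases h.target with ⟨b1, b2, b3, b4, b5⟩ | ⟨b1, b2, b3, b4, b5⟩
      · right
        have h11 := top_mem b1
        have h12 : z.1.re + (x - y) ∈ {x | x ∈ Ioo (0 : ℝ) 1 ∧ Complex.mk x 1 ∉ G.removed} := by
          refine ⟨⟨by linarith, by linarith⟩, ?_⟩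
          have := h2 _ (hT _ hz)
          have h13 : Complex.mk (z.1.re + (x - y)) 1 = z.1 + τ := by
            apply Complex.ext <;> simp [hτ, b2]
          rwa [h13]
        have h13 := G.horiz_bijOn.injOn h11 h12 (by rw [hS _ hz]; exact b3.symm)
        apply Complex.ext <;> simp [hτ, b1, b2, h13]
      · linarith
  · intro z z' hzz hz
    obtain ⟨a, b⟩ := hB _ hz
    rw [abs_lt, Complex.sub_re, tre] at a
    rw [abs_lt, Complex.sub_im, tim] at b
    rcases proj_eq_iff.1 hzz with h | h | h
    · exact Or.inl h.symm
    · rcases h.target with ⟨b1, b2, b3, b4, b5⟩ | ⟨b1, b2, b3, b4, b5⟩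
      · right
        have h13 := hS _ hz
        rw [Complex.sub_re, tre, sub_add_cancel, ← b3] at h13
        apply Complex.ext <;> simp [hτ, b1, b2, h13]
      · linarith
    · rcases h.target with ⟨b1, b2, b3, b4, b5⟩ | ⟨b1, b2, b3, b4, b5⟩ <;> linarith
  · intro w hw hw'
    have a := (hB _ hw).2
    have b := (hB _ hw').2
    rw [Complex.add_im, tim] at b
    rw [abs_lt] at a b
    linarith
  · have : Complex.mk x 1 - τ = Complex.mk y 0 := by
      apply Complex.ext <;> simp [hτ]
    rw [this]
    exact Metric.mem_ball_self h9


theorem exists_vertical_patch {x : ℝ} (hx : x ∈ Ioo (0 : ℝ) 1) (hr : Complex.mk 1 x ∉ G.removed) :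
    ∃ D : FlatPatch G, Complex.mk 0 (G.vert x) ∈ D.B ∧ Complex.mk 1 x - D.τ ∈ D.B := by
  have hy := G.vert_bijOn.mapsTo (show x ∈ {x | x ∈ Ioo (0 : ℝ) 1 ∧ Complex.mk 1 x ∉ G.removed} from
    ⟨hx, hr⟩)
  obtain ⟨hy, hr'⟩ := hy
  set y := G.vert x with hydef
  have e1 : ∀ᶠ r : ℝ in 𝓝[>] 0, ∀ s ∈ Metric.ball x r, G.vert s - y = s - x := by
    obtain ⟨ε, hε, h⟩ := Metric.eventually_nhds_iff_ball.1 (G.vert_translation x hx hr)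
    filter_upwards [Ioo_mem_nhdsGT hε] with r hr' s hs
    exact h s (Metric.ball_subset_ball hr'.2.le hs)
  have e2 : ∀ z : ℂ, z ∉ G.removed → ∀ᶠ r : ℝ in 𝓝[>] 0, ∀ w ∈ Metric.ball z r, w ∉ G.removed := by
    intro z hz
    obtain ⟨ε, hε, h⟩ := Metric.isOpen_iff.1 G.removed_closed.isOpen_compl z hz
    filter_upwards [Ioo_mem_nhdsGT hε] with r hr' s hs
    exact h (Metric.ball_subset_ball hr'.2.le hs)
  have e3 : ∀ᶠ r : ℝ in 𝓝[>] 0, r < 1 / 2 ∧ r < x ∧ r < 1 - x ∧ r < y ∧ r < 1 - y ∧ 0 < r := by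
    have h := hx.1; have h2 := hx.2; have h3 := hy.1; have h4 := hy.2
    filter_upwards [Ioo_mem_nhdsGT (show (0 : ℝ) < 1 / 2 by norm_num), Ioo_mem_nhdsGT h,
      Ioo_mem_nhdsGT (sub_pos.2 h2), Ioo_mem_nhdsGT h3, Ioo_mem_nhdsGT (sub_pos.2 h4)]
      with r a b c d e
    exact ⟨a.2, b.2, c.2, d.2, e.2, a.1⟩
  obtain ⟨r, h1, h2, h3, h4, h5, h6, h7, h8, h9⟩ :=
    (e1.and ((e2 _ hr).and ((e2 _ hr').and e3))).exists
  set τ : ℂ := Complex.mk 1 (x - y) with hτ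
  have tre : τ.im = x - y := rfl
  have tim : τ.re = 1 := rfl
  have hB : ∀ w ∈ Metric.ball (Complex.mk 0 y) r, |w.im - y| < r ∧ |w.re| < r := by
    intro w hw
    rw [Metric.mem_ball, dist_eq_norm] at hw
    have a := (Complex.abs_im_le_norm _).trans_lt hw
    have b := (Complex.abs_re_le_norm _).trans_lt hw
    simp only [Complex.sub_re, Complex.sub_im, sub_zero] at a b
    exact ⟨a, b⟩
  have hT : ∀ w ∈ Metric.ball (Complex.mk 0 y) r, w + τ ∈ Metric.ball (Complex.mk 1 x) r := by
    intro w hw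
    rw [Metric.mem_ball, dist_eq_norm] at hw ⊢
    have : w + τ - Complex.mk 1 x = w - Complex.mk 0 y := by
      apply Complex.ext <;> (simp [hτ]; try ring)
    rwa [this]
  have hS : ∀ w ∈ Metric.ball (Complex.mk 0 y) r, G.vert (w.im + (x - y)) = w.im := by
    intro w hw
    have := h1 (w.im + (x - y)) (by
      rw [Metric.mem_ball, Real.dist_eq]
      have := (hB w hw).1
      have h10 : w.im + (x - y) - x = w.im - y := by ring
      rwa [h10])
    linarith
  have hsq : ∀ w : ℂ, w ∈ unitSquare → 0 ≤ w.im ∧ w.im ≤ 1 ∧ 0 ≤ w.re ∧ w.re ≤ 1 := fun w hw =>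
    ⟨hw.2.1, hw.2.2, hw.1.1, hw.1.2⟩
  refine ⟨⟨Metric.ball (Complex.mk 0 y) r, τ, Metric.isOpen_ball, ?_, fun w hw _ => h3 w hw,
    fun w hw _ => h2 _ (hT w hw), ?_, ?_, ?_, ?_⟩, Metric.mem_ball_self h9, ?_⟩
  · intro w hw
    obtain ⟨a, b⟩ := hB w hw
    rw [abs_lt] at a b
    rcases le_total 0 w.re with h | h
    · left
      exact ⟨⟨h, by linarith⟩, ⟨by linarith, by linarith⟩⟩
    · right
      exact ⟨⟨by rw [Complex.add_re]; linarith, by rw [Complex.add_re]; linarith⟩,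
        by rw [Complex.add_im]; linarith, by rw [Complex.add_im]; linarith⟩
  · intro w hw hw1 hw2
    have hw0 : w.re = 0 := by
      have a := (hsq _ hw2).2.2.2
      have b := (hsq _ hw1).2.2.1
      rw [Complex.add_re, tim] at a
      linarith
    rw [projC_of_mem ⟨hw1, h3 w hw⟩, projC_of_mem ⟨hw2, h2 _ (hT w hw)⟩]
    refine proj_eq_iff.2 (Or.inr (Or.inr (Or.inr ⟨?_, ?_⟩)))
    · change (w + τ).re = 1
      rw [Complex.add_re, hw0, tim, zero_add]
    · change w = Complex.mk 0 (G.vert (w + τ).im)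
      rw [Complex.add_im, tre, hS w hw, ← hw0]
  · intro z z' hzz hz
    obtain ⟨a, b⟩ := hB _ hz
    rw [abs_lt] at a b
    rcases proj_eq_iff.1 hzz with h | h | h
    · exact Or.inl h.symm
    · rcases h.source with h | h <;> linarith
    · rcases h.target.symm with ⟨b1, b2, b3, b4, b5⟩ | ⟨b1, b2, b3, b4, b5⟩
      · right
        have h11 := right_mem b1
        have h12 : z.1.im + (x - y) ∈ {x | x ∈ Ioo (0 : ℝ) 1 ∧ Complex.mk 1 x ∉ G.removed} := by
          refine ⟨⟨by linarith, by linarith⟩, ?_⟩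
          have := h2 _ (hT _ hz)
          have h13 : Complex.mk 1 (z.1.im + (x - y)) = z.1 + τ := by
            apply Complex.ext <;> simp [hτ, b2]
          rwa [h13]
        have h13 := G.vert_bijOn.injOn h11 h12 (by rw [hS _ hz]; exact b3.symm)
        apply Complex.ext <;> simp [hτ, b1, b2, h13]
      · linarith
  · intro z z' hzz hz
    obtain ⟨a, b⟩ := hB _ hz
    rw [abs_lt, Complex.sub_im, tre] at a
    rw [abs_lt, Complex.sub_re, tim] at b
    rcases proj_eq_iff.1 hzz with h | h | h
    · exact Or.inl h.symm
    · rcases h.target.symm with ⟨b1, b2, b3, b4, b5⟩ | ⟨b1, b2, b3, b4, b5⟩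
      · right
        have h13 := hS _ hz
        rw [Complex.sub_im, tre, sub_add_cancel, ← b3] at h13
        apply Complex.ext <;> simp [hτ, b1, b2, h13]
      · linarith
    · rcases h.target.symm with ⟨b1, b2, b3, b4, b5⟩ | ⟨b1, b2, b3, b4, b5⟩ <;> linarith
  · intro w hw hw'
    have a := (hB _ hw).2
    have b := (hB _ hw').2
    rw [Complex.add_re, tim] at b
    rw [abs_lt] at a b
    linarith
  · have : Complex.mk 1 x - τ = Complex.mk 0 y := by
      apply Complex.ext <;> simp [hτ]
    rw [this]
    exact Metric.mem_ball_self h9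

/-- Every point of the punctured square lies in the domain of a chart. -/
theorem exists_patch (z : G.Points) : ∃ D : FlatPatch G, z ∈ D.domain := by
  by_cases hz : z.1 ∈ interior unitSquare
  · obtain ⟨D, hD⟩ := exists_interior_patch G
    exact ⟨D, Or.inl (by rwa [hD])⟩
  · have h := (mem_frontier_unitSquare.1 ⟨subset_closure z.2.1, hz⟩).2
    rcases h with h | h | h | h
    · have h1 := G.im_mem_Ioo z.2 (Or.inl h)
      have h2 : z.1 = Complex.mk 0 z.1.im := Complex.ext h rfl
      obtain ⟨y, hy, hyz⟩ := G.vert_bijOn.surjOn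
        (show z.1.im ∈ {y | y ∈ Ioo (0 : ℝ) 1 ∧ Complex.mk 0 y ∉ G.removed} from
          ⟨h1, by rw [← h2]; exact z.2.2⟩)
      obtain ⟨D, hD, -⟩ := exists_vertical_patch hy.1 hy.2
      exact ⟨D, Or.inl (by rwa [hyz, ← h2] at hD)⟩
    · obtain ⟨D, -, hD⟩ := exists_vertical_patch (right_mem h).1 (right_mem h).2
      refine ⟨D, Or.inr ?_⟩
      rwa [show z.1 = Complex.mk 1 z.1.im from Complex.ext h rfl]
    · have h1 := G.re_mem_Ioo z.2 (Or.inl h)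
      have h2 : z.1 = Complex.mk z.1.re 0 := Complex.ext rfl h
      obtain ⟨y, hy, hyz⟩ := G.horiz_bijOn.surjOn
        (show z.1.re ∈ {y | y ∈ Ioo (0 : ℝ) 1 ∧ Complex.mk y 0 ∉ G.removed} from
          ⟨h1, by rw [← h2]; exact z.2.2⟩)
      obtain ⟨D, hD, -⟩ := exists_horizontal_patch hy.1 hy.2
      exact ⟨D, Or.inl (by rwa [hyz, ← h2] at hD)⟩
    · obtain ⟨D, -, hD⟩ := exists_horizontal_patch (top_mem h).1 (top_mem h).2
      refine ⟨D, Or.inr ?_⟩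
      rwa [show z.1 = Complex.mk z.1.re 1 from Complex.ext rfl h]

end SquareGluing

namespace SquareGluing

variable {G : SquareGluing}

namespace FlatPatch

variable (D : FlatPatch G)

theorem eq_or_eq_of_proj_eq_develop {w : ℂ} (hw : w ∈ D.B) {z : G.Points}
    (h : G.proj z = D.develop w) : z.1 = w ∨ z.1 = w + D.τ := by
  obtain ⟨z', hz', h', h''⟩ := D.exists_develop hw
  obtain ⟨h1, h2⟩ := D.proj_congr (h'.trans h.symm) hz'
  rw [h''] at h2
  rcases h1 with h1 | h1
  · rw [D.read_of_mem h1] at h2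
    exact Or.inl h2
  · rw [D.read_of_mem' h1] at h2
    exact Or.inr (sub_eq_iff_eq_add.1 h2)

theorem read_sub_read {z : G.Points} (hz : z ∈ D.domain) :
    ∀ᶠ w in 𝓝 z, D.read w - D.read z = w.1 - z.1 := by
  rcases hz with hz | hz
  · filter_upwards [(D.isOpen.preimage continuous_subtype_val).mem_nhds hz] with w hw
    rw [D.read_of_mem hw, D.read_of_mem hz]
  · filter_upwards [(D.isOpen.preimage
      (continuous_subtype_val.sub continuous_const)).mem_nhds hz] with w hw
    rw [D.read_of_mem' hw, D.read_of_mem' hz, sub_sub_sub_cancel_right]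

end FlatPatch

theorem isClosedMap_proj : IsClosedMap G.proj := by
  intro Z hZ
  obtain ⟨C, hC, rfl⟩ := isClosed_induced_iff.1 hZ
  rw [← isOpen_compl_iff, isOpen_iff_mem_nhds]
  intro m hm
  obtain ⟨z, rfl⟩ := proj_surjective m
  obtain ⟨D, hD⟩ := exists_patch z
  have hs : G.proj z ∈ D.chart.source := D.mem_chart_source.2 hD
  refine (D.chart.eventually_nhds' (fun m => m ∈ (G.proj '' (Subtype.val ⁻¹' C))ᶜ) hs).1 ?_
  rw [D.chart_proj hD]
  have hc : IsClosed (unitSquare ∩ C) := isClosed_unitSquare.inter hC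
  have hB := D.read_mem hD
  have h1 : D.read z ∉ unitSquare ∩ C := by
    intro h
    exact hm ⟨⟨D.read z, h.1, D.avoid _ hB h.1⟩, h.2, by
      rw [← D.develop_of_mem hB h.1, D.develop_read hD]⟩
  have h2 : D.read z + D.τ ∉ unitSquare ∩ C := by
    intro h
    exact hm ⟨⟨D.read z + D.τ, h.1, D.avoid' _ hB h.1⟩, h.2, by
      rw [← D.develop_of_mem' hB h.1, D.develop_read hD]⟩
  have h3 : ∀ᶠ w in 𝓝 (D.read z), w + D.τ ∉ unitSquare ∩ C :=
    (hc.preimage (continuous_id.add continuous_const)).isOpen_compl.mem_nhds h2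
  filter_upwards [hc.isOpen_compl.mem_nhds h1, h3, D.isOpen.mem_nhds hB] with w h4 h5 h6
  rintro ⟨z', hz', h7⟩
  rcases D.eq_or_eq_of_proj_eq_develop h6 h7 with h8 | h8
  · exact h4 ⟨h8 ▸ z'.2.1, h8 ▸ hz'⟩
  · exact h5 ⟨h8 ▸ z'.2.1, h8 ▸ hz'⟩

theorem finite_fiber (m : G.Surface) : (G.proj ⁻¹' {m}).Finite := by
  obtain ⟨z, rfl⟩ := proj_surjective m
  obtain ⟨D, hD⟩ := exists_patch z
  refine Set.Finite.of_finite_image (f := Subtype.val) (Set.Finite.subset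
    (Set.toFinite {D.read z, D.read z + D.τ}) ?_) Subtype.val_injective.injOn
  rintro _ ⟨z', hz', rfl⟩
  exact D.eq_or_eq_of_proj_eq_develop (D.read_mem hD) (by rw [D.develop_read hD]; exact hz')

theorem isProperMap_proj : IsProperMap G.proj :=
  isProperMap_iff_isClosedMap_and_compact_fibers.2
    ⟨continuous_proj, isClosedMap_proj, fun m => (finite_fiber m).isCompact⟩

instance : T2Space G.Surface := by
  refine t2Space_iff_disjoint_nhds.2 fun m m' hne => ?_
  have hd : Disjoint (G.proj ⁻¹' {m}) (G.proj ⁻¹' {m'}) :=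
    Disjoint.preimage _ (disjoint_singleton.2 hne)
  obtain ⟨U, V, hU, hV, h1, h2, h3⟩ := SeparatedNhds.of_isCompact_isCompact
    (finite_fiber m).isCompact (finite_fiber m').isCompact hd
  have key : ∀ (m : G.Surface) (U : Set G.Points), IsOpen U → G.proj ⁻¹' {m} ⊆ U →
      (G.proj '' Uᶜ)ᶜ ∈ 𝓝 m := fun m U hU h =>
    (isClosedMap_proj _ hU.isClosed_compl).isOpen_compl.mem_nhds (by
      rintro ⟨z, hz, rfl⟩
      exact hz (h rfl))
  refine Filter.disjoint_iff.2 ⟨_, key m U hU h1, _, key m' V hV h2, ?_⟩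
  rw [Set.disjoint_left]
  intro x hx hx'
  obtain ⟨z, rfl⟩ := proj_surjective x
  have a : z ∈ U := by_contra fun h => hx ⟨z, h, rfl⟩
  have b : z ∈ V := by_contra fun h => hx' ⟨z, h, rfl⟩
  exact Set.disjoint_left.1 h3 a b

/-- A property holds near a point of the surface if it holds near its representatives. -/
theorem eventually_of_proj {m : G.Surface} {P : G.Surface → Prop}
    (h : ∀ z, G.proj z = m → ∀ᶠ w in 𝓝 z, P (G.proj w)) : ∀ᶠ m' in 𝓝 m, P m' := by
  filter_upwards [isClosedMap_proj.eventually_nhds_fiber m h] with m' hm'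
  obtain ⟨z, rfl⟩ := proj_surjective m'
  exact hm' z rfl

instance : ChartedSpace ℂ G.Surface where
  atlas := range FlatPatch.chart
  chartAt m := (exists_patch (rep m)).choose.chart
  mem_chart_source m := by
    have h := (FlatPatch.mem_chart_source _).2 (exists_patch (rep m)).choose_spec
    rwa [proj_rep] at h
  chart_mem_atlas m := mem_range_self _

theorem isInherited (G : SquareGluing) : G.IsInherited := by
  rintro _ ⟨D, rfl⟩ z hz
  have hz := D.mem_chart_source.1 hz
  filter_upwards [D.read_sub_read hz, D.isOpen_domain.mem_nhds hz] with w hw hw'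
  rw [D.chart_proj hz, D.chart_proj hw', hw]

/-- Two charts differ locally by a translation. -/
theorem chart_sub_chart {e e' : OpenPartialHomeomorph G.Surface ℂ} (he : e ∈ atlas ℂ G.Surface)
    (he' : e' ∈ atlas ℂ G.Surface) {m : G.Surface} (hm : m ∈ e.source) (hm' : m ∈ e'.source) :
    ∀ᶠ x in 𝓝 m, e' x - e' m = e x - e m := by
  refine eventually_of_proj fun z hz => ?_
  subst hz
  filter_upwards [G.isInherited e he z hm, G.isInherited e' he' z hm'] with w h1 h2
  rw [h1, h2]

instance : SecondCountableTopology G.Surface := by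
  have h1 : LocallyCompactSpace G.Points := by
    have : IsLocallyClosed (unitSquare \ G.removed) :=
      isClosed_unitSquare.isLocallyClosed.inter G.removed_closed.isOpen_compl.isLocallyClosed
    exact this.locallyCompactSpace
  have h2 : SigmaCompactSpace G.Surface := by
    rw [← isSigmaCompact_univ_iff, ← proj_surjective.range_eq]
    exact isSigmaCompact_range continuous_proj
  exact ChartedSpace.secondCountable_of_sigmaCompact ℂ G.Surface

theorem diff_subset_closure_interior : unitSquare \ G.removed ⊆ closure (interior unitSquare) := by
  rw [closure_interior_unitSquare]; exact sdiff_subset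

theorem isConnected_diff : IsConnected (unitSquare \ G.removed) :=
  (convex_unitSquare.interior.isConnected
    ⟨_, mem_interior_unitSquare.2 (by norm_num : (⟨1 / 2, 1 / 2⟩ : ℂ).re ∈ _ ∧ _)⟩).subset_closure
    G.interior_subset_diff diff_subset_closure_interior

instance : ConnectedSpace G.Surface := by
  have : ConnectedSpace G.Points := isConnected_iff_connectedSpace.1 isConnected_diff
  exact proj_surjective.connectedSpace continuous_proj

theorem isTranslationSurface (G : SquareGluing) : IsTranslationSurface G.Surface where
  t2 := inferInstance
  secondCountable := inferInstance
  connected := inferInstance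
  translations := by
    refine hasGroupoid_of_pregroupoid translationPregroupoid ?_
    intro e e' he he' x hx
    rw [OpenPartialHomeomorph.trans_source, OpenPartialHomeomorph.symm_source] at hx
    have h := chart_sub_chart he he' (e.map_target hx.1) hx.2
    have h1 := (e.symm.continuousAt hx.1).eventually h
    filter_upwards [h1, e.open_target.mem_nhds hx.1] with y h2 h3
    simp only [OpenPartialHomeomorph.coe_trans, Function.comp_apply]
    rw [h2, e.right_inv h3, e.right_inv hx.1]

/-! ### The area -/

theorem not_mem_interior_of_proj_eq {z w : G.Points} (h : G.proj z = G.proj w) (hne : z ≠ w) :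
    z.1 ∉ interior unitSquare := by
  intro hz
  obtain ⟨⟨a, b⟩, c, d⟩ := mem_interior_unitSquare.1 hz
  rcases proj_eq_iff.1 h with h | h | h
  · exact hne h
  · rcases h.source with h | h <;> linarith
  · rcases h.target with ⟨_, h, _⟩ | ⟨_, h, _⟩ <;> linarith

theorem measurableSet_diff : MeasurableSet (unitSquare \ G.removed) :=
  isClosed_unitSquare.measurableSet.diff G.removed_closed.measurableSet

theorem exists_isAreaMeasure (G : SquareGluing) :
    ∃ μ : Measure G.Surface, IsAreaMeasure μ ∧ μ univ < ⊤ := by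
  refine ⟨(Measure.comap (Subtype.val : G.Points → ℂ) volume).map G.proj, ?_, ?_⟩
  · rintro _ ⟨D, rfl⟩ A hA hAm
    have hpm : MeasurableSet (G.proj ⁻¹' A) := continuous_proj.measurable hAm
    rw [Measure.map_apply continuous_proj.measurable hAm,
      comap_subtype_coe_apply measurableSet_diff]
    set Z : Set ℂ := Subtype.val '' (G.proj ⁻¹' A) with hZ
    have hZm : MeasurableSet Z := measurableSet_diff.subtype_image hpm
    set Z₁ : Set ℂ := Z ∩ D.B with hZ₁
    set Z₂ : Set ℂ := Z ∩ {z | z - D.τ ∈ D.B} with hZ₂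
    have hBm : MeasurableSet {z | z - D.τ ∈ D.B} :=
      (D.isOpen.preimage (continuous_id.sub continuous_const)).measurableSet
    have hZ₁m : MeasurableSet Z₁ := hZm.inter D.isOpen.measurableSet
    have hZ₂m : MeasurableSet Z₂ := hZm.inter hBm
    have e1 : Z = Z₁ ∪ Z₂ := by
      rw [hZ₁, hZ₂, ← inter_union_distrib_left, eq_comm, inter_eq_left]
      rintro _ ⟨z, hz, rfl⟩
      exact D.mem_chart_source.1 (hA hz)
    have e2 : Disjoint Z₁ Z₂ := by
      rw [Set.disjoint_left]
      rintro z h1 h2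
      refine D.disj _ h2.2 ?_
      rw [sub_add_cancel]
      exact h1.2
    have e3 : D.chart '' A = Z₁ ∪ (fun w => w + D.τ) ⁻¹' Z₂ := by
      ext w
      constructor
      · rintro ⟨m, hm, rfl⟩
        obtain ⟨z, rfl⟩ := proj_surjective m
        have hz := D.mem_chart_source.1 (hA hm)
        rw [D.chart_proj hz]
        rcases hz with hz | hz
        · rw [D.read_of_mem hz]
          exact Or.inl ⟨⟨z, hm, rfl⟩, hz⟩
        · rw [D.read_of_mem' hz]
          refine Or.inr ⟨⟨z, hm, (sub_add_cancel _ _).symm⟩, ?_⟩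
          change z.1 - D.τ + D.τ - D.τ ∈ D.B
          rwa [sub_add_cancel]
      · rintro (⟨⟨z, hz, rfl⟩, h⟩ | ⟨⟨z, hz, h1⟩, h⟩)
        · exact ⟨_, hz, by rw [D.chart_proj (Or.inl h), D.read_of_mem h]⟩
        · have h2 : w = z.1 - D.τ := by rw [h1, add_sub_cancel_right]
          have h3 : z.1 - D.τ ∈ D.B := by rw [h1]; exact h
          exact ⟨_, hz, by rw [D.chart_proj (Or.inr h3), D.read_of_mem' h3, h2]⟩
    have e4 : AEDisjoint volume Z₁ ((fun w => w + D.τ) ⁻¹' Z₂) := by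
      refine measure_mono_null ?_ (convex_unitSquare.addHaar_frontier volume)
      rintro _ ⟨⟨⟨z, hz, rfl⟩, h1⟩, ⟨⟨z', hz', h'⟩, -⟩⟩
      change z'.1 = z.1 + D.τ at h'
      refine ⟨subset_closure z.2.1, not_mem_interior_of_proj_eq (w := z') ?_ ?_⟩
      · have := D.glue _ h1 z.2.1 (h' ▸ z'.2.1)
        rwa [← h', projC_coe, projC_coe] at this
      · rintro rfl
        exact D.disj _ h1 (by rw [← h']; exact h1)
    rw [e3, measure_union₀ (hZ₂m.preimage (measurable_add_const _)).nullMeasurableSet e4,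
      measure_preimage_add_right, ← measure_union e2 hZ₂m, ← e1]
  · rw [Measure.map_apply continuous_proj.measurable MeasurableSet.univ,
      comap_subtype_coe_apply measurableSet_diff]
    refine (measure_mono ?_).trans_lt isCompact_unitSquare.measure_lt_top
    rintro _ ⟨z, -, rfl⟩
    exact z.2.1

end SquareGluing

/-! ### The flat metric -/

namespace SquareGluing

variable {G : SquareGluing}

theorem _root_.IsDevelopment.eventually_chart {x y : G.Surface} {γ : Path x y} {δ : unitInterval → ℂ}
    (h : IsDevelopment γ δ) {e : OpenPartialHomeomorph G.Surface ℂ} (he : e ∈ atlas ℂ G.Surface)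
    {t : unitInterval} (ht : γ t ∈ e.source) :
    ∀ᶠ s in 𝓝 t, e (γ s) - e (γ t) = δ s - δ t := by
  obtain ⟨e', he', ht', h'⟩ := h t
  filter_upwards [h', γ.continuous.continuousAt.eventually (chart_sub_chart he' he ht' ht)]
    with s h1 h2
  rw [h2, h1]

theorem flatEDist_le {x y : G.Surface} {γ : Path x y} {δ : unitInterval → ℂ}
    (h : IsDevelopment γ δ) : flatEDist x y ≤ eVariationOn δ univ :=
  iInf_le_of_le γ (iInf₂_le δ h)

theorem flatEDist_symm_le (x y : G.Surface) : flatEDist x y ≤ flatEDist y x := by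
  refine le_iInf fun γ => le_iInf fun δ => le_iInf fun h => ?_
  refine (flatEDist_le (γ := γ.symm) (δ := δ ∘ unitInterval.symm) ?_).trans (eVariationOn.comp_le_of_antitoneOn δ unitInterval.symm
      (fun a _ b _ hab => ?_) (mapsTo_univ _ _))
  · intro t
    obtain ⟨e, he, h1, h2⟩ := h (unitInterval.symm t)
    exact ⟨e, he, h1, (unitInterval.continuous_symm.tendsto t).eventually h2⟩
  · change 1 - (b : ℝ) ≤ 1 - (a : ℝ)
    exact sub_le_sub_left (show (a : ℝ) ≤ b from hab) _

theorem flatEDist_triangle (x y z : G.Surface) :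
    flatEDist x z ≤ flatEDist x y + flatEDist y z := by
  simp only [flatEDist, ENNReal.iInf_add, ENNReal.add_iInf]
  refine le_iInf fun γ₂ => le_iInf fun δ₂ => le_iInf fun h₂ =>
    le_iInf fun γ₁ => le_iInf fun δ₁ => le_iInf fun h₁ => ?_
  set p₁ : unitInterval → unitInterval := fun t => projIcc 0 1 zero_le_one (2 * (t : ℝ)) with hp₁
  set p₂ : unitInterval → unitInterval :=
    fun t => projIcc 0 1 zero_le_one (2 * (t : ℝ) - 1) with hp₂
  have c₁ : Continuous p₁ := continuous_projIcc.comp (by fun_prop)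
  have c₂ : Continuous p₂ := continuous_projIcc.comp (by fun_prop)
  have m₁ : Monotone p₁ := fun a b hab =>
    monotone_projIcc _ (mul_le_mul_of_nonneg_left (show (a : ℝ) ≤ b from hab) zero_le_two)
  have m₂ : Monotone p₂ := fun a b hab =>
    monotone_projIcc _ (sub_le_sub_right (mul_le_mul_of_nonneg_left
      (show (a : ℝ) ≤ b from hab) zero_le_two) _)
  set half : unitInterval := ⟨1 / 2, by norm_num⟩ with hhalf
  have ph₁ : p₁ half = 1 := by
    simp only [hp₁, hhalf]; norm_num
  have ph₂ : p₂ half = 0 := by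
    simp only [hp₂, hhalf]; norm_num
  set γ := γ₁.trans γ₂ with hγ
  have g₁ : ∀ t ≤ half, γ t = γ₁ (p₁ t) := by
    intro t ht
    have ht' : (t : ℝ) ≤ 1 / 2 := ht
    rw [hγ, Path.trans_apply, dif_pos ht', hp₁]
    congr 1
    exact (projIcc_of_mem _ _).symm
  have g₂ : ∀ t, half ≤ t → γ t = γ₂ (p₂ t) := by
    intro t ht
    rcases eq_or_lt_of_le ht with rfl | ht
    · rw [g₁ _ le_rfl, ph₁, ph₂, γ₁.target, γ₂.source]
    · have ht' : ¬ (t : ℝ) ≤ 1 / 2 := not_le.2 ht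
      rw [hγ, Path.trans_apply, dif_neg ht', hp₂]
      congr 1
      exact (projIcc_of_mem _ _).symm
  classical
  set δ : unitInterval → ℂ := fun t => if t ≤ half then δ₁ (p₁ t) else δ₂ (p₂ t) + (δ₁ 1 - δ₂ 0)
    with hδ
  have d₁ : ∀ t ≤ half, δ t = δ₁ (p₁ t) := fun t ht => if_pos ht
  have d₂ : ∀ t, half ≤ t → δ t = δ₂ (p₂ t) + (δ₁ 1 - δ₂ 0) := by
    intro t ht
    rcases eq_or_lt_of_le ht with rfl | ht
    · rw [d₁ _ le_rfl, ph₁, ph₂]; ring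
    · exact if_neg (not_le.2 ht)
  have hdev : IsDevelopment γ δ := by
    intro t
    refine ⟨_, chart_mem_atlas ℂ (γ t), mem_chart_source ℂ (γ t), ?_⟩
    have A : t ≤ half → ∀ᶠ s in 𝓝 t, s ≤ half →
        chartAt ℂ (γ t) (γ s) - chartAt ℂ (γ t) (γ t) = δ s - δ t := by
      intro ht
      have := h₁.eventually_chart (chart_mem_atlas ℂ (γ t)) (t := p₁ t)
        (by rw [← g₁ t ht]; exact mem_chart_source ℂ (γ t))
      filter_upwards [c₁.continuousAt.eventually this] with s hs hs'
      rw [d₁ s hs', d₁ t ht, ← hs, ← g₁ s hs', ← g₁ t ht]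
    have B : half ≤ t → ∀ᶠ s in 𝓝 t, half ≤ s →
        chartAt ℂ (γ t) (γ s) - chartAt ℂ (γ t) (γ t) = δ s - δ t := by
      intro ht
      have := h₂.eventually_chart (chart_mem_atlas ℂ (γ t)) (t := p₂ t)
        (by rw [← g₂ t ht]; exact mem_chart_source ℂ (γ t))
      filter_upwards [c₂.continuousAt.eventually this] with s hs hs'
      rw [d₂ s hs', d₂ t ht, add_sub_add_right_eq_sub, ← hs, ← g₂ s hs', ← g₂ t ht]
    rcases lt_trichotomy t half with ht | ht | ht
    · filter_upwards [A ht.le, Iio_mem_nhds ht] with s h1 h2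
      exact h1 (le_of_lt h2)
    · filter_upwards [A ht.le, B ht.ge] with s h1 h2
      exact (le_total s half).elim h1 h2
    · filter_upwards [B ht.le, Ioi_mem_nhds ht] with s h1 h2
      exact h1 (le_of_lt h2)
  refine (flatEDist_le hdev).trans ?_
  have hu : (univ : Set unitInterval) = Iic half ∪ Ici half := Iic_union_Ici.symm
  rw [hu, eVariationOn.union δ isGreatest_Iic isLeast_Ici]
  refine add_le_add ?_ ?_
  · rw [eVariationOn.congr (g := δ₁ ∘ p₁) (s := Iic half) fun t ht => d₁ t ht, ← hu]
    exact eVariationOn.comp_le_of_monotoneOn δ₁ p₁ (m₁.monotoneOn _) (mapsTo_univ _ _)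
  · rw [eVariationOn.congr (g := (fun t => δ₂ t + (δ₁ 1 - δ₂ 0)) ∘ p₂) (s := Ici half)
      fun t ht => d₂ t ht, ← hu]
    refine (eVariationOn.comp_le_of_monotoneOn _ p₂ (m₂.monotoneOn _) (mapsTo_univ _ _)).trans ?_
    refine le_of_eq ?_
    simp only [eVariationOn, edist_add_right]

theorem flatEDist_proj_le_of_segment {z w : G.Points}
    (h : segment ℝ z.1 w.1 ⊆ unitSquare \ G.removed) :
    flatEDist (G.proj z) (G.proj w) ≤ edist z.1 w.1 := by
  have hm : ∀ t : unitInterval, z.1 + (t : ℝ) • (w.1 - z.1) ∈ unitSquare \ G.removed := by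
    intro t
    refine h ?_
    rw [segment_eq_image']
    exact ⟨t, t.2, rfl⟩
  set ζ : unitInterval → G.Points := fun t => ⟨_, hm t⟩ with hζ
  have hc : Continuous ζ := by
    refine Continuous.subtype_mk ?_ _
    fun_prop
  set γ : Path (G.proj z) (G.proj w) :=
    { toFun := fun t => G.proj (ζ t)
      continuous_toFun := continuous_proj.comp hc
      source' := by
        congr 1
        apply Subtype.ext
        simp [hζ]
      target' := by
        congr 1
        apply Subtype.ext
        simp [hζ] } with hγ
  have hdev : IsDevelopment γ fun t => (ζ t).1 := by
    intro t
    refine ⟨_, chart_mem_atlas ℂ (γ t), mem_chart_source ℂ (γ t), ?_⟩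
    exact hc.continuousAt.eventually (G.isInherited _ (chart_mem_atlas ℂ (γ t)) (ζ t)
      (mem_chart_source ℂ (γ t)))
  refine (flatEDist_le hdev).trans ?_
  have hl : LipschitzWith ‖w.1 - z.1‖₊ fun t : ℝ => z.1 + t • (w.1 - z.1) := by
    refine LipschitzWith.of_dist_le_mul fun a b => ?_
    rw [dist_add_left, dist_eq_norm, ← sub_smul, norm_smul, mul_comm, Real.dist_eq,
      Real.norm_eq_abs, coe_nnnorm]
  have h1 := hl.lipschitzOnWith.comp_eVariationOn_le (f := fun t : ℝ => z.1 + t • (w.1 - z.1))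
    (g := fun t : unitInterval => (t : ℝ)) (mapsTo_univ _ univ)
  have h2 : eVariationOn (fun t : unitInterval => (t : ℝ)) univ ≤ 1 := by
    have h3 : MonotoneOn (fun t : unitInterval => (t : ℝ)) univ := fun a _ b _ hab => hab
    have h4 := (h3.eVariationOn_eq (mem_univ 0) (mem_univ 1)).le
    rw [univ_inter, show Icc (0 : unitInterval) 1 = univ from eq_univ_of_forall fun t =>
      ⟨t.2.1, t.2.2⟩] at h4
    simpa using h4
  calc eVariationOn (fun t => (ζ t).1) univ
      ≤ ‖w.1 - z.1‖₊ * eVariationOn (fun t : unitInterval => (t : ℝ)) univ := h1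
    _ ≤ ‖w.1 - z.1‖₊ * 1 := by gcongr
    _ = edist z.1 w.1 := by
      rw [mul_one, edist_comm, edist_eq_enorm_sub]; rfl

/-- The projection of the square onto the surface does not increase distances. -/
theorem flatEDist_proj_le (z w : G.Points) :
    flatEDist (G.proj z) (G.proj w) ≤ edist z.1 w.1 := by
  have key : ∀ c ∈ interior unitSquare,
      flatEDist (G.proj z) (G.proj w) ≤ edist z.1 c + edist c w.1 := by
    intro c hc
    have seg : ∀ z : G.Points, segment ℝ z.1 c ⊆ unitSquare \ G.removed := by
      intro z
      rw [← insert_endpoints_openSegment]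
      refine insert_subset z.2 (insert_subset (G.interior_subset_diff hc) ?_)
      exact (convex_unitSquare.openSegment_self_interior_subset_interior z.2.1 hc).trans
        G.interior_subset_diff
    have hc' := G.interior_subset_diff hc
    refine (flatEDist_triangle _ (G.proj ⟨c, hc'⟩) _).trans (add_le_add ?_ ?_)
    · exact flatEDist_proj_le_of_segment (seg z)
    · refine (flatEDist_symm_le _ _).trans ?_
      rw [edist_comm]
      exact flatEDist_proj_le_of_segment (seg w)
  have hz : z.1 ∈ closure (interior unitSquare) := diff_subset_closure_interior z.2
  have hcont : Continuous fun c : ℂ => edist z.1 c + edist c w.1 := by fun_prop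
  have hcl : IsClosed {c : ℂ | flatEDist (G.proj z) (G.proj w) ≤ edist z.1 c + edist c w.1} :=
    isClosed_le continuous_const hcont
  have := hcl.closure_subset_iff.2 key hz
  simpa using this

theorem flatEDist_ne_top (x y : G.Surface) : flatEDist x y ≠ ⊤ := by
  obtain ⟨z, rfl⟩ := proj_surjective x
  obtain ⟨w, rfl⟩ := proj_surjective y
  exact ((flatEDist_proj_le z w).trans_lt (edist_lt_top _ _)).ne

/-- A point outside the disc of radius `ρ` around `m` in a chart has distance at least `ρ`. -/
theorem le_flatEDist {m y : G.Surface} {e : OpenPartialHomeomorph G.Surface ℂ}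
    (he : e ∈ atlas ℂ G.Surface) (hm : m ∈ e.source) {ρ : ℝ}
    (hρ : Metric.ball (e m) ρ ⊆ e.target) (hy : y ∉ e.symm '' Metric.ball (e m) ρ) :
    ENNReal.ofReal ρ ≤ flatEDist m y := by
  refine le_iInf fun γ => le_iInf fun δ => le_iInf fun h => ?_
  by_contra! hlt
  set V := (eVariationOn δ univ).toReal with hV
  have hVρ : V < ρ := (ENNReal.lt_ofReal_iff_toReal_lt (ne_top_of_lt hlt)).1 hlt
  have hδ : ∀ t, ‖δ t - δ 0‖ ≤ V := by
    intro t
    have := eVariationOn.edist_le δ (mem_univ t) (mem_univ 0)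
    rw [edist_dist, dist_eq_norm] at this
    exact (ENNReal.ofReal_le_iff_le_toReal (ne_top_of_lt hlt)).1 this
  have hVt : Metric.closedBall (e m) V ⊆ e.target :=
    (Metric.closedBall_subset_ball hVρ).trans hρ
  set K := e.symm '' Metric.closedBall (e m) V with hK
  have hKc : IsClosed K :=
    ((isCompact_closedBall _ _).image_of_continuousOn (e.continuousOn_symm.mono hVt)).isClosed
  have hKs : K ⊆ e.source := by
    rintro _ ⟨w, hw, rfl⟩
    exact e.map_target (hVt hw)
  have hclopen : IsClopen {t | γ t ∈ K ∧ e (γ t) - e m = δ t - δ 0} := by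
    constructor
    · rw [← isOpen_compl_iff, isOpen_iff_mem_nhds]
      intro t ht
      by_cases htK : γ t ∈ K
      · have hne : e (γ t) - e m ≠ δ t - δ 0 := fun h' => ht ⟨htK, h'⟩
        filter_upwards [h.eventually_chart he (hKs htK)] with s hs hs'
        refine hne ?_
        linear_combination hs'.2 - hs
      · filter_upwards [γ.continuous.continuousAt.eventually (hKc.isOpen_compl.mem_nhds htK)]
          with s hs hs'
        exact hs hs'.1
    · rw [isOpen_iff_mem_nhds]
      rintro t ⟨htK, ht⟩
      filter_upwards [h.eventually_chart he (hKs htK),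
        γ.continuous.continuousAt.eventually (e.open_source.mem_nhds (hKs htK))] with s hs hs'
      have h1 : e (γ s) - e m = δ s - δ 0 := by linear_combination hs + ht
      refine ⟨⟨e (γ s), ?_, e.left_inv hs'⟩, h1⟩
      rw [Metric.mem_closedBall, dist_eq_norm, h1]
      exact hδ s
  have huniv := hclopen.eq_univ ⟨0, by
    refine ⟨⟨e m, Metric.mem_closedBall_self ENNReal.toReal_nonneg, ?_⟩, ?_⟩
    · rw [e.left_inv hm, γ.source]
    · rw [γ.source, sub_self, sub_self]⟩
  have h1 : γ 1 ∈ K := (eq_univ_iff_forall.1 huniv 1).1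
  rw [γ.target] at h1
  exact hy (image_mono (Metric.closedBall_subset_ball hVρ) h1)

/-- A small closed disc around a point, in a chart. -/
theorem exists_chart_ball (m : G.Surface) :
    ∃ e ∈ atlas ℂ G.Surface, m ∈ e.source ∧ ∃ ρ > 0, Metric.closedBall (e m) ρ ⊆ e.target := by
  refine ⟨_, chart_mem_atlas ℂ m, mem_chart_source ℂ m, ?_⟩
  exact Metric.nhds_basis_closedBall.mem_iff.1
    ((chartAt ℂ m).open_target.mem_nhds (mem_chart_target ℂ m))

theorem eq_of_flatEDist_eq_zero {x y : G.Surface} (h : flatEDist x y = 0) : x = y := by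
  obtain ⟨e, he, hx, ρ, hρ, hball⟩ := exists_chart_ball x
  have key : ∀ r, 0 < r → r ≤ ρ → y ∈ e.symm '' Metric.ball (e x) r := by
    intro r hr hr'
    by_contra hy
    have := le_flatEDist he hx
      ((Metric.ball_subset_closedBall.trans (Metric.closedBall_subset_closedBall hr')).trans hball) hy
    rw [h, nonpos_iff_eq_zero, ENNReal.ofReal_eq_zero] at this
    linarith
  obtain ⟨w, hw, rfl⟩ := key ρ hρ le_rfl
  have hwt := hball (Metric.ball_subset_closedBall hw)
  by_contra hne
  have hd : 0 < dist w (e x) := dist_pos.2 fun h' => hne (by rw [h', e.left_inv hx])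
  obtain ⟨w', hw', hww'⟩ := key (dist w (e x)) hd (Metric.mem_ball.1 hw).le
  have hwt' := hball (Metric.ball_subset_closedBall
    (Metric.ball_subset_ball (Metric.mem_ball.1 hw).le hw'))
  have : w' = w := by rw [← e.right_inv hwt', hww', e.right_inv hwt]
  rw [this] at hw'
  exact lt_irrefl _ (Metric.mem_ball.1 hw')

/-- The surface with the path distance of its flat metric. -/
def FlatSpace (G : SquareGluing) : Type := G.Surface

instance : EMetricSpace (FlatSpace G) where
  edist x y := flatEDist (M := G.Surface) x y
  edist_self x := by
    obtain ⟨z, rfl⟩ := proj_surjective x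
    have := flatEDist_proj_le z z
    rwa [edist_self, nonpos_iff_eq_zero] at this
  edist_comm x y := le_antisymm (flatEDist_symm_le _ _) (flatEDist_symm_le _ _)
  edist_triangle := flatEDist_triangle
  eq_of_edist_eq_zero := eq_of_flatEDist_eq_zero

instance : MetricSpace (FlatSpace G) := EMetricSpace.toMetricSpace flatEDist_ne_top

/-- The metric completion of the surface. -/
def completion (G : SquareGluing) : MetricCompletion G.Surface where
  Carrier := UniformSpace.Completion (FlatSpace G)
  ι := fun x => UniformSpace.Completion.coe' (α := FlatSpace G) x
  isometry := fun x y => UniformSpace.Completion.edist_eq (α := FlatSpace G) x y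
  dense := UniformSpace.Completion.denseRange_coe (α := FlatSpace G)

variable (C : MetricCompletion G.Surface)

theorem edist_ι_proj_le (z w : G.Points) :
    edist (C.ι (G.proj z)) (C.ι (G.proj w)) ≤ edist z w := by
  rw [C.isometry]; exact flatEDist_proj_le z w

theorem continuous_ι : Continuous C.ι := by
  have : LipschitzWith 1 (C.ι ∘ G.proj) := fun z w => by
    rw [ENNReal.coe_one, one_mul]; exact edist_ι_proj_le C z w
  exact (isQuotientMap_proj (G := G)).continuous_iff.2 this.continuous

theorem exists_extension : ∃ Φ : ℂ → C.Carrier, ContinuousOn Φ unitSquare ∧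
    ∀ z : G.Points, Φ z = C.ι (G.proj z) := by
  have hf : LipschitzWith 1 (C.ι ∘ G.proj) := fun z w => by
    rw [ENNReal.coe_one, one_mul]; exact edist_ι_proj_le C z w
  have hsub : unitSquare \ G.removed ⊆ unitSquare := sdiff_subset
  have hi : IsUniformInducing (Set.inclusion hsub) :=
    (isUniformEmbedding_set_inclusion hsub).isUniformInducing
  have hd : DenseRange (Set.inclusion hsub) := by
    rw [denseRange_inclusion_iff]
    exact closure_interior_unitSquare.ge.trans (closure_mono G.interior_subset_diff)
  have hc := uniformContinuous_uniformly_extend hi hd hf.uniformContinuous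
  classical
  refine ⟨fun z => if h : z ∈ unitSquare then
    (hi.isDenseInducing hd).extend (C.ι ∘ G.proj) ⟨z, h⟩ else C.ι (G.proj G.centre), ?_, ?_⟩
  · rw [continuousOn_iff_continuous_domRestrict]
    refine hc.continuous.congr fun z => ?_
    rw [Set.domRestrict_apply, dif_pos z.2]
  · intro z
    refine (dif_pos z.2.1).trans ?_
    exact uniformly_extend_of_ind hi hd hf.uniformContinuous z

variable {C}

theorem isCompact_preimage_proj {K : Set G.Surface} (hK : IsCompact K) :
    IsCompact (Subtype.val '' (G.proj ⁻¹' K)) :=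
  (isProperMap_proj.isCompact_preimage hK).image continuous_subtype_val

theorem singularities_eq_image {Φ : ℂ → C.Carrier} (hΦ : ContinuousOn Φ unitSquare)
    (hΦι : ∀ z : G.Points, Φ z = C.ι (G.proj z)) : C.singularities = Φ '' G.removed := by
  have hrs : G.removed ⊆ unitSquare := fun r hr =>
    isClosed_unitSquare.frontier_subset (G.removed_subset hr)
  have hsurj : ∀ c, ∃ z ∈ unitSquare, Φ z = c := by
    have hcl : IsClosed (Φ '' unitSquare) :=
      (isCompact_unitSquare.image_of_continuousOn hΦ).isClosed
    have h1 : range C.ι ⊆ Φ '' unitSquare := by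
      rintro _ ⟨m, rfl⟩
      obtain ⟨z, rfl⟩ := proj_surjective m
      exact ⟨z, z.2.1, hΦι z⟩
    intro c
    exact hcl.closure_subset_iff.2 h1 (C.dense c)
  ext c
  constructor
  · intro hc
    obtain ⟨z, hz, rfl⟩ := hsurj c
    refine ⟨z, by_contra fun h => hc ⟨G.proj ⟨z, hz, h⟩, (hΦι _).symm⟩, rfl⟩
  · rintro ⟨r, hr, rfl⟩ ⟨m, hm⟩
    obtain ⟨e, he, hme, ρ, hρ, hball⟩ := exists_chart_ball m
    have hK := isCompact_preimage_proj
      ((isCompact_closedBall (e m) ρ).image_of_continuousOn (e.continuousOn_symm.mono hball))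
    have h1 : ∀ᶠ z in 𝓝[unitSquare] r, Φ z ∈ Metric.eball (C.ι m) (ENNReal.ofReal ρ) := by
      refine (hΦ r (hrs hr)).eventually (Metric.isOpen_eball.mem_nhds ?_)
      rw [← hm]
      exact Metric.mem_eball_self (ENNReal.ofReal_pos.2 hρ)
    have h2 : ∀ᶠ z in 𝓝[interior unitSquare] r,
        z ∈ Subtype.val '' (G.proj ⁻¹' (e.symm '' Metric.closedBall (e m) ρ)) := by
      filter_upwards [nhdsWithin_mono r interior_subset h1, self_mem_nhdsWithin] with z hz hzi
      have hz' := G.interior_subset_diff hzi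
      refine ⟨⟨z, hz'⟩, ?_, rfl⟩
      refine image_mono Metric.ball_subset_closedBall (by_contra fun hn => ?_)
      have h3 := le_flatEDist he hme (Metric.ball_subset_closedBall.trans hball) hn
      have h4 : Φ z ∈ Metric.eball (C.ι m) (ENNReal.ofReal ρ) := hz
      rw [show Φ z = _ from hΦι ⟨z, hz'⟩, Metric.mem_eball, edist_comm, C.isometry] at h4
      exact absurd h4 (not_lt.2 h3)
    have h5 : (𝓝[interior unitSquare] r).NeBot :=
      mem_closure_iff_nhdsWithin_neBot.1 (by rw [closure_interior_unitSquare]; exact hrs hr)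
    have h6 : r ∈ Subtype.val '' (G.proj ⁻¹' (e.symm '' Metric.closedBall (e m) ρ)) :=
      hK.isClosed.mem_of_frequently_of_tendsto (f := id) (b := 𝓝[interior unitSquare] r)
        h2.frequently (tendsto_id.mono_left nhdsWithin_le_nhds)
    obtain ⟨z, -, rfl⟩ := h6
    exact z.2.2 hr

end SquareGluing

/-! ### Merging of the removed points -/

namespace SquareGluing

variable {G : SquareGluing}

/-- `φ` takes the same value at removed points of opposite sides if the gluing maps one-sided
neighbourhoods of them, or parts of such neighbourhoods, onto one another. -/
structure GermInvariant (G : SquareGluing) {Y : Type*} (φ : ℂ → Y) : Prop where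
  horiz : ∀ t b : ℝ, Complex.mk t 1 ∈ G.removed → Complex.mk b 0 ∈ G.removed →
    (∃ᶠ s in 𝓝 (0 : ℝ), t + s ∈ Ioo (0 : ℝ) 1 ∧ Complex.mk (t + s) 1 ∉ G.removed ∧
      G.horiz (t + s) = b + s) → φ (Complex.mk t 1) = φ (Complex.mk b 0)
  vert : ∀ t b : ℝ, Complex.mk 1 t ∈ G.removed → Complex.mk 0 b ∈ G.removed →
    (∃ᶠ s in 𝓝 (0 : ℝ), t + s ∈ Ioo (0 : ℝ) 1 ∧ Complex.mk 1 (t + s) ∉ G.removed ∧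
      G.vert (t + s) = b + s) → φ (Complex.mk 1 t) = φ (Complex.mk 0 b)

/-- The gluing merges all removed points into one. -/
def IsMerging (G : SquareGluing) : Prop :=
  ∀ (Y : Type) [TopologicalSpace Y] [T2Space Y] (φ : ℂ → Y), ContinuousOn φ G.removed →
    G.GermInvariant φ → ∀ r ∈ G.removed, ∀ r' ∈ G.removed, φ r = φ r'

theorem projC_horiz {x : ℝ} (hx : x ∈ Ioo (0 : ℝ) 1) (hr : Complex.mk x 1 ∉ G.removed) :
    Complex.mk x 1 ∈ unitSquare \ G.removed ∧ Complex.mk (G.horiz x) 0 ∈ unitSquare \ G.removed ∧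
      G.projC (Complex.mk x 1) = G.projC (Complex.mk (G.horiz x) 0) := by
  have h1 : Complex.mk x 1 ∈ unitSquare \ G.removed :=
    ⟨⟨⟨hx.1.le, hx.2.le⟩, zero_le_one, le_rfl⟩, hr⟩
  obtain ⟨h2, h3⟩ := G.horiz_bijOn.mapsTo (show x ∈ {x | _ ∧ _} from ⟨hx, hr⟩)
  have h4 : Complex.mk (G.horiz x) 0 ∈ unitSquare \ G.removed :=
    ⟨⟨⟨h2.1.le, h2.2.le⟩, le_rfl, zero_le_one⟩, h3⟩
  refine ⟨h1, h4, ?_⟩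
  rw [projC_of_mem h1, projC_of_mem h4]
  exact proj_eq_iff.2 (Or.inr (Or.inl (Or.inl ⟨rfl, rfl⟩)))

theorem projC_vert {y : ℝ} (hy : y ∈ Ioo (0 : ℝ) 1) (hr : Complex.mk 1 y ∉ G.removed) :
    Complex.mk 1 y ∈ unitSquare \ G.removed ∧ Complex.mk 0 (G.vert y) ∈ unitSquare \ G.removed ∧
      G.projC (Complex.mk 1 y) = G.projC (Complex.mk 0 (G.vert y)) := by
  have h1 : Complex.mk 1 y ∈ unitSquare \ G.removed :=
    ⟨⟨⟨zero_le_one, le_rfl⟩, hy.1.le, hy.2.le⟩, hr⟩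
  obtain ⟨h2, h3⟩ := G.vert_bijOn.mapsTo (show y ∈ {x | _ ∧ _} from ⟨hy, hr⟩)
  have h4 : Complex.mk 0 (G.vert y) ∈ unitSquare \ G.removed :=
    ⟨⟨⟨le_rfl, zero_le_one⟩, h2.1.le, h2.2.le⟩, h3⟩
  refine ⟨h1, h4, ?_⟩
  rw [projC_of_mem h1, projC_of_mem h4]
  exact proj_eq_iff.2 (Or.inr (Or.inl (Or.inr ⟨rfl, rfl⟩)))

theorem removed_subset_unitSquare (G : SquareGluing) : G.removed ⊆ unitSquare := fun _ hr =>
  isClosed_unitSquare.frontier_subset (G.removed_subset hr)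

theorem eq_of_frequently_eq {Y : Type*} [TopologicalSpace Y] [T2Space Y] {Φ : ℂ → Y}
    (hΦ : ContinuousOn Φ unitSquare) {f g : ℝ → ℂ} (hf : Continuous f) (hg : Continuous g)
    (h0 : f 0 ∈ unitSquare) (h0' : g 0 ∈ unitSquare)
    (h : ∃ᶠ s in 𝓝 (0 : ℝ), f s ∈ unitSquare ∧ g s ∈ unitSquare ∧ Φ (f s) = Φ (g s)) :
    Φ (f 0) = Φ (g 0) := by
  set T := {s | f s ∈ unitSquare ∧ g s ∈ unitSquare ∧ Φ (f s) = Φ (g s)} with hT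
  have hne : (𝓝[T] (0 : ℝ)).NeBot := by
    rw [← mem_closure_iff_nhdsWithin_neBot, mem_closure_iff_frequently]; exact h
  have key : ∀ f : ℝ → ℂ, Continuous f → f 0 ∈ unitSquare → (∀ s ∈ T, f s ∈ unitSquare) →
      Tendsto (fun s => Φ (f s)) (𝓝[T] 0) (𝓝 (Φ (f 0))) := fun f hf h0 hs =>
    (hΦ _ h0).tendsto.comp (tendsto_nhdsWithin_iff.2
      ⟨hf.continuousAt.tendsto.mono_left nhdsWithin_le_nhds,
        eventually_nhdsWithin_of_forall hs⟩)
  refine tendsto_nhds_unique_of_eventuallyEq (key f hf h0 fun s hs => hs.1)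
    (key g hg h0' fun s hs => hs.2.1) (eventually_nhdsWithin_of_forall fun s hs => hs.2.2)

theorem germInvariant_extension {C : MetricCompletion G.Surface} {Φ : ℂ → C.Carrier}
    (hΦ : ContinuousOn Φ unitSquare) (hΦι : ∀ z : G.Points, Φ z = C.ι (G.proj z)) :
    G.GermInvariant Φ := by
  have hΦ' : ∀ z ∈ unitSquare \ G.removed, Φ z = C.ι (G.projC z) := fun z hz => by
    rw [projC_of_mem hz]; exact hΦι ⟨z, hz⟩
  constructor
  · intro t b ht hb h
    have := eq_of_frequently_eq hΦ (f := fun s => (Complex.mk t 1 + s : ℂ))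
      (g := fun s => (Complex.mk b 0 + s : ℂ)) (by fun_prop) (by fun_prop)
      (by simpa using G.removed_subset_unitSquare ht)
      (by simpa using G.removed_subset_unitSquare hb) (h.mono ?_)
    · simpa using this
    · rintro s ⟨h1, h2, h3⟩
      have e1 : (Complex.mk t 1 + s : ℂ) = Complex.mk (t + s) 1 := by
        apply Complex.ext <;> simp
      have e2 : (Complex.mk b 0 + s : ℂ) = Complex.mk (b + s) 0 := by
        apply Complex.ext <;> simp
      obtain ⟨h4, h5, h6⟩ := projC_horiz h1 h2
      rw [h3] at h5 h6
      rw [e1, e2, hΦ' _ h4, hΦ' _ h5, h6]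
      exact ⟨h4.1, h5.1, rfl⟩
  · intro t b ht hb h
    have := eq_of_frequently_eq hΦ (f := fun s => (Complex.mk 1 t + s * Complex.I : ℂ))
      (g := fun s => (Complex.mk 0 b + s * Complex.I : ℂ)) (by fun_prop) (by fun_prop)
      (by simpa using G.removed_subset_unitSquare ht)
      (by simpa using G.removed_subset_unitSquare hb) (h.mono ?_)
    · simpa using this
    · rintro s ⟨h1, h2, h3⟩
      have e1 : (Complex.mk 1 t + s * Complex.I : ℂ) = Complex.mk 1 (t + s) := by
        apply Complex.ext <;> simp
      have e2 : (Complex.mk 0 b + s * Complex.I : ℂ) = Complex.mk 0 (b + s) := by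
        apply Complex.ext <;> simp
      obtain ⟨h4, h5, h6⟩ := projC_vert h1 h2
      rw [h3] at h5 h6
      rw [e1, e2, hΦ' _ h4, hΦ' _ h5, h6]
      exact ⟨h4.1, h5.1, rfl⟩

theorem dist_mk_re (a b c : ℝ) : dist (Complex.mk a c) (Complex.mk b c) = |a - b| :=
  Complex.dist_of_im_eq (z := Complex.mk a c) (w := Complex.mk b c) rfl

theorem dist_mk_im (a b c : ℝ) : dist (Complex.mk c a) (Complex.mk c b) = |a - b| :=
  Complex.dist_of_re_eq (z := Complex.mk c a) (w := Complex.mk c b) rfl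

theorem zero_mem_removed (G : SquareGluing) : (0 : ℂ) ∈ G.removed :=
  G.corners 0 (Or.inl rfl) (Or.inl rfl)

/-! ### The end of the surface -/

theorem isConnected_projC_image {U : Set ℂ} (hU : IsOpen U)
    (h : IsConnected (interior unitSquare ∩ U)) :
    IsConnected (G.projC '' ((unitSquare \ G.removed) ∩ U)) := by
  have h1 : IsConnected ((unitSquare \ G.removed) ∩ U) :=
    h.subset_closure (inter_subset_inter_left _ G.interior_subset_diff)
      ((inter_subset_inter_left _ diff_subset_closure_interior).trans hU.closure_inter)
  exact h1.image _ (continuousOn_projC.mono inter_subset_left)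

/-- The points of the surface at distance less than `η` from the removed points. -/
def cuspNhd (G : SquareGluing) (η : ℝ) : Set G.Surface :=
  ⋃ r ∈ G.removed, G.projC '' ((unitSquare \ G.removed) ∩ Metric.ball r η)

theorem mem_cuspNhd {η : ℝ} {m : G.Surface} :
    m ∈ G.cuspNhd η ↔ ∃ z : G.Points, G.proj z = m ∧ ∃ r ∈ G.removed, dist z.1 r < η := by
  simp only [cuspNhd, mem_iUnion₂]
  constructor
  · rintro ⟨r, hr, z, ⟨hz, hzr⟩, rfl⟩
    exact ⟨⟨z, hz⟩, (projC_of_mem hz).symm, r, hr, hzr⟩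
  · rintro ⟨z, rfl, r, hr, hzr⟩
    exact ⟨r, hr, z, ⟨z.2, hzr⟩, projC_coe z⟩

theorem cuspNhd_mono {η η' : ℝ} (h : η ≤ η') : G.cuspNhd η ⊆ G.cuspNhd η' := by
  intro m hm
  obtain ⟨z, hz, r, hr, hd⟩ := mem_cuspNhd.1 hm
  exact mem_cuspNhd.2 ⟨z, hz, r, hr, hd.trans_le h⟩

theorem isConnected_halfDisc {r : ℂ} (hr : r ∈ unitSquare) {η : ℝ} (hη : 0 < η) :
    IsConnected (G.projC '' ((unitSquare \ G.removed) ∩ Metric.ball r η)) := by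
  refine isConnected_projC_image Metric.isOpen_ball ?_
  refine (convex_unitSquare.interior.inter (convex_ball _ _)).isConnected ?_
  rw [← closure_interior_unitSquare, Metric.mem_closure_iff] at hr
  obtain ⟨z, hz, hd⟩ := hr η hη
  exact ⟨z, hz, by rwa [Metric.mem_ball, dist_comm]⟩

theorem isConnected_cuspNhd (hG : G.IsMerging) {η : ℝ} (hη : 0 < η) :
    IsConnected (G.cuspNhd η) := by
  set H : ℂ → Set G.Surface :=
    fun r => G.projC '' ((unitSquare \ G.removed) ∩ Metric.ball r η) with hH
  have hHc : ∀ r ∈ G.removed, IsConnected (H r) := fun r hr =>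
    isConnected_halfDisc (G.removed_subset_unitSquare hr) hη
  have hHs : ∀ r ∈ G.removed, H r ⊆ G.cuspNhd η := fun r hr => subset_biUnion_of_mem hr
  choose! c hc using fun r hr => (hHc r hr).nonempty
  set φ : ℂ → Set G.Surface := fun r => connectedComponentIn (G.cuspNhd η) (c r) with hφ
  have hsub : ∀ r ∈ G.removed, H r ⊆ φ r := fun r hr =>
    (hHc r hr).isPreconnected.subset_connectedComponentIn (hc r hr) (hHs r hr)
  have hmeet : ∀ r ∈ G.removed, ∀ r' ∈ G.removed, (H r ∩ H r').Nonempty → φ r = φ r' := by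
    rintro r hr r' hr' ⟨x, h1, h2⟩
    exact (connectedComponentIn_eq (hsub r hr h1)).trans
      (connectedComponentIn_eq (hsub r' hr' h2)).symm
  have hconst : ∀ r ∈ G.removed, ∀ r' ∈ G.removed, φ r = φ r' := by
    let _ : TopologicalSpace (Set G.Surface) := ⊥
    have : DiscreteTopology (Set G.Surface) := ⟨rfl⟩
    refine hG (Set G.Surface) φ ?_ ⟨?_, ?_⟩
    · intro r hr
      have : ∀ᶠ r' in 𝓝[G.removed] r, φ r' = φ r := by
        filter_upwards [self_mem_nhdsWithin,
          mem_nhdsWithin_of_mem_nhds (Metric.ball_mem_nhds r hη)] with r' hr' hd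
        refine hmeet r' hr' r hr ?_
        obtain ⟨x, hx⟩ := (isConnected_halfDisc (G := G) (G.removed_subset_unitSquare hr')
          (lt_min hη (sub_pos.2 (Metric.mem_ball.1 hd)))).nonempty
        refine ⟨x, image_mono (inter_subset_inter_right _ (Metric.ball_subset_ball
          (min_le_left _ _))) hx, image_mono (inter_subset_inter_right _ ?_) hx⟩
        refine Metric.ball_subset_ball' ?_
        linarith [min_le_right η (η - dist r' r)]
      exact (continuousWithinAt_const (b := φ r)).congr_of_eventuallyEq this rfl
    · intro t b ht hb h
      obtain ⟨s, ⟨h1, h2, h3⟩, hs⟩ := (h.and_eventually (Metric.ball_mem_nhds 0 hη)).exists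
      obtain ⟨h4, h5, h6⟩ := projC_horiz h1 h2
      rw [h3] at h5 h6
      have hs' : |s| < η := by simpa using hs
      refine hmeet _ ht _ hb ⟨_, ⟨_, ⟨h4, ?_⟩, rfl⟩, ⟨_, ⟨h5, ?_⟩, h6.symm⟩⟩
      · rw [Metric.mem_ball, dist_mk_re]; simpa using hs'
      · rw [Metric.mem_ball, dist_mk_re]; simpa using hs'
    · intro t b ht hb h
      obtain ⟨s, ⟨h1, h2, h3⟩, hs⟩ := (h.and_eventually (Metric.ball_mem_nhds 0 hη)).exists
      obtain ⟨h4, h5, h6⟩ := projC_vert h1 h2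
      rw [h3] at h5 h6
      have hs' : |s| < η := by simpa using hs
      refine hmeet _ ht _ hb ⟨_, ⟨_, ⟨h4, ?_⟩, rfl⟩, ⟨_, ⟨h5, ?_⟩, h6.symm⟩⟩
      · rw [Metric.mem_ball, dist_mk_im]; simpa using hs'
      · rw [Metric.mem_ball, dist_mk_im]; simpa using hs'
  have h0 := G.zero_mem_removed
  have hc0 : c 0 ∈ G.cuspNhd η := hHs 0 h0 (hc 0 h0)
  have : G.cuspNhd η = φ 0 := by
    refine Subset.antisymm ?_ (connectedComponentIn_subset _ _)
    refine iUnion₂_subset fun r hr => ?_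
    rw [hconst 0 h0 r hr]
    exact hsub r hr
  rw [this]
  exact isConnected_connectedComponentIn_iff.2 hc0

theorem exists_cuspNhd_subset_compl {K : Set G.Surface} (hK : IsCompact K) :
    ∃ η > 0, G.cuspNhd η ⊆ Kᶜ := by
  have hd : Disjoint (Subtype.val '' (G.proj ⁻¹' K)) G.removed := by
    rw [Set.disjoint_left]
    rintro _ ⟨z, -, rfl⟩
    exact z.2.2
  obtain ⟨δ, hδ, h⟩ := hd.exists_thickenings (isCompact_preimage_proj hK) G.removed_closed
  refine ⟨δ, hδ, fun m hm hmK => ?_⟩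
  obtain ⟨z, rfl, r, hr, hzr⟩ := mem_cuspNhd.1 hm
  exact Set.disjoint_left.1 h (Metric.self_subset_thickening hδ _ ⟨z, hmK, rfl⟩)
    (Metric.mem_thickening_iff.2 ⟨r, hr, hzr⟩)

theorem TopEnd_comp_eq (hG : G.IsMerging) (e : TopEnd G.Surface)
    (K : TopologicalSpace.Compacts G.Surface) {η : ℝ} (hη : 0 < η)
    (hK : G.cuspNhd η ⊆ (K : Set G.Surface)ᶜ) {y : G.Surface} (hy : y ∈ G.cuspNhd η) :
    e.comp K = connectedComponentIn (K : Set G.Surface)ᶜ y := by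
  set Z : Set ℂ := unitSquare ∩ ⋂ r ∈ G.removed, {z | η ≤ dist z r} with hZ
  have hZc : IsCompact Z := isCompact_unitSquare.inter_right
    (isClosed_biInter fun r _ => isClosed_le continuous_const (continuous_id.dist continuous_const))
  have hZs : Z ⊆ unitSquare \ G.removed := by
    rintro z ⟨hz, hz'⟩
    refine ⟨hz, fun hr => ?_⟩
    have := mem_iInter₂.1 hz' z hr
    rw [mem_ofPred_eq, dist_self] at this
    linarith
  set K' : TopologicalSpace.Compacts G.Surface :=
    K ⊔ ⟨G.projC '' Z, hZc.image_of_continuousOn (continuousOn_projC.mono hZs)⟩ with hK'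
  obtain ⟨x, hx, hxe⟩ := e.isComponent K'
  have hxc : x ∈ e.comp K' := by rw [hxe]; exact mem_connectedComponentIn hx
  have hxN : x ∈ G.cuspNhd η := by
    obtain ⟨z, rfl⟩ := proj_surjective x
    by_contra hn
    refine hx (Or.inr ⟨z, ⟨z.2.1, mem_iInter₂.2 fun r hr => ?_⟩, projC_coe z⟩)
    by_contra hlt
    exact hn (mem_cuspNhd.2 ⟨z, rfl, r, hr, not_le.1 hlt⟩)
  have hxK : x ∈ e.comp K := e.anti K K' le_sup_left hxc
  obtain ⟨x', -, hxe'⟩ := e.isComponent K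
  rw [hxe'] at hxK ⊢
  rw [connectedComponentIn_eq hxK]
  exact connectedComponentIn_eq ((isConnected_cuspNhd hG hη).isPreconnected.subset_connectedComponentIn
    hxN hK hy)

theorem subsingleton_topEnd (hG : G.IsMerging) (e e' : TopEnd G.Surface) : e = e' := by
  refine TopEnd.ext (funext fun K => ?_)
  obtain ⟨η, hη, hK⟩ := exists_cuspNhd_subset_compl K.isCompact
  obtain ⟨y, hy⟩ := (isConnected_cuspNhd hG hη).nonempty
  rw [TopEnd_comp_eq hG e K hη hK hy, TopEnd_comp_eq hG e' K hη hK hy]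

theorem nonempty_topEnd (hG : G.IsMerging) : Nonempty (TopEnd G.Surface) := by
  choose η hη hK using fun K : TopologicalSpace.Compacts G.Surface =>
    exists_cuspNhd_subset_compl K.isCompact
  choose y hy using fun K => (isConnected_cuspNhd hG (hη K)).nonempty
  refine ⟨⟨fun K => connectedComponentIn (K : Set G.Surface)ᶜ (y K),
    fun K => ⟨y K, hK K (hy K), rfl⟩, fun K K' hKK => ?_⟩⟩
  obtain ⟨x, hx⟩ := (isConnected_cuspNhd hG (lt_min (hη K) (hη K'))).nonempty
  have h1 : ∀ K, x ∈ G.cuspNhd (η K) → connectedComponentIn (K : Set G.Surface)ᶜ (y K) =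
      connectedComponentIn (K : Set G.Surface)ᶜ x := fun K hx =>
    connectedComponentIn_eq ((isConnected_cuspNhd hG (hη K)).isPreconnected.subset_connectedComponentIn
      (hy K) (hK K) hx)
  rw [h1 K (cuspNhd_mono (min_le_left _ _) hx), h1 K' (cuspNhd_mono (min_le_right _ _) hx)]
  exact connectedComponentIn_mono _ (compl_subset_compl.2 hKK)

end SquareGluing

/-! ### The genus of the end -/

/-- Half of an annulus. -/
def halfAnnulus (r R : ℝ) : Set ℂ := {w | 0 < w.im ∧ r < ‖w‖ ∧ ‖w‖ < R}

theorem isConnected_halfAnnulus {r R : ℝ} (hr : 0 < r) (hR : r < R) :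
    IsConnected (halfAnnulus r R) := by
  have h : halfAnnulus r R = (fun p : ℝ × ℝ => (p.1 : ℂ) * Complex.exp (p.2 * Complex.I)) ''
      (Ioo r R ×ˢ Ioo 0 Real.pi) := by
    ext w
    constructor
    · rintro ⟨h1, h2, h3⟩
      refine ⟨(‖w‖, w.arg), ⟨⟨h2, h3⟩, ?_, ?_⟩, Complex.norm_mul_exp_arg_mul_I w⟩
      · by_contra hn
        have := Real.sin_nonpos_of_nonpos_of_neg_pi_le (not_lt.1 hn) (Complex.neg_pi_lt_arg w).le
        rw [Complex.sin_arg] at this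
        exact absurd this (not_le.2 (div_pos h1 (hr.trans h2)))
      · refine lt_of_le_of_ne (Complex.arg_le_pi w) fun hn => ?_
        exact h1.ne' (Complex.arg_eq_pi_iff.1 hn).2
    · rintro ⟨⟨s, θ⟩, ⟨⟨h1, h2⟩, h3, h4⟩, rfl⟩
      have hs : 0 < s := hr.trans h1
      have e : ‖(s : ℂ) * Complex.exp (θ * Complex.I)‖ = s := by
        rw [norm_mul, Complex.norm_exp_ofReal_mul_I, mul_one, Complex.norm_real,
          Real.norm_of_nonneg hs.le]
      refine ⟨?_, by rwa [e], by rwa [e]⟩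
      simp only [Complex.im_ofReal_mul, Complex.exp_ofReal_mul_I_im]
      exact mul_pos hs (Real.sin_pos_of_pos_of_lt_pi h3 h4)
  rw [h]
  refine (isConnected_Ioo hR |>.prod (isConnected_Ioo Real.pi_pos)).image _ ?_
  exact Continuous.continuousOn (by fun_prop)

/-- Removing a closed subset from a connected set leaves it connected, if the removed subset has a
neighbourhood whose remaining part lies in a connected set. -/
theorem IsPreconnected.diff_of_connected_nhd {X : Type*} [TopologicalSpace X] {A α O W : Set X}
    (hA : IsPreconnected A) (hα : IsClosed α) (hO : IsPreconnected O) (hOA : O ⊆ A \ α)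
    (hW : IsOpen W) (hαW : α ⊆ W) (hWO : W \ α ⊆ O) : IsPreconnected (A \ α) := by
  have key : ∀ u v : Set X, IsOpen u → IsOpen v → A \ α ⊆ u ∪ v → (A \ α) ∩ (u ∩ v) = ∅ →
      O ⊆ u → A \ α ⊆ u ∨ A \ α ⊆ v := by
    intro u v hu hv h1 h2 h3
    have h4 := isPreconnected_iff_subset_of_disjoint.1 hA (u ∪ W) (v \ α) (hu.union hW)
      (hv.sdiff hα) (fun x hx => ?_) ?_
    · refine h4.imp (fun h x hx => ?_) fun h x hx => (h hx.1).1
      exact (h hx.1).elim id fun hxW => h3 (hWO ⟨hxW, hx.2⟩)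
    · by_cases hxα : x ∈ α
      · exact Or.inl (Or.inr (hαW hxα))
      · exact (h1 ⟨hx, hxα⟩).imp Or.inl fun h => ⟨h, hxα⟩
    · rw [eq_empty_iff_forall_notMem] at h2 ⊢
      rintro x ⟨hx, hxu | hxW, hxv, hxα⟩
      · exact h2 x ⟨⟨hx, hxα⟩, hxu, hxv⟩
      · exact h2 x ⟨⟨hx, hxα⟩, h3 (hWO ⟨hxW, hxα⟩), hxv⟩
  refine isPreconnected_iff_subset_of_disjoint.2 fun u v hu hv h1 h2 => ?_
  rcases isPreconnected_iff_subset_of_disjoint.1 hO u v hu hv (hOA.trans h1)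
    (subset_empty_iff.1 (h2 ▸ inter_subset_inter_left _ hOA)) with h | h
  · exact key u v hu hv h1 h2 h
  · exact (key v u hv hu (by rwa [union_comm]) (by rwa [inter_comm v u]) h).symm

namespace SquareGluing

variable {G : SquareGluing}

/-- Three neighbouring intervals of the upper side, of lengths `l`, `2l` and `4l`, which are glued
in the reverse order to intervals of the lower side. -/
structure Handle (G : SquareGluing) (t b l : ℝ) : Prop where
  pos : 0 < l
  t_nonneg : 0 ≤ t
  t_le : t + 7 * l ≤ 1
  b_nonneg : 0 ≤ b
  b_le : b + 7 * l ≤ 1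
  top_removed : Complex.mk t 1 ∈ G.removed
  bot_removed : Complex.mk b 0 ∈ G.removed
  left_removed : Complex.mk (b + 4 * l) 0 ∈ G.removed
  right_removed : Complex.mk (b + 6 * l) 0 ∈ G.removed
  first : ∀ x ∈ Ioo t (t + l), Complex.mk x 1 ∉ G.removed ∧ G.horiz x = x - t + b + 6 * l
  second : ∀ x ∈ Ioo (t + l) (t + 3 * l), Complex.mk x 1 ∉ G.removed ∧
    G.horiz x = x - t + b + 3 * l
  third : ∀ x ∈ Ioo (t + 3 * l) (t + 7 * l), Complex.mk x 1 ∉ G.removed ∧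
    G.horiz x = x - t + b - 3 * l

namespace Handle

variable {t b l : ℝ} (h : G.Handle t b l)

/-- The centre of the upper half discs. -/
def cA (t l : ℝ) : ℂ := Complex.mk (t + 7 / 2 * l) 1

/-- The centre of the lower half discs. -/
def cB (b l : ℝ) : ℂ := Complex.mk (b + 7 / 2 * l) 0

include h in
theorem glue {x y : ℝ} (hx : x ∈ Ioo t (t + 7 * l)) (hr : Complex.mk x 1 ∉ G.removed)
    (hy : G.horiz x = y) :
    Complex.mk x 1 ∈ unitSquare \ G.removed ∧ Complex.mk y 0 ∈ unitSquare \ G.removed ∧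
      G.projC (Complex.mk x 1) = G.projC (Complex.mk y 0) := by
  subst hy
  exact projC_horiz ⟨h.t_nonneg.trans_lt hx.1, hx.2.trans_le h.t_le⟩ hr

include h in
theorem glue_two : Complex.mk (t + 2 * l) 1 ∈ unitSquare \ G.removed ∧
    Complex.mk (b + 5 * l) 0 ∈ unitSquare \ G.removed ∧
      G.projC (Complex.mk (t + 2 * l) 1) = G.projC (Complex.mk (b + 5 * l) 0) := by
  have hl := h.pos
  obtain ⟨h1, h2⟩ := h.second (t + 2 * l) ⟨by linarith, by linarith⟩
  exact h.glue ⟨by linarith, by linarith⟩ h1 (h2.trans (by ring))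

include h in
theorem glue_three : Complex.mk (t + 5 * l) 1 ∈ unitSquare \ G.removed ∧
    Complex.mk (b + 2 * l) 0 ∈ unitSquare \ G.removed ∧
      G.projC (Complex.mk (t + 5 * l) 1) = G.projC (Complex.mk (b + 2 * l) 0) := by
  have hl := h.pos
  obtain ⟨h1, h2⟩ := h.third (t + 5 * l) ⟨by linarith, by linarith⟩
  exact h.glue ⟨by linarith, by linarith⟩ h1 (h2.trans (by ring))

theorem coord_A {z : ℂ} {r : ℝ} (hz : ‖z - cA t l‖ ≤ r) :
    t + 7 / 2 * l - r ≤ z.re ∧ z.re ≤ t + 7 / 2 * l + r ∧ 1 - r ≤ z.im := by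
  have h1 := abs_le.1 ((Complex.abs_re_le_norm _).trans hz)
  have h2 := abs_le.1 ((Complex.abs_im_le_norm _).trans hz)
  simp only [cA, Complex.sub_re, Complex.sub_im] at h1 h2
  exact ⟨by linarith, by linarith, by linarith⟩

theorem coord_B {z : ℂ} {r : ℝ} (hz : ‖z - cB b l‖ ≤ r) :
    b + 7 / 2 * l - r ≤ z.re ∧ z.re ≤ b + 7 / 2 * l + r ∧ z.im ≤ r := by
  have h1 := abs_le.1 ((Complex.abs_re_le_norm _).trans hz)
  have h2 := abs_le.1 ((Complex.abs_im_le_norm _).trans hz)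
  simp only [cB, Complex.sub_re, Complex.sub_im] at h1 h2
  exact ⟨by linarith, by linarith, by linarith⟩

/-- The upper half circle. -/
def arcA (t l : ℝ) (u : ℂ) : ℂ := cA t l + (3 / 2 * l : ℝ) * u

/-- The lower half circle. -/
def arcB (b l : ℝ) (u : ℂ) : ℂ := cB b l - (3 / 2 * l : ℝ) * (starRingEnd ℂ) u

theorem eq_one_or_of_im_eq_zero {u : ℂ} (hu : ‖u‖ = 1) (h0 : u.im = 0) : u = 1 ∨ u = -1 := by
  have h1 : u = (u.re : ℂ) := Complex.ext rfl (by simp [h0])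
  rw [h1, Complex.norm_real, Real.norm_eq_abs] at hu
  rcases eq_or_eq_neg_of_abs_eq hu with h2 | h2
  · left; rw [h1, h2, Complex.ofReal_one]
  · right; rw [h1, h2, Complex.ofReal_neg, Complex.ofReal_one]

theorem arcA_one : arcA t l 1 = Complex.mk (t + 5 * l) 1 := by
  apply Complex.ext <;> simp [arcA, cA]; ring

theorem arcA_neg_one : arcA t l (-1) = Complex.mk (t + 2 * l) 1 := by
  apply Complex.ext <;> simp [arcA, cA]; ring

theorem arcB_one : arcB b l 1 = Complex.mk (b + 2 * l) 0 := by
  apply Complex.ext <;> simp [arcB, cB]; ring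

theorem arcB_neg_one : arcB b l (-1) = Complex.mk (b + 5 * l) 0 := by
  apply Complex.ext <;> simp [arcB, cB]; ring

theorem arcA_im (u : ℂ) : (arcA t l u).im = 1 + 3 / 2 * l * u.im := by
  simp [arcA, cA]

theorem arcB_im (u : ℂ) : (arcB b l u).im = 3 / 2 * l * u.im := by
  simp [arcB, cB]

include h in
theorem norm_arcA (u : ℂ) (hu : ‖u‖ = 1) : ‖arcA t l u - cA t l‖ = 3 / 2 * l := by
  rw [arcA, add_sub_cancel_left, norm_mul, hu, mul_one, Complex.norm_real,
    Real.norm_of_nonneg (by linarith [h.pos])]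

include h in
theorem norm_arcB (u : ℂ) (hu : ‖u‖ = 1) : ‖arcB b l u - cB b l‖ = 3 / 2 * l := by
  rw [arcB, sub_sub_cancel_left, norm_neg, norm_mul, Complex.norm_conj, hu, mul_one,
    Complex.norm_real, Real.norm_of_nonneg (by linarith [h.pos])]

include h in
theorem l_le : l ≤ 1 / 7 := by linarith [h.t_nonneg, h.t_le]

include h in
theorem arcA_mem_interior {u : ℂ} (hu : ‖u‖ = 1) (hi : u.im < 0) :
    arcA t l u ∈ interior unitSquare := by
  obtain ⟨h1, h2, h3⟩ := coord_A (h.norm_arcA u hu).le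
  have := mul_neg_of_pos_of_neg (show 0 < 3 / 2 * l by linarith [h.pos]) hi
  have h5 := h.pos; have h6 := h.t_nonneg; have h7 := h.t_le; have h8 := h.l_le
  refine mem_interior_unitSquare.2 ⟨⟨by linarith, by linarith⟩, by linarith, ?_⟩
  rw [arcA_im]; linarith

include h in
theorem arcB_mem_interior {u : ℂ} (hu : ‖u‖ = 1) (hi : 0 < u.im) :
    arcB b l u ∈ interior unitSquare := by
  obtain ⟨h1, h2, h3⟩ := coord_B (h.norm_arcB u hu).le
  have := mul_pos (show 0 < 3 / 2 * l by linarith [h.pos]) hi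
  have h5 := h.pos; have h6 := h.b_nonneg; have h7 := h.b_le; have h8 := h.l_le
  refine mem_interior_unitSquare.2 ⟨⟨by linarith, by linarith⟩, ?_, by linarith⟩
  rw [arcB_im]; linarith

include h in
theorem arcA_mem {u : ℂ} (hu : ‖u‖ = 1) (hi : u.im ≤ 0) :
    arcA t l u ∈ unitSquare \ G.removed := by
  rcases eq_or_lt_of_le hi with h0 | h0
  · rcases eq_one_or_of_im_eq_zero hu h0 with rfl | rfl
    · rw [arcA_one]; exact h.glue_three.1
    · rw [arcA_neg_one]; exact h.glue_two.1
  · exact G.interior_subset_diff (h.arcA_mem_interior hu h0)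

include h in
theorem arcB_mem {u : ℂ} (hu : ‖u‖ = 1) (hi : 0 ≤ u.im) :
    arcB b l u ∈ unitSquare \ G.removed := by
  rcases eq_or_lt_of_le hi with h0 | h0
  · rcases eq_one_or_of_im_eq_zero hu h0.symm with rfl | rfl
    · rw [arcB_one]; exact h.glue_three.2.1
    · rw [arcB_neg_one]; exact h.glue_two.2.1
  · exact G.interior_subset_diff (h.arcB_mem_interior hu h0)

open Classical in
/-- A closed curve through the handle. -/
def curve (_ : G.Handle t b l) (u : Circle) : G.Surface :=
  if (u : ℂ).im ≤ 0 then G.projC (arcA t l u) else G.projC (arcB b l u)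

theorem curve_of_nonpos {u : Circle} (hi : (u : ℂ).im ≤ 0) :
    h.curve u = G.projC (arcA t l u) := if_pos hi

theorem curve_of_nonneg {u : Circle} (hi : 0 ≤ (u : ℂ).im) :
    h.curve u = G.projC (arcB b l u) := by
  rcases eq_or_lt_of_le hi with h0 | h0
  · rw [h.curve_of_nonpos h0.ge]
    rcases eq_one_or_of_im_eq_zero (Circle.norm_coe u) h0.symm with h1 | h1 <;> rw [h1]
    · rw [arcA_one, arcB_one]; exact h.glue_three.2.2
    · rw [arcA_neg_one, arcB_neg_one]; exact h.glue_two.2.2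
  · exact if_neg (not_le.2 h0)

theorem continuous_curve : Continuous h.curve := by
  have hA : ContinuousOn h.curve {u : Circle | (u : ℂ).im ≤ 0} := by
    refine ContinuousOn.congr (f := fun u : Circle => G.projC (arcA t l u)) ?_
      fun u hu => h.curve_of_nonpos hu
    refine continuousOn_projC.comp (Continuous.continuousOn ?_)
      fun u hu => h.arcA_mem (Circle.norm_coe u) hu
    unfold arcA; fun_prop
  have hB : ContinuousOn h.curve {u : Circle | 0 ≤ (u : ℂ).im} := by
    refine ContinuousOn.congr (f := fun u : Circle => G.projC (arcB b l u)) ?_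
      fun u hu => h.curve_of_nonneg hu
    refine continuousOn_projC.comp (Continuous.continuousOn ?_)
      fun u hu => h.arcB_mem (Circle.norm_coe u) hu
    unfold arcB
    have := Complex.continuous_conj
    fun_prop
  have hc : Continuous fun u : Circle => (u : ℂ).im :=
    Complex.continuous_im.comp (by fun_prop)
  have := hA.union_of_isClosed hB (isClosed_le hc continuous_const) (isClosed_le continuous_const hc)
  rw [← continuousOn_univ]
  refine this.mono fun u _ => ?_
  exact le_total (u : ℂ).im 0

theorem injective_curve : Function.Injective h.curve := by
  have hl := h.pos
  have hl' := h.l_le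
  have hA : ∀ u : Circle, ((1 : ℝ) - 3 / 2 * l ≤ (arcA t l u).im ∧ 0 < (arcA t l u).re) := by
    intro u
    obtain ⟨h1, h2, h3⟩ := coord_A (h.norm_arcA u (Circle.norm_coe u)).le
    exact ⟨h3, by linarith [h.t_nonneg]⟩
  have hB : ∀ u : Circle, (arcB b l u).im ≤ 3 / 2 * l := fun u =>
    (coord_B (h.norm_arcB u (Circle.norm_coe u)).le).2.2
  have mixed : ∀ u u' : Circle, (u : ℂ).im ≤ 0 → 0 < (u' : ℂ).im → h.curve u ≠ h.curve u' := by
    intro u u' hu hu' he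
    rw [h.curve_of_nonpos hu, h.curve_of_nonneg hu'.le,
      projC_of_mem (h.arcA_mem (Circle.norm_coe u) hu),
      projC_of_mem (h.arcB_mem (Circle.norm_coe u') hu'.le)] at he
    refine not_mem_interior_of_proj_eq he.symm (fun h1 => ?_)
      (h.arcB_mem_interior (Circle.norm_coe u') hu')
    have h2 : arcB b l u' = arcA t l u := congrArg Subtype.val h1
    have h3 := (hA u).1
    rw [← h2] at h3
    linarith [hB u']
  intro u u' he
  rcases le_or_gt (u : ℂ).im 0 with hu | hu <;> rcases le_or_gt (u' : ℂ).im 0 with hu' | hu'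
  · have hne : ((3 / 2 * l : ℝ) : ℂ) ≠ 0 := by
      rw [Complex.ofReal_ne_zero]; linarith
    rw [h.curve_of_nonpos hu, h.curve_of_nonpos hu',
      projC_of_mem (h.arcA_mem (Circle.norm_coe u) hu),
      projC_of_mem (h.arcA_mem (Circle.norm_coe u') hu')] at he
    have hng : ∀ (u u' : Circle) (h1 h2), ¬ G.Glued ⟨arcA t l u, h1⟩ ⟨arcA t l u', h2⟩ := by
      intro u u' h1 h2 hg
      obtain ⟨h3, h4⟩ := hA u'
      rcases hg.target with ⟨_, h5, _⟩ | ⟨_, h5, _⟩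
      · change (arcA t l u').im = 0 at h5
        linarith
      · exact h4.ne' h5
    rcases proj_eq_iff.1 he with h1 | h1 | h1
    · have h2 : arcA t l u = arcA t l u' := congrArg Subtype.val h1
      exact Circle.ext (mul_left_cancel₀ hne (add_left_cancel h2))
    · exact (hng _ _ _ _ h1).elim
    · exact (hng _ _ _ _ h1).elim
  · exact (mixed u u' hu hu' he).elim
  · exact (mixed u' u hu' hu he.symm).elim
  · have hne : ((3 / 2 * l : ℝ) : ℂ) ≠ 0 := by
      rw [Complex.ofReal_ne_zero]; linarith
    rw [h.curve_of_nonneg hu.le, h.curve_of_nonneg hu'.le,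
      projC_of_mem (h.arcB_mem (Circle.norm_coe u) hu.le),
      projC_of_mem (h.arcB_mem (Circle.norm_coe u') hu'.le)] at he
    by_contra hn
    refine not_mem_interior_of_proj_eq he (fun h1 => hn ?_)
      (h.arcB_mem_interior (Circle.norm_coe u) hu)
    have h2 : arcB b l u = arcB b l u' := congrArg Subtype.val h1
    exact Circle.ext ((starRingEnd ℂ).injective (mul_left_cancel₀ hne (sub_right_injective h2)))

theorem proj_mem_range_curve {z : G.Points} :
    G.proj z ∈ range h.curve ↔ ‖z.1 - cA t l‖ = 3 / 2 * l ∨ ‖z.1 - cB b l‖ = 3 / 2 * l := by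
  have hl := h.pos
  have hne : ((3 / 2 * l : ℝ) : ℂ) ≠ 0 := by
    rw [Complex.ofReal_ne_zero]; linarith
  constructor
  · rintro ⟨u, hu⟩
    rcases le_or_gt (u : ℂ).im 0 with hi | hi
    · rw [h.curve_of_nonpos hi, projC_of_mem (h.arcA_mem (Circle.norm_coe u) hi)] at hu
      by_cases h1 : (⟨_, h.arcA_mem (Circle.norm_coe u) hi⟩ : G.Points) = z
      · left; rw [← h1]; exact h.norm_arcA u (Circle.norm_coe u)
      · have h2 := not_mem_interior_of_proj_eq hu h1
        have h3 : (u : ℂ).im = 0 := by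
          by_contra h4
          exact h2 (h.arcA_mem_interior (Circle.norm_coe u) (lt_of_le_of_ne hi h4))
        rw [← projC_of_mem, ← h.curve_of_nonpos hi, h.curve_of_nonneg h3.ge,
          projC_of_mem (h.arcB_mem (Circle.norm_coe u) h3.ge)] at hu
        have hBt : ∀ z' : G.Points, G.Glued z' z → z' = ⟨_, h.arcA_mem (Circle.norm_coe u) hi⟩ →
            ‖z.1 - cA t l‖ = 3 / 2 * l ∨ ‖z.1 - cB b l‖ = 3 / 2 * l := by
          rintro z' hg rfl
          have hg' : G.Glued ⟨_, h.arcA_mem (Circle.norm_coe u) hi⟩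
              ⟨_, h.arcB_mem (Circle.norm_coe u) h3.ge⟩ := by
            have h5 : G.proj ⟨_, h.arcA_mem (Circle.norm_coe u) hi⟩ =
                G.proj ⟨_, h.arcB_mem (Circle.norm_coe u) h3.ge⟩ := by
              rw [hu]; exact Quot.sound hg
            have e1 : (arcA t l u).im = 1 := by rw [arcA_im, h3]; ring
            have e2 : (arcB b l u).im = 0 := by rw [arcB_im, h3]; ring
            rcases proj_eq_iff.1 h5 with h6 | h6 | h6
            · have := congrArg (fun z : G.Points => z.1.im) h6
              simp only [e1, e2] at this
              norm_num at this
            · exact h6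
            · have e3 : (arcB b l u).re ≤ b + 7 / 2 * l + 3 / 2 * l :=
                (coord_B (h.norm_arcB u (Circle.norm_coe u)).le).2.1
              have e4 := h.b_le
              rcases h6.source with h7 | h7
              · change (arcB b l u).im = 1 at h7
                linarith
              · change (arcB b l u).re = 1 at h7
                linarith
          right
          rw [← hg'.right_unique hg]
          exact h.norm_arcB u (Circle.norm_coe u)
        have h6 : G.proj ⟨_, h.arcA_mem (Circle.norm_coe u) hi⟩ = G.proj z := by
          rw [← hu, ← projC_of_mem, ← projC_of_mem, ← h.curve_of_nonpos hi,
            ← h.curve_of_nonneg h3.ge]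
        rcases proj_eq_iff.1 h6 with h7 | h7 | h7
        · exact (h1 h7).elim
        · exact hBt _ h7 rfl
        · obtain ⟨e1, e2, e3⟩ := coord_A (h.norm_arcA u (Circle.norm_coe u)).le
          have e4 := h.t_nonneg; have e5 := h.l_le
          rcases h7.target with ⟨_, h8, _⟩ | ⟨_, h8, _⟩
          · change (arcA t l u).im = 0 at h8
            linarith
          · change (arcA t l u).re = 0 at h8
            linarith
    · rw [h.curve_of_nonneg hi.le, projC_of_mem (h.arcB_mem (Circle.norm_coe u) hi.le)] at hu
      by_cases h1 : (⟨_, h.arcB_mem (Circle.norm_coe u) hi.le⟩ : G.Points) = z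
      · right; rw [← h1]; exact h.norm_arcB u (Circle.norm_coe u)
      · exact (not_mem_interior_of_proj_eq hu h1
          (h.arcB_mem_interior (Circle.norm_coe u) hi)).elim
  · have hnorm : ∀ w : ℂ, ‖w‖ = 3 / 2 * l → ‖w / ((3 / 2 * l : ℝ) : ℂ)‖ = 1 := by
      intro w hw
      rw [norm_div, hw, Complex.norm_real, Real.norm_of_nonneg (by linarith),
        div_self (by linarith)]
    rintro (hz | hz)
    · set u : Circle := ⟨(z.1 - cA t l) / ((3 / 2 * l : ℝ) : ℂ),
        mem_sphere_zero_iff_norm.2 (hnorm _ hz)⟩ with hu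
      have hz2 : arcA t l u = z.1 := by
        rw [arcA, hu]
        change _ + _ * (_ / _) = _
        rw [mul_div_cancel₀ _ hne, add_sub_cancel]
      have hi : (u : ℂ).im ≤ 0 := by
        change (_ / _ : ℂ).im ≤ 0
        rw [Complex.div_ofReal_im]
        refine div_nonpos_of_nonpos_of_nonneg ?_ (by linarith)
        have := z.2.1.2.2
        simp only [cA, Complex.sub_im]
        linarith
      exact ⟨u, by rw [h.curve_of_nonpos hi, hz2, projC_coe]⟩
    · set u : Circle := ⟨-(starRingEnd ℂ) (z.1 - cB b l) / ((3 / 2 * l : ℝ) : ℂ),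
        mem_sphere_zero_iff_norm.2 (hnorm _ (by rw [norm_neg, Complex.norm_conj, hz]))⟩ with hu
      have hz2 : arcB b l u = z.1 := by
        rw [arcB, hu]
        change _ - _ * (starRingEnd ℂ) (_ / _) = _
        rw [map_div₀, Complex.conj_ofReal, mul_div_cancel₀ _ hne, map_neg, Complex.conj_conj]
        ring
      have hi : 0 ≤ (u : ℂ).im := by
        change 0 ≤ (_ / _ : ℂ).im
        rw [Complex.div_ofReal_im]
        refine div_nonneg ?_ (by linarith)
        have := z.2.1.2.1
        simp only [cB, Complex.neg_im, Complex.conj_im, Complex.sub_im]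
        linarith
      exact ⟨u, by rw [h.curve_of_nonneg hi, hz2, projC_coe]⟩

end Handle

end SquareGluing

namespace SquareGluing

variable {G : SquareGluing}

namespace Handle

variable {t b l : ℝ} (h : G.Handle t b l)

/-- The part of the surface that comes from a subset of the plane. -/
def part (G : SquareGluing) (U : Set ℂ) : Set G.Surface := G.projC '' ((unitSquare \ G.removed) ∩ U)

theorem mem_part {U : Set ℂ} {m : G.Surface} :
    m ∈ part G U ↔ ∃ z : G.Points, G.proj z = m ∧ z.1 ∈ U := by
  constructor
  · rintro ⟨z, ⟨hz, hU⟩, rfl⟩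
    exact ⟨⟨z, hz⟩, (projC_of_mem hz).symm, hU⟩
  · rintro ⟨z, rfl, hz⟩
    exact ⟨z, ⟨z.2, hz⟩, projC_coe z⟩

/-- An open annulus. -/
def annulus (c : ℂ) (r R : ℝ) : Set ℂ := {z | r < ‖z - c‖ ∧ ‖z - c‖ < R}

theorem isOpen_annulus (c : ℂ) (r R : ℝ) : IsOpen (annulus c r R) := by
  have h1 : IsOpen {z : ℂ | r < ‖z - c‖} := isOpen_lt continuous_const (by fun_prop)
  have h2 : IsOpen {z : ℂ | ‖z - c‖ < R} := isOpen_lt (by fun_prop) continuous_const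
  exact h1.inter h2

include h in
theorem isConnected_A_out : IsConnected (part G (annulus (cA t l) (3 / 2 * l) (13 / 4 * l))) := by
  have hl := h.pos
  refine isConnected_projC_image (isOpen_annulus _ _ _) ?_
  have : interior unitSquare ∩ annulus (cA t l) (3 / 2 * l) (13 / 4 * l) =
      (fun w => cA t l + (starRingEnd ℂ) w) '' halfAnnulus (3 / 2 * l) (13 / 4 * l) := by
    ext z
    constructor
    · rintro ⟨h1, h2, h3⟩
      refine ⟨(starRingEnd ℂ) (z - cA t l), ⟨?_, ?_, ?_⟩, ?_⟩
      · have := (mem_interior_unitSquare.1 h1).2.2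
        simp only [Complex.conj_im, Complex.sub_im, cA]
        linarith
      · rwa [Complex.norm_conj]
      · rwa [Complex.norm_conj]
      · change _ + (starRingEnd ℂ) ((starRingEnd ℂ) _) = _
        rw [Complex.conj_conj, add_sub_cancel]
    · rintro ⟨w, ⟨h1, h2, h3⟩, rfl⟩
      have hn : ‖cA t l + (starRingEnd ℂ) w - cA t l‖ = ‖w‖ := by
        rw [add_sub_cancel_left, Complex.norm_conj]
      refine ⟨?_, by rwa [hn], by rwa [hn]⟩
      obtain ⟨e1, e2, e3⟩ := coord_A (r := 13 / 4 * l) (hn.le.trans h3.le)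
      have e4 := h.t_nonneg; have e5 := h.t_le; have e6 := h.l_le
      refine mem_interior_unitSquare.2 ⟨⟨by linarith, by linarith⟩, by linarith, ?_⟩
      simp only [cA, Complex.add_im, Complex.conj_im]
      linarith
  rw [this]
  refine (isConnected_halfAnnulus (by linarith) (by linarith)).image _ ?_
  have := Complex.continuous_conj
  exact Continuous.continuousOn (by fun_prop)

include h in
theorem isConnected_B_out : IsConnected (part G (annulus (cB b l) (3 / 2 * l) (13 / 4 * l))) := by
  have hl := h.pos
  refine isConnected_projC_image (isOpen_annulus _ _ _) ?_
  have : interior unitSquare ∩ annulus (cB b l) (3 / 2 * l) (13 / 4 * l) =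
      (fun w => cB b l + w) '' halfAnnulus (3 / 2 * l) (13 / 4 * l) := by
    ext z
    constructor
    · rintro ⟨h1, h2, h3⟩
      refine ⟨z - cB b l, ⟨?_, h2, h3⟩, add_sub_cancel _ _⟩
      have := (mem_interior_unitSquare.1 h1).2.1
      simp only [Complex.sub_im, cB]
      linarith
    · rintro ⟨w, ⟨h1, h2, h3⟩, rfl⟩
      have hn : ‖cB b l + w - cB b l‖ = ‖w‖ := by rw [add_sub_cancel_left]
      refine ⟨?_, by rwa [hn], by rwa [hn]⟩
      obtain ⟨e1, e2, e3⟩ := coord_B (r := 13 / 4 * l) (hn.le.trans h3.le)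
      have e4 := h.b_nonneg; have e5 := h.b_le; have e6 := h.l_le
      refine mem_interior_unitSquare.2 ⟨⟨by linarith, by linarith⟩, ?_, by linarith⟩
      simp only [cB, Complex.add_im]
      linarith
  rw [this]
  refine (isConnected_halfAnnulus (by linarith) (by linarith)).image _ ?_
  exact Continuous.continuousOn (by fun_prop)

include h in
theorem isConnected_A_in : IsConnected (part G (Metric.ball (cA t l) (3 / 2 * l))) := by
  have hl := h.pos; have h1 := h.t_nonneg; have h2 := h.t_le
  refine isConnected_halfDisc ⟨⟨?_, ?_⟩, zero_le_one, le_rfl⟩ (by linarith) <;>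
    simp only [cA] <;> linarith

include h in
theorem isConnected_B_in : IsConnected (part G (Metric.ball (cB b l) (3 / 2 * l))) := by
  have hl := h.pos; have h1 := h.b_nonneg; have h2 := h.b_le
  refine isConnected_halfDisc ⟨⟨?_, ?_⟩, le_rfl, zero_le_one⟩ (by linarith) <;>
    simp only [cB] <;> linarith

theorem norm_sub_cA (x : ℝ) : ‖Complex.mk x 1 - cA t l‖ = |x - (t + 7 / 2 * l)| := by
  rw [← dist_eq_norm]; exact dist_mk_re _ _ _

theorem norm_sub_cB (x : ℝ) : ‖Complex.mk x 0 - cB b l‖ = |x - (b + 7 / 2 * l)| := by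
  rw [← dist_eq_norm]; exact dist_mk_re _ _ _

/-- The two discs around the handle, without the curve. -/
def complementaryPart (G : SquareGluing) (t b l : ℝ) : Set G.Surface :=
  (part G (Metric.ball (cA t l) (3 / 2 * l)) ∪
    part G (annulus (cB b l) (3 / 2 * l) (13 / 4 * l))) ∪
  (part G (annulus (cA t l) (3 / 2 * l) (13 / 4 * l)) ∪
    part G (Metric.ball (cB b l) (3 / 2 * l)))

include h in
theorem isConnected_complementaryPart : IsConnected (complementaryPart G t b l) := by
  have hl := h.pos
  have hin : ∀ {c z : ℂ} {r : ℝ}, ‖z - c‖ < r → z ∈ Metric.ball c r := fun hz => by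
    rwa [Metric.mem_ball, dist_eq_norm]
  have h1 : IsConnected (part G (Metric.ball (cA t l) (3 / 2 * l)) ∪
      part G (annulus (cB b l) (3 / 2 * l) (13 / 4 * l))) := by
    refine IsConnected.union ?_ h.isConnected_A_in h.isConnected_B_out
    obtain ⟨e1, e2⟩ := h.second (t + 5 / 2 * l) ⟨by linarith, by linarith⟩
    obtain ⟨e3, e4, e5⟩ := h.glue (y := b + 11 / 2 * l) ⟨by linarith, by linarith⟩ e1
      (e2.trans (by ring))
    refine ⟨_, ⟨_, ⟨e3, hin ?_⟩, rfl⟩, ⟨_, ⟨e4, ?_⟩, e5.symm⟩⟩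
    · rw [norm_sub_cA, abs_lt]; constructor <;> linarith
    · change _ < ‖_‖ ∧ ‖_‖ < _
      rw [norm_sub_cB, lt_abs, abs_lt]
      exact ⟨Or.inl (by linarith), by linarith, by linarith⟩
  have h2 : IsConnected (part G (annulus (cA t l) (3 / 2 * l) (13 / 4 * l)) ∪
      part G (Metric.ball (cB b l) (3 / 2 * l))) := by
    refine IsConnected.union ?_ h.isConnected_A_out h.isConnected_B_in
    obtain ⟨e1, e2⟩ := h.second (t + 3 / 2 * l) ⟨by linarith, by linarith⟩
    obtain ⟨e3, e4, e5⟩ := h.glue (y := b + 9 / 2 * l) ⟨by linarith, by linarith⟩ e1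
      (e2.trans (by ring))
    refine ⟨_, ⟨_, ⟨e3, ?_⟩, rfl⟩, ⟨_, ⟨e4, hin ?_⟩, e5.symm⟩⟩
    · change _ < ‖_‖ ∧ ‖_‖ < _
      rw [norm_sub_cA, lt_abs, abs_lt]
      exact ⟨Or.inr (by linarith), by linarith, by linarith⟩
    · rw [norm_sub_cB, abs_lt]; constructor <;> linarith
  refine IsConnected.union ?_ h1 h2
  obtain ⟨e1, e2⟩ := h.first (t + 1 / 2 * l) ⟨by linarith, by linarith⟩
  obtain ⟨e3, e4, e5⟩ := h.glue (y := b + 13 / 2 * l) ⟨by linarith, by linarith⟩ e1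
    (e2.trans (by ring))
  refine ⟨_, Or.inr ⟨_, ⟨e4, ?_⟩, e5.symm⟩, Or.inl ⟨_, ⟨e3, ?_⟩, rfl⟩⟩ <;>
    change _ < ‖_‖ ∧ ‖_‖ < _
  · rw [norm_sub_cB, lt_abs, abs_lt]
    exact ⟨Or.inl (by linarith), by linarith, by linarith⟩
  · rw [norm_sub_cA, lt_abs, abs_lt]
    exact ⟨Or.inr (by linarith), by linarith, by linarith⟩

theorem mem_complementaryPart {z : G.Points}
    (hz : ‖z.1 - cA t l‖ < 13 / 4 * l ∨ ‖z.1 - cB b l‖ < 13 / 4 * l)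
    (hA : ‖z.1 - cA t l‖ ≠ 3 / 2 * l) (hB : ‖z.1 - cB b l‖ ≠ 3 / 2 * l) :
    G.proj z ∈ complementaryPart G t b l := by
  rcases hz with hz | hz
  · rcases hA.lt_or_gt with h1 | h1
    · exact Or.inl (Or.inl (mem_part.2 ⟨z, rfl, by rwa [Metric.mem_ball, dist_eq_norm]⟩))
    · exact Or.inr (Or.inl (mem_part.2 ⟨z, rfl, h1, hz⟩))
  · rcases hB.lt_or_gt with h1 | h1
    · exact Or.inr (Or.inr (mem_part.2 ⟨z, rfl, by rwa [Metric.mem_ball, dist_eq_norm]⟩))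
    · exact Or.inl (Or.inr (mem_part.2 ⟨z, rfl, h1, hz⟩))

include h in
theorem exists_of_mem_complementaryPart {m : G.Surface} (hm : m ∈ complementaryPart G t b l) :
    ∃ z : G.Points, G.proj z = m ∧ (‖z.1 - cA t l‖ < 13 / 4 * l ∨ ‖z.1 - cB b l‖ < 13 / 4 * l) ∧
      ‖z.1 - cA t l‖ ≠ 3 / 2 * l ∧ ‖z.1 - cB b l‖ ≠ 3 / 2 * l := by
  have hl := h.pos
  have hl' := h.l_le
  have hAB : ∀ z : G.Points, ‖z.1 - cA t l‖ < 13 / 4 * l → ‖z.1 - cB b l‖ ≠ 3 / 2 * l := by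
    intro z h1 h2
    have e1 := (coord_A h1.le).2.2
    have e2 := (coord_B h2.le).2.2
    linarith
  have hBA : ∀ z : G.Points, ‖z.1 - cB b l‖ < 13 / 4 * l → ‖z.1 - cA t l‖ ≠ 3 / 2 * l := by
    intro z h1 h2
    have e1 := (coord_B h1.le).2.2
    have e2 := (coord_A h2.le).2.2
    linarith
  rcases hm with (hm | hm) | (hm | hm) <;> obtain ⟨z, rfl, hz⟩ := mem_part.1 hm <;>
    refine ⟨z, rfl, ?_⟩
  · rw [Metric.mem_ball, dist_eq_norm] at hz
    have hz' : ‖z.1 - cA t l‖ < 13 / 4 * l := by linarith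
    exact ⟨Or.inl hz', hz.ne, hAB z hz'⟩
  · exact ⟨Or.inr hz.2, hBA z hz.2, hz.1.ne'⟩
  · exact ⟨Or.inl hz.2, hz.1.ne', hAB z hz.2⟩
  · rw [Metric.mem_ball, dist_eq_norm] at hz
    have hz' : ‖z.1 - cB b l‖ < 13 / 4 * l := by linarith
    exact ⟨Or.inr hz', hBA z hz', hz.ne⟩

include h in
theorem mem_cuspNhd_of_lt {η : ℝ} (hη : 7 * l ≤ η) {z : G.Points}
    (hz : ‖z.1 - cA t l‖ < 13 / 4 * l ∨ ‖z.1 - cB b l‖ < 13 / 4 * l) :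
    G.proj z ∈ G.cuspNhd η := by
  have hl := h.pos
  rcases hz with hz | hz
  · refine mem_cuspNhd.2 ⟨z, rfl, _, h.top_removed, ?_⟩
    have h1 : dist (cA t l) (Complex.mk t 1) = 7 / 2 * l := by
      rw [cA, dist_mk_re, abs_of_nonneg] <;> linarith
    have h2 := dist_triangle z.1 (cA t l) (Complex.mk t 1)
    rw [← dist_eq_norm] at hz
    linarith
  · refine mem_cuspNhd.2 ⟨z, rfl, _, h.bot_removed, ?_⟩
    have h1 : dist (cB b l) (Complex.mk b 0) = 7 / 2 * l := by
      rw [cB, dist_mk_re, abs_of_nonneg] <;> linarith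
    have h2 := dist_triangle z.1 (cB b l) (Complex.mk b 0)
    rw [← dist_eq_norm] at hz
    linarith

include h in
/-- A connected open set which contains the handle has positive genus. -/
theorem genus_ne_zero {X : Set G.Surface} (hX : IsConnected X) {η : ℝ} (hη : 7 * l ≤ η)
    (hN : G.cuspNhd η ⊆ X) : genus X ≠ 0 := by
  have hl := h.pos
  have hOX : complementaryPart G t b l ⊆ X \ range h.curve := by
    intro m hm
    obtain ⟨z, rfl, hz, h1, h2⟩ := h.exists_of_mem_complementaryPart hm
    exact ⟨hN (h.mem_cuspNhd_of_lt hη hz), fun h3 =>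
      (h.proj_mem_range_curve.1 h3).elim h1 h2⟩
  set V : Set G.Points := {z | 13 / 4 * l ≤ ‖z.1 - cA t l‖ ∧ 13 / 4 * l ≤ ‖z.1 - cB b l‖} with hV
  have hVc : IsClosed V := by
    have h1 : IsClosed {z : G.Points | 13 / 4 * l ≤ ‖z.1 - cA t l‖} :=
      isClosed_le continuous_const (by fun_prop)
    have h2 : IsClosed {z : G.Points | 13 / 4 * l ≤ ‖z.1 - cB b l‖} :=
      isClosed_le continuous_const (by fun_prop)
    exact h1.inter h2
  have hV' : ∀ z : G.Points, z ∉ V → ‖z.1 - cA t l‖ < 13 / 4 * l ∨ ‖z.1 - cB b l‖ < 13 / 4 * l := by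
    intro z hz
    by_contra! hc
    exact hz hc
  have hcurve : range h.curve ⊆ (G.proj '' V)ᶜ := by
    rintro m hm ⟨z, ⟨h1, h2⟩, rfl⟩
    rcases h.proj_mem_range_curve.1 hm with h3 | h3 <;> linarith
  have hcX : range h.curve ⊆ X := by
    intro m hm
    obtain ⟨z, rfl⟩ := proj_surjective m
    exact hN (h.mem_cuspNhd_of_lt hη (hV' z fun hz => hcurve hm ⟨z, hz, rfl⟩))
  have hpre : IsPreconnected (X \ range h.curve) := by
    refine IsPreconnected.diff_of_connected_nhd hX.isPreconnected
      (isCompact_range h.continuous_curve).isClosed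
      h.isConnected_complementaryPart.isPreconnected hOX
      (isClosedMap_proj V hVc).isOpen_compl hcurve ?_
    rintro m ⟨h1, h2⟩
    obtain ⟨z, rfl⟩ := proj_surjective m
    rw [h.proj_mem_range_curve, not_or] at h2
    exact mem_complementaryPart (hV' z fun hz => h1 ⟨z, hz, rfl⟩) h2.1 h2.2
  have hcon : IsConnected (X \ range h.curve) :=
    ⟨h.isConnected_complementaryPart.nonempty.mono hOX, hpre⟩
  set c : Fin 1 → Circle → X := fun _ u => ⟨h.curve u, hcX (mem_range_self u)⟩ with hc
  have himage : Subtype.val '' (⋃ i, range (c i))ᶜ = X \ range h.curve := by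
    ext m
    constructor
    · rintro ⟨⟨m, hm⟩, hm', rfl⟩
      refine ⟨hm, ?_⟩
      rintro ⟨u, rfl⟩
      exact hm' (mem_iUnion.2 ⟨0, u, rfl⟩)
    · rintro ⟨hm, hm'⟩
      refine ⟨⟨m, hm⟩, fun h1 => ?_, rfl⟩
      obtain ⟨i, u, hu⟩ := mem_iUnion.1 h1
      exact hm' ⟨u, congrArg Subtype.val hu⟩
  have hcon' : IsConnected (⋃ i, range (c i))ᶜ := by
    rw [← himage] at hcon
    exact ⟨hcon.nonempty.of_image, IsInducing.subtypeVal.isPreconnected_image.1 hcon.isPreconnected⟩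
  have h1 : ((1 : ℕ) : ℕ∞) ≤ genus X := by
    refine le_iSup₂ (f := fun (n : ℕ) (_ : _) => (n : ℕ∞)) 1 ⟨c, fun i => ?_, fun i => ?_, ?_, hcon'⟩
    · exact h.continuous_curve.subtype_mk _
    · intro u u' hu
      exact h.injective_curve (congrArg Subtype.val hu)
    · intro i j hij
      exact (hij (Subsingleton.elim _ _)).elim
  intro h0
  rw [h0] at h1
  simp at h1

end Handle

/-- There are arbitrarily small handles. -/
def HasHandles (G : SquareGluing) : Prop := ∀ η > 0, ∃ t b l, l < η ∧ G.Handle t b l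

theorem not_isPlanar (hG : G.IsMerging) (hH : G.HasHandles) (e : TopEnd G.Surface) :
    ¬ e.IsPlanar := by
  rintro ⟨K, hK⟩
  obtain ⟨η, hη, hN⟩ := exists_cuspNhd_subset_compl K.isCompact
  obtain ⟨y, hy⟩ := (isConnected_cuspNhd hG hη).nonempty
  have he := TopEnd_comp_eq hG e K hη hN hy
  obtain ⟨t, b, l, hl, h⟩ := hH (η / 7) (by positivity)
  refine h.genus_ne_zero (X := e.comp K) (η := η) ?_ (by linarith) ?_ hK
  · rw [he]; exact isConnected_connectedComponentIn_iff.2 (hN hy)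
  · rw [he]
    exact (isConnected_cuspNhd hG hη).isPreconnected.subset_connectedComponentIn hy hN

theorem existsUnique_nonplanar_end (hG : G.IsMerging) (hH : G.HasHandles) :
    ∃! e : TopEnd G.Surface, ¬ e.IsPlanar := by
  obtain ⟨e⟩ := nonempty_topEnd hG
  exact ⟨e, not_isPlanar hG hH e, fun e' _ => subsingleton_topEnd hG e' e⟩

theorem finite_planar_ends (hG : G.IsMerging) (hH : G.HasHandles) :
    {e : TopEnd G.Surface | e.IsPlanar}.Finite := by
  convert Set.finite_empty
  exact eq_empty_of_forall_notMem fun e he => not_isPlanar hG hH e he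

end SquareGluing

/-! ### The wild singularity -/

namespace SquareGluing

variable {G : SquareGluing}

/-- In the plane, the covering differs locally by a translation from the projection of the square,
so it differs by one translation over a connected set. -/
theorem exists_translation_of_isTranslationCovering {U : Set G.Surface} {V : Set ℂ} {f : U → V}
    (hf : IsTranslationCovering f) {T : Set ℂ} (hT : IsPreconnected T)
    (hTm : T ⊆ unitSquare \ G.removed) (hTU : ∀ z (hz : z ∈ T), G.proj ⟨z, hTm hz⟩ ∈ U) :
    ∃ c : ℂ, ∀ z (hz : z ∈ T), (f ⟨G.proj ⟨z, hTm hz⟩, hTU z hz⟩ : ℂ) = z + c := by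
  rcases T.eq_empty_or_nonempty with rfl | ⟨z₀, hz₀⟩
  · exact ⟨0, fun z hz => hz.elim⟩
  set g : T → ℂ := fun z => (f ⟨G.proj ⟨z, hTm z.2⟩, hTU z z.2⟩ : ℂ) - z with hg
  have hloc : IsLocallyConstant g := by
    rw [IsLocallyConstant.iff_eventually_eq]
    intro z
    have hι : Continuous fun w : T => (⟨w, hTm w.2⟩ : G.Points) := by fun_prop
    have hp : Continuous fun w : T => (⟨G.proj ⟨w, hTm w.2⟩, hTU w w.2⟩ : U) :=
      (continuous_proj.comp hι).subtype_mk _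
    obtain ⟨e, he, h1, h2⟩ := hf.translation ⟨G.proj ⟨z, hTm z.2⟩, hTU z z.2⟩
    filter_upwards [hp.continuousAt.eventually h2,
      hι.continuousAt.eventually (G.isInherited e he _ h1)] with w h3 h4
    simp only [hg]
    linear_combination h3 + h4
  have : PreconnectedSpace T := Subtype.preconnectedSpace hT
  refine ⟨g ⟨z₀, hz₀⟩, fun z hz => ?_⟩
  rw [← hloc.apply_eq_of_preconnectedSpace ⟨z, hz⟩ ⟨z₀, hz₀⟩]
  simp only [hg]
  ring

variable {C : MetricCompletion G.Surface}

theorem dist_extension_le {Φ : ℂ → C.Carrier} (hΦ : ContinuousOn Φ unitSquare)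
    (hΦι : ∀ z : G.Points, Φ z = C.ι (G.proj z)) {z w : ℂ} (hz : z ∈ unitSquare)
    (hw : w ∈ unitSquare) : dist (Φ z) (Φ w) ≤ dist z w := by
  have h1 : LipschitzOnWith 1 Φ (interior unitSquare) := fun a ha b hb => by
    rw [hΦι ⟨a, G.interior_subset_diff ha⟩, hΦι ⟨b, G.interior_subset_diff hb⟩,
      ENNReal.coe_one, one_mul]
    exact edist_ι_proj_le C _ _
  have h2 : LipschitzOnWith 1 Φ (closure (interior unitSquare)) :=
    h1.closure (hΦ.mono closure_interior_unitSquare.le)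
  rw [closure_interior_unitSquare] at h2
  simpa using h2.dist_le_mul z hz w hw

theorem segment_horizontal (a c y : ℝ) :
    IsPreconnected {z : ℂ | z.re ∈ Ioo a c ∧ z.im = y} := by
  have : {z : ℂ | z.re ∈ Ioo a c ∧ z.im = y} = (fun x : ℝ => Complex.mk x y) '' Ioo a c := by
    ext z
    constructor
    · rintro ⟨h1, rfl⟩; exact ⟨z.re, h1, rfl⟩
    · rintro ⟨x, hx, rfl⟩; exact ⟨hx, rfl⟩
  rw [this]
  refine isPreconnected_Ioo.image _ ?_
  have : (fun x : ℝ => Complex.mk x y) = fun x : ℝ => (x : ℂ) + y * Complex.I := by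
    ext x; apply Complex.ext <;> simp
  rw [this]
  fun_prop

theorem segment_vertical (x a c : ℝ) :
    IsPreconnected {z : ℂ | z.re = x ∧ z.im ∈ Icc a c} := by
  have : {z : ℂ | z.re = x ∧ z.im ∈ Icc a c} = (fun y : ℝ => Complex.mk x y) '' Icc a c := by
    ext z
    constructor
    · rintro ⟨rfl, h1⟩; exact ⟨z.im, h1, rfl⟩
    · rintro ⟨x, hx, rfl⟩; exact ⟨rfl, hx⟩
  rw [this]
  refine isPreconnected_Icc.image _ ?_
  have : (fun y : ℝ => Complex.mk x y) = fun y : ℝ => (x : ℂ) + y * Complex.I := by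
    ext x; apply Complex.ext <;> simp
  rw [this]
  fun_prop

/-- If a straight segment of the square ends at a singularity `σ`, then its development by a
covering of the punctured disc around `σ` ends at the puncture or outside of the disc. -/
theorem eq_zero_of_segment_end {Φ : ℂ → C.Carrier} (hΦ : ContinuousOn Φ unitSquare)
    (hΦι : ∀ z : G.Points, Φ z = C.ι (G.proj z)) {σ : C.Carrier} {ε : ℝ}
    {f : (C.ι ⁻¹' (Metric.ball σ ε \ {σ}) : Set _) → (Metric.ball (0 : ℂ) ε \ {0} : Set ℂ)}
    (hf : IsTranslationCovering f) {x d c : ℂ} (hend : Φ (x + d) = σ) (hendm : x + d ∈ unitSquare)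
    (hm : ∀ r ∈ Ico (0 : ℝ) 1, x + r * d ∈ unitSquare \ G.removed)
    (hU : ∀ r (hr : r ∈ Ico (0 : ℝ) 1), G.proj ⟨x + r * d, hm r hr⟩ ∈
      C.ι ⁻¹' (Metric.ball σ ε \ {σ}))
    (hfc : ∀ r (hr : r ∈ Ico (0 : ℝ) 1),
      (f ⟨G.proj ⟨x + r * d, hm r hr⟩, hU r hr⟩ : ℂ) = x + r * d + c)
    (hε : ‖x + d + c‖ < ε) : x + d + c = 0 := by
  by_contra hne
  set s : Set unitInterval := {u | u ≠ 1} with hs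
  have hs1 : ∀ u ∈ s, (u : ℝ) ∈ Ico (0 : ℝ) 1 := fun u hu =>
    ⟨u.2.1, lt_of_le_of_ne u.2.2 fun h => hu (Subtype.ext h)⟩
  have hV : ∀ u : unitInterval, x + (u : ℝ) * d + c ∈ Metric.ball (0 : ℂ) ε \ {0} := by
    intro u
    by_cases hu : u = 1
    · subst hu
      simpa using ⟨hε, hne⟩
    · rw [← hfc u (hs1 u hu)]
      exact (f _).2
  set γ : C(unitInterval, (Metric.ball (0 : ℂ) ε \ {0} : Set ℂ)) :=
    ⟨fun u => ⟨x + (u : ℝ) * d + c, hV u⟩, by fun_prop⟩ with hγ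
  have h0 : (0 : ℝ) ∈ Ico (0 : ℝ) 1 := by norm_num
  obtain ⟨Γ, hΓ, hΓ0⟩ := hf.covering.exists_path_lifts γ ⟨_, hU 0 h0⟩ (by
    apply Subtype.ext
    rw [hfc 0 h0]
    simp [hγ])
  classical
  set g : unitInterval → (C.ι ⁻¹' (Metric.ball σ ε \ {σ}) : Set _) := fun u =>
    if hu : u ∈ s then ⟨_, hU u (hs1 u hu)⟩ else ⟨_, hU 0 h0⟩ with hg
  have hgs : ∀ u (hu : u ∈ s), g u = ⟨_, hU u (hs1 u hu)⟩ := fun u hu => dif_pos hu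
  have hgc : ContinuousOn g s := by
    rw [continuousOn_iff_continuous_domRestrict]
    have : Continuous fun u : s => (⟨G.proj ⟨x + ((u : unitInterval) : ℝ) * d,
        hm _ (hs1 u u.2)⟩, hU _ (hs1 u u.2)⟩ : (C.ι ⁻¹' (Metric.ball σ ε \ {σ}) : Set _)) :=
      (continuous_proj.comp (Continuous.subtype_mk (by fun_prop) _)).subtype_mk _
    refine this.congr fun u => ?_
    rw [Set.domRestrict_apply, hgs u u.2]
  have hsc : IsPreconnected s := by
    have : s = Iio 1 := by
      ext u
      exact ⟨fun h => lt_of_le_of_ne u.2.2 fun h' => h (Subtype.ext h'), fun h => ne_of_lt h⟩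
    rw [this]
    exact isPreconnected_Iio
  have h0s : (0 : unitInterval) ∈ s := zero_ne_one
  have heq : s.EqOn Γ g := by
    refine hf.covering.eqOn_of_comp_eqOn hsc Γ.continuous.continuousOn hgc (fun u hu => ?_) h0s ?_
    · rw [hΓ, Function.comp_apply, hgs u hu]
      apply Subtype.ext
      rw [hfc u (hs1 u hu)]
      rfl
    · rw [hΓ0, hgs 0 h0s]
      rfl
  have hcl : (𝓝[s] (1 : unitInterval)).NeBot := by
    have : s = ({1} : Set unitInterval)ᶜ := rfl
    rw [this]
    infer_instance
  have h1 : Tendsto (fun u => C.ι (Γ u)) (𝓝[s] 1) (𝓝 (C.ι (Γ 1))) :=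
    (((continuous_ι C).comp (continuous_subtype_val.comp Γ.continuous)).tendsto 1).mono_left
      nhdsWithin_le_nhds
  have h2 : Tendsto (fun u : unitInterval => Φ (x + (u : ℝ) * d)) (𝓝[s] 1) (𝓝 σ) := by
    rw [← hend]
    have h3 : Tendsto (fun u : unitInterval => x + (u : ℝ) * d) (𝓝[s] 1) (𝓝 (x + d)) := by
      have : Continuous fun u : unitInterval => x + (u : ℝ) * d := by fun_prop
      simpa using (this.tendsto 1).mono_left nhdsWithin_le_nhds
    exact (hΦ _ hendm).tendsto.comp (tendsto_nhdsWithin_iff.2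
      ⟨h3, eventually_nhdsWithin_of_forall fun u hu => (hm u (hs1 u hu)).1⟩)
  have h3 : C.ι (Γ 1) = σ := by
    refine tendsto_nhds_unique_of_eventuallyEq h1 h2 (eventually_nhdsWithin_of_forall fun u hu => ?_)
    change C.ι (Γ u) = Φ _
    rw [heq hu, hgs u hu]
    exact (hΦι _).symm
  exact (Γ 1).2.2 h3

end SquareGluing

namespace SquareGluing

variable {G : SquareGluing} {C : MetricCompletion G.Surface}

/-- With arbitrarily small handles, no punctured ball around the singularity is a cyclic covering
of a punctured disc: the midpoint of a short saddle connection would have to lie far from the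
boundary of the disc, and both endpoints would have to lie over the puncture. -/
theorem not_isCyclicCover (hH : G.HasHandles) {Φ : ℂ → C.Carrier} (hΦ : ContinuousOn Φ unitSquare)
    (hΦι : ∀ z : G.Points, Φ z = C.ι (G.proj z)) {σ : C.Carrier}
    (hσ : ∀ r ∈ G.removed, Φ r = σ) {ε : ℝ} (hε : 0 < ε) (k : ℕ∞) :
    ¬ C.IsCyclicCover σ ε k := by
  rintro ⟨-, -, f, hf, -⟩
  have hσC : σ ∈ C.singularities := by
    rw [singularities_eq_image hΦ hΦι]
    exact ⟨0, G.zero_mem_removed, hσ 0 G.zero_mem_removed⟩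
  have hmem : ∀ (z : ℂ) (hz : z ∈ unitSquare \ G.removed), ∀ r ∈ G.removed, dist z r < ε →
      G.proj ⟨z, hz⟩ ∈ C.ι ⁻¹' (Metric.ball σ ε \ {σ}) := by
    intro z hz r hr hd
    refine ⟨?_, fun h => hσC ⟨_, h⟩⟩
    rw [← hΦι ⟨z, hz⟩, Metric.mem_ball, ← hσ r hr]
    exact (dist_extension_le hΦ hΦι hz.1 (G.removed_subset_unitSquare hr)).trans_lt hd
  set s := min (ε / 2) (1 / 4) with hs
  have hs0 : 0 < s := lt_min (by linarith) (by norm_num)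
  have hs1 : s ≤ ε / 2 := min_le_left _ _
  have hs2 : s ≤ 1 / 4 := min_le_right _ _
  set δ := s ^ 2 / (2 * ε) with hδ
  have hδ0 : 0 < δ := by positivity
  have hδs : 2 * ε * δ = s ^ 2 := by rw [hδ]; field_simp
  have hδε : δ ≤ ε / 8 := by nlinarith
  obtain ⟨t, b, l, hlδ, h⟩ := hH δ hδ0
  have hl := h.pos
  have ht0 := h.t_nonneg
  have ht1 := h.t_le
  have hb0 := h.b_nonneg
  have hb1 := h.b_le
  obtain ⟨g1, g2, g3⟩ := h.glue_two
  -- the three segments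
  set T₁ : Set ℂ := {z | z.re = b + 5 * l ∧ z.im ∈ Icc 0 s} with hT₁
  set T₂ : Set ℂ := {z | z.re = t + 2 * l ∧ z.im ∈ Icc (1 - s) 1} with hT₂
  set T₃ : Set ℂ := {z | z.re ∈ Ioo (b + 4 * l) (b + 6 * l) ∧ z.im = 0} with hT₃
  have m₁ : T₁ ⊆ unitSquare \ G.removed := by
    rintro z ⟨h1, h2⟩
    rcases h2.1.eq_or_lt with h3 | h3
    · have : z = Complex.mk (b + 5 * l) 0 := Complex.ext h1 h3.symm
      rwa [this]
    · refine G.interior_subset_diff (mem_interior_unitSquare.2 ⟨⟨?_, ?_⟩, h3, ?_⟩) <;>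
        linarith [h2.2]
  have m₂ : T₂ ⊆ unitSquare \ G.removed := by
    rintro z ⟨h1, h2⟩
    rcases h2.2.eq_or_lt with h3 | h3
    · have : z = Complex.mk (t + 2 * l) 1 := Complex.ext h1 h3
      rwa [this]
    · refine G.interior_subset_diff (mem_interior_unitSquare.2 ⟨⟨?_, ?_⟩, ?_, h3⟩) <;>
        linarith [h2.1]
  have m₃ : T₃ ⊆ unitSquare \ G.removed := by
    rintro z ⟨h1, h2⟩
    obtain ⟨h3, h4⟩ := h.second (z.re - b - 3 * l + t) ⟨by linarith [h1.1], by linarith [h1.2]⟩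
    have := (h.glue (y := z.re) ⟨by linarith [h1.1], by linarith [h1.2]⟩ h3
      (by rw [h4]; ring)).2.1
    rwa [show z = Complex.mk z.re 0 from Complex.ext rfl h2]
  have u₁ : ∀ z (hz : z ∈ T₁), G.proj ⟨z, m₁ hz⟩ ∈ C.ι ⁻¹' (Metric.ball σ ε \ {σ}) := by
    rintro z ⟨h1, h2⟩
    refine hmem z _ _ h.left_removed ?_
    rw [Complex.dist_eq]
    refine (Complex.norm_le_abs_re_add_abs_im _).trans_lt ?_
    simp only [Complex.sub_re, Complex.sub_im, h1, sub_zero]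
    rw [abs_of_nonneg h2.1, abs_of_nonneg (by linarith)]
    linarith [h2.2]
  have u₂ : ∀ z (hz : z ∈ T₂), G.proj ⟨z, m₂ hz⟩ ∈ C.ι ⁻¹' (Metric.ball σ ε \ {σ}) := by
    rintro z ⟨h1, h2⟩
    refine hmem z _ _ h.top_removed ?_
    rw [Complex.dist_eq]
    refine (Complex.norm_le_abs_re_add_abs_im _).trans_lt ?_
    simp only [Complex.sub_re, Complex.sub_im, h1]
    rw [abs_of_nonneg (by linarith), abs_of_nonpos (by linarith [h2.2])]
    linarith [h2.1]
  have u₃ : ∀ z (hz : z ∈ T₃), G.proj ⟨z, m₃ hz⟩ ∈ C.ι ⁻¹' (Metric.ball σ ε \ {σ}) := by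
    rintro z ⟨h1, h2⟩
    refine hmem z _ _ h.left_removed ?_
    rw [Complex.dist_eq]
    refine (Complex.norm_le_abs_re_add_abs_im _).trans_lt ?_
    simp only [Complex.sub_re, Complex.sub_im, h2, sub_zero, abs_zero, add_zero]
    rw [abs_of_nonneg (by linarith [h1.1])]
    linarith [h1.2]
  obtain ⟨c₁, hc₁⟩ := exists_translation_of_isTranslationCovering hf (segment_vertical _ _ _) m₁ u₁
  obtain ⟨c₂, hc₂⟩ := exists_translation_of_isTranslationCovering hf (segment_vertical _ _ _) m₂ u₂
  obtain ⟨c₃, hc₃⟩ := exists_translation_of_isTranslationCovering hf (segment_horizontal _ _ _) m₃ u₃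
  have p₁ : Complex.mk (b + 5 * l) 0 ∈ T₁ := ⟨rfl, le_rfl, hs0.le⟩
  have p₂ : Complex.mk (t + 2 * l) 1 ∈ T₂ := ⟨rfl, by simpa using hs0.le, le_rfl⟩
  have p₃ : Complex.mk (b + 5 * l) 0 ∈ T₃ :=
    ⟨⟨by linarith, by linarith⟩, rfl⟩
  have e₁₃ : c₁ = c₃ := by
    have h1 := hc₁ _ p₁
    have h3 := hc₃ _ p₃
    exact add_left_cancel (h1.symm.trans h3)
  set w := Complex.mk (b + 5 * l) 0 + c₁ with hw
  have e₁₂ : Complex.mk (t + 2 * l) 1 + c₂ = w := by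
    rw [hw, ← hc₁ _ p₁, ← hc₂ _ p₂]
    rw [projC_of_mem g1, projC_of_mem g2] at g3
    congr 2
    exact Subtype.ext g3
  have n₁ : ‖w + s * Complex.I‖ < ε := by
    have p : Complex.mk (b + 5 * l) s ∈ T₁ := ⟨rfl, hs0.le, le_rfl⟩
    have e : w + s * Complex.I = Complex.mk (b + 5 * l) s + c₁ := by
      rw [hw]; apply Complex.ext <;> simp; ring
    rw [e, ← hc₁ _ p]
    simpa using (f _).2.1
  have n₂ : ‖w - s * Complex.I‖ < ε := by
    have p : Complex.mk (t + 2 * l) (1 - s) ∈ T₂ := ⟨rfl, le_rfl, by simpa using hs0.le⟩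
    have e : w - s * Complex.I = Complex.mk (t + 2 * l) (1 - s) + c₂ := by
      rw [← e₁₂]; apply Complex.ext <;> simp; ring
    rw [e, ← hc₂ _ p]
    simpa using (f _).2.1
  have hwε : ‖w‖ + l < ε := by
    have hp := parallelogram_law_with_norm ℝ w (s * Complex.I)
    have hI : ‖(s : ℂ) * Complex.I‖ = s := by simp [abs_of_pos hs0]
    rw [hI] at hp
    have q1 : ‖w + s * Complex.I‖ * ‖w + s * Complex.I‖ < ε * ε :=
      mul_lt_mul'' n₁ n₁ (norm_nonneg _) (norm_nonneg _)
    have q2 : ‖w - s * Complex.I‖ * ‖w - s * Complex.I‖ < ε * ε :=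
      mul_lt_mul'' n₂ n₂ (norm_nonneg _) (norm_nonneg _)
    by_contra! hc
    have q3 : (ε - δ) * (ε - δ) ≤ ‖w‖ * ‖w‖ :=
      mul_self_le_mul_self (by linarith) (by linarith)
    nlinarith
  have key : ∀ d : ℝ, |d| = l → w + d = 0 := by
    intro d hd
    have hd' := abs_le.1 hd.le
    have hseg : ∀ r ∈ Ico (0 : ℝ) 1, Complex.mk (b + 5 * l) 0 + r * d ∈ T₃ := by
      intro r hr
      have : |r * d| < l := by
        rw [abs_mul, hd, abs_of_nonneg hr.1]
        nlinarith [hr.2]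
      rw [abs_lt] at this
      refine ⟨⟨?_, ?_⟩, ?_⟩ <;> simp <;> linarith
    have hend : Complex.mk (b + 5 * l) 0 + d ∈ G.removed := by
      rcases eq_or_eq_neg_of_abs_eq hd with rfl | rfl
      · convert h.right_removed using 1
        apply Complex.ext <;> simp; ring
      · convert h.left_removed using 1
        apply Complex.ext <;> simp; ring
    have := eq_zero_of_segment_end hΦ hΦι hf (x := Complex.mk (b + 5 * l) 0) (d := d) (c := c₁)
      (hσ _ hend) (G.removed_subset_unitSquare hend) (fun r hr => m₃ (hseg r hr))
      (fun r hr => u₃ _ (hseg r hr)) (fun r hr => by rw [hc₃ _ (hseg r hr), e₁₃]) ?_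
    · rw [hw, ← this]; ring
    · rw [show Complex.mk (b + 5 * l) 0 + (d : ℂ) + c₁ = w + d by rw [hw]; ring]
      refine (norm_add_le _ _).trans_lt ?_
      rwa [Complex.norm_real, Real.norm_eq_abs, hd]
  have k1 := key l (abs_of_pos hl)
  have k2 := key (-l) (by rw [abs_neg, abs_of_pos hl])
  have k3 : (2 * l : ℂ) = 0 := by
    push_cast at k2
    linear_combination k1 - k2
  norm_cast at k3
  linarith

theorem singularities_eq_singleton (hG : G.IsMerging) : ∃ (Φ : ℂ → C.Carrier) (σ : C.Carrier),
    ContinuousOn Φ unitSquare ∧ (∀ z : G.Points, Φ z = C.ι (G.proj z)) ∧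
    (∀ r ∈ G.removed, Φ r = σ) ∧ C.singularities = {σ} := by
  obtain ⟨Φ, hΦ, hΦι⟩ := exists_extension C
  have h1 : ∀ r ∈ G.removed, Φ r = Φ 0 := fun r hr =>
    hG C.Carrier Φ (hΦ.mono G.removed_subset_unitSquare) (germInvariant_extension hΦ hΦι) r hr 0
      G.zero_mem_removed
  refine ⟨Φ, Φ 0, hΦ, hΦι, h1, ?_⟩
  rw [singularities_eq_image hΦ hΦι]
  refine Subset.antisymm ?_ (singleton_subset_iff.2 ⟨0, G.zero_mem_removed, rfl⟩)
  rintro _ ⟨r, hr, rfl⟩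
  exact h1 r hr

theorem singularities_classified (hG : G.IsMerging) (hH : G.HasHandles)
    (C : MetricCompletion G.Surface) :
    (∃! σ, C.IsWildSingularity σ) ∧ {σ | C.IsConeSingularity σ}.Finite ∧
      ∀ σ ∈ C.singularities, C.IsWildSingularity σ ∨ C.IsConeSingularity σ := by
  obtain ⟨Φ, σ, hΦ, hΦι, hσ, hs⟩ := singularities_eq_singleton (C := C) hG
  have hw : C.IsWildSingularity σ :=
    ⟨by rw [hs]; rfl, fun ⟨ε, hε, k, hk⟩ => not_isCyclicCover hH hΦ hΦι hσ hε k hk⟩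
  refine ⟨⟨σ, hw, fun τ hτ => ?_⟩, ?_, fun τ hτ => Or.inl ?_⟩
  · simpa [hs] using hτ.1
  · refine (finite_singleton σ).subset fun τ hτ => ?_
    rw [← hs]; exact hτ.1
  · rw [hs] at hτ
    rwa [mem_singleton_iff.1 hτ]

end SquareGluing

/-! ### Right-isolated sets and the twist of their gaps -/

/-- A closed subset of `[0, 1]`, containing `0`, `1/2` and `1`, in which every point is isolated
on the right. -/
structure IsGapSet (S : Set ℝ) : Prop where
  isClosed : IsClosed S
  subset : S ⊆ Icc 0 1
  zero_mem : (0 : ℝ) ∈ S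
  half_mem : (1 / 2 : ℝ) ∈ S
  one_mem : (1 : ℝ) ∈ S
  isolated : ∀ s ∈ S, s < 1 → ∀ᶠ x in 𝓝[>] s, x ∉ S

/-- `(u, w)` is a bounded connected component of the complement of `S`. -/
structure IsGap (S : Set ℝ) (u w : ℝ) : Prop where
  lt : u < w
  left_mem : u ∈ S
  right_mem : w ∈ S
  not_mem : ∀ x ∈ Ioo u w, x ∉ S

/-- The length of the `n`-th piece of the twist of a gap of length one. -/
def dyad (n : ℕ) : ℝ := (1 / 2) ^ (n + 2)

theorem dyad_pos (n : ℕ) : 0 < dyad n := by rw [dyad]; positivity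

theorem dyad_succ (n : ℕ) : dyad (n + 1) = dyad n / 2 := by rw [dyad, dyad]; ring

theorem dyad_anti {m n : ℕ} (h : m ≤ n) : dyad n ≤ dyad m :=
  pow_le_pow_of_le_one (by norm_num) (by norm_num) (by omega)

theorem dyad_le (n : ℕ) : dyad n ≤ 1 / 4 :=
  (dyad_anti (Nat.zero_le n)).trans (by norm_num [dyad])

theorem tendsto_dyad : Tendsto dyad atTop (𝓝 0) :=
  (tendsto_pow_atTop_nhds_zero_of_lt_one (by norm_num) (by norm_num)).comp (tendsto_add_atTop_nat 2)

theorem dyad_unique {m n : ℕ} (h1 : dyad m < 2 * dyad n) (h2 : dyad n < 2 * dyad m) : m = n := by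
  rcases lt_trichotomy m n with h | h | h
  · have := dyad_anti (Nat.succ_le_of_lt h)
    rw [dyad_succ] at this
    linarith
  · exact h
  · have := dyad_anti (Nat.succ_le_of_lt h)
    rw [dyad_succ] at this
    linarith

/-- A point of `(0, 1)` that is not a piece endpoint lies in a piece, measured from the nearer end. -/
theorem exists_dyad {y : ℝ} (h0 : 0 < y) (h1 : y ≤ 1 / 2) :
    ∃ n, y = 2 * dyad n ∨ dyad n < y ∧ y < 2 * dyad n := by
  obtain ⟨n, h2, h3⟩ := exists_nat_pow_near_of_lt_one (x := 2 * y) (y := 1 / 2) (by linarith)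
    (by linarith) (by norm_num) (by norm_num)
  have e : dyad n = (1 / 2) ^ n / 4 := by rw [dyad]; ring
  rw [pow_succ] at h2
  refine ⟨n, ?_⟩
  rcases h3.eq_or_lt with h4 | h4
  · left; rw [e]; linarith
  · right; rw [e]; constructor <;> linarith

/-- The twist of the gaps of `S` moves the interval `(a, a + l)` by `r`. -/
def IsPiece (S : Set ℝ) (a l r : ℝ) : Prop :=
  ∃ u w n, IsGap S u w ∧ l = (w - u) * dyad n ∧
    ((a = u + l ∧ r = (w - u) - 3 * l) ∨ (a = w - 2 * l ∧ r = 3 * l - (w - u)))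

/-- The twist of the gaps of `S` moves the point `x` by `r`. -/
def Moves (S : Set ℝ) (x r : ℝ) : Prop := ∃ a l, IsPiece S a l r ∧ x ∈ Ioo a (a + l)

/-- The points that the twist of the gaps of `S` moves. -/
def twistDomain (S : Set ℝ) : Set ℝ := {x | ∃ r, Moves S x r}

open Classical in
/-- The twist of the gaps of `S`: in a gap of length one, it exchanges the interval
`(2⁻ⁿ, 2 * 2⁻ⁿ)` with the interval `(1 - 2 * 2⁻ⁿ, 1 - 2⁻ⁿ)`, for every `n ≥ 2`. -/
def twist (S : Set ℝ) (x : ℝ) : ℝ := if h : ∃ r, Moves S x r then x + h.choose else x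

variable {S : Set ℝ}

theorem IsGap.unique {u w u' w' x : ℝ} (h : IsGap S u w) (h' : IsGap S u' w')
    (hx : x ∈ Ioo u w) (hx' : x ∈ Ioo u' w') : u = u' ∧ w = w' := by
  constructor
  · rcases lt_trichotomy u u' with h1 | h1 | h1
    · exact absurd h'.left_mem (h.not_mem _ ⟨h1, hx'.1.trans hx.2⟩)
    · exact h1
    · exact absurd h.left_mem (h'.not_mem _ ⟨h1, hx.1.trans hx'.2⟩)
  · rcases lt_trichotomy w w' with h1 | h1 | h1
    · exact absurd h.right_mem (h'.not_mem _ ⟨hx'.1.trans hx.2, h1⟩)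
    · exact h1
    · exact absurd h'.right_mem (h.not_mem _ ⟨hx.1.trans hx'.2, h1⟩)

theorem IsPiece.pos {a l r : ℝ} (h : IsPiece S a l r) : 0 < l := by
  obtain ⟨u, w, n, hg, rfl, -⟩ := h
  exact mul_pos (sub_pos.2 hg.lt) (dyad_pos n)

theorem IsPiece.neg {a l r : ℝ} (h : IsPiece S a l r) : IsPiece S (a + r) l (-r) := by
  obtain ⟨u, w, n, hg, hl, ⟨h1, h2⟩ | ⟨h1, h2⟩⟩ := h
  · exact ⟨u, w, n, hg, hl, Or.inr ⟨by rw [h1, h2]; ring, by rw [h2]; ring⟩⟩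
  · exact ⟨u, w, n, hg, hl, Or.inl ⟨by rw [h1, h2]; ring, by rw [h2]; ring⟩⟩

theorem IsGap.piece_le {u w : ℝ} (h : IsGap S u w) (n : ℕ) :
    0 < (w - u) * dyad n ∧ 4 * ((w - u) * dyad n) ≤ w - u := by
  have h1 := sub_pos.2 h.lt
  refine ⟨mul_pos h1 (dyad_pos n), ?_⟩
  nlinarith [dyad_le n]

/-- Every piece lies in a gap, with the piece to which it is moved. -/
theorem IsPiece.exists_gap {a l r : ℝ} (h : IsPiece S a l r) :
    ∃ u w, IsGap S u w ∧ u < a ∧ a + l < w ∧ u < a + r ∧ a + r + l < w := by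
  obtain ⟨u, w, n, hg, hl, ⟨h1, h2⟩ | ⟨h1, h2⟩⟩ := h <;>
  · obtain ⟨h3, h4⟩ := hg.piece_le n
    rw [← hl] at h3 h4
    exact ⟨u, w, hg, by linarith, by linarith, by linarith, by linarith⟩

theorem Moves.unique {x r r' : ℝ} (h : Moves S x r) (h' : Moves S x r') : r = r' := by
  obtain ⟨a, l, ⟨u, w, n, hg, hl, hp⟩, h1, h2⟩ := h
  obtain ⟨a', l', ⟨u', w', n', hg', hl', hp'⟩, h1', h2'⟩ := h'
  obtain ⟨q1, q2⟩ := hg.piece_le n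
  obtain ⟨q1', q2'⟩ := hg'.piece_le n'
  rw [← hl] at q1 q2
  rw [← hl'] at q1' q2'
  have hx : x ∈ Ioo u w := by
    rcases hp with ⟨h3, -⟩ | ⟨h3, -⟩ <;> constructor <;> linarith
  have hx' : x ∈ Ioo u' w' := by
    rcases hp' with ⟨h3, -⟩ | ⟨h3, -⟩ <;> constructor <;> linarith
  obtain ⟨rfl, rfl⟩ := hg.unique hg' hx hx'
  have hL := sub_pos.2 hg.lt
  have key : l < 2 * l' → l' < 2 * l → l = l' := by
    intro k1 k2
    rw [hl, hl', ← mul_left_comm] at k1 k2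
    rw [hl, hl', dyad_unique (lt_of_mul_lt_mul_left k1 hL.le) (lt_of_mul_lt_mul_left k2 hL.le)]
  rcases hp with ⟨h3, h4⟩ | ⟨h3, h4⟩ <;> rcases hp' with ⟨h3', h4'⟩ | ⟨h3', h4'⟩
  · rw [h4, h4', key (by linarith) (by linarith)]
  · linarith
  · linarith
  · rw [h4, h4', key (by linarith) (by linarith)]

theorem Moves.twist_eq {x r : ℝ} (h : Moves S x r) : twist S x = x + r := by
  have h' : ∃ r, Moves S x r := ⟨r, h⟩
  rw [twist, dif_pos h', h'.choose_spec.unique h]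

theorem Moves.neg {x r : ℝ} (h : Moves S x r) : Moves S (x + r) (-r) := by
  obtain ⟨a, l, h, h1, h2⟩ := h
  exact ⟨a + r, l, h.neg, by linarith, by linarith⟩

theorem Moves.eventually {x r : ℝ} (h : Moves S x r) : ∀ᶠ x' in 𝓝 x, Moves S x' r := by
  obtain ⟨a, l, h, hx⟩ := h
  filter_upwards [isOpen_Ioo.mem_nhds hx] with x' hx'
  exact ⟨a, l, h, hx'⟩

theorem isOpen_twistDomain : IsOpen (twistDomain S) :=
  isOpen_iff_mem_nhds.2 fun _ ⟨r, h⟩ => h.eventually.mono fun _ h' => ⟨r, h'⟩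

theorem twist_mem {x : ℝ} (h : x ∈ twistDomain S) : twist S x ∈ twistDomain S := by
  obtain ⟨r, h⟩ := h
  rw [h.twist_eq]
  exact ⟨_, h.neg⟩

theorem twist_twist {x : ℝ} (h : x ∈ twistDomain S) : twist S (twist S x) = x := by
  obtain ⟨r, h⟩ := h
  rw [h.twist_eq, h.neg.twist_eq]
  ring

theorem bijOn_twist : BijOn (twist S) (twistDomain S) (twistDomain S) :=
  ⟨fun _ => twist_mem, fun x hx y hy h => by rw [← twist_twist hx, h, twist_twist hy],
    fun x hx => ⟨_, twist_mem hx, twist_twist hx⟩⟩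

theorem twist_translation {x : ℝ} (h : x ∈ twistDomain S) :
    ∀ᶠ x' in 𝓝 x, twist S x' - twist S x = x' - x := by
  obtain ⟨r, h⟩ := h
  filter_upwards [h.eventually] with x' h'
  rw [h.twist_eq, h'.twist_eq]
  ring

theorem Moves.exists_gap {x r : ℝ} (h : Moves S x r) :
    ∃ u w, IsGap S u w ∧ x ∈ Ioo u w ∧ x + r ∈ Ioo u w := by
  obtain ⟨a, l, h, h1, h2⟩ := h
  obtain ⟨u, w, hg, h3, h4, h5, h6⟩ := h.exists_gap
  exact ⟨u, w, hg, ⟨by linarith, by linarith⟩, by linarith, by linarith⟩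

/-- The points `u + (w - u) / 2ⁿ⁺¹`. -/
def lowPoint (u w : ℝ) (n : ℕ) : ℝ := u + (w - u) * (2 * dyad n)

/-- The points `w - (w - u) / 2ⁿ⁺¹`. -/
def highPoint (u w : ℝ) (n : ℕ) : ℝ := w - (w - u) * (2 * dyad n)

theorem IsGap.eq_or_eq {u w x : ℝ} (h : IsGap S u w) (hx : x ∈ Ioo u w) (hD : x ∉ twistDomain S) :
    ∃ n, x = lowPoint u w n ∨ x = highPoint u w n := by
  have hL := sub_pos.2 h.lt
  rcases le_total ((x - u) / (w - u)) (1 / 2) with h1 | h1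
  · obtain ⟨n, h2 | ⟨h2, h3⟩⟩ := exists_dyad (div_pos (sub_pos.2 hx.1) hL) h1
    · refine ⟨n, Or.inl ?_⟩
      rw [lowPoint, ← h2]; field_simp; ring
    · rw [lt_div_iff₀ hL] at h2
      rw [div_lt_iff₀ hL] at h3
      exact (hD ⟨_, _, _, ⟨u, w, n, h, rfl, Or.inl ⟨rfl, rfl⟩⟩, by linarith, by linarith⟩).elim
  · have e : (w - x) / (w - u) = 1 - (x - u) / (w - u) := by field_simp; ring
    obtain ⟨n, h2 | ⟨h2, h3⟩⟩ := exists_dyad (div_pos (sub_pos.2 hx.2) hL) (by linarith)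
    · refine ⟨n, Or.inr ?_⟩
      rw [highPoint, ← h2]; field_simp; ring
    · rw [lt_div_iff₀ hL] at h2
      rw [div_lt_iff₀ hL] at h3
      exact (hD ⟨_, _, _, ⟨u, w, n, h, rfl, Or.inr ⟨rfl, rfl⟩⟩, by linarith, by linarith⟩).elim

namespace IsGapSet

variable (hS : IsGapSet S)

include hS

theorem exists_gap_right {s : ℝ} (hs : s ∈ S) (h1 : s < 1) : ∃ w, IsGap S s w := by
  obtain ⟨δ, hδ, h⟩ := mem_nhdsGT_iff_exists_Ioo_subset.1 (hS.isolated s hs h1)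
  have hδ' : s < δ := hδ
  have hδ1 : δ ≤ 1 := by
    by_contra! hc
    exact h ⟨h1, hc⟩ hS.one_mem
  have hc : IsCompact (S ∩ Icc δ 1) := isCompact_Icc.inter_left hS.isClosed
  obtain ⟨w, ⟨hwS, hw⟩, hmin⟩ := hc.exists_isLeast ⟨1, hS.one_mem, hδ1, le_rfl⟩
  refine ⟨w, hδ'.trans_le hw.1, hs, hwS, fun x hx hxS => ?_⟩
  rcases lt_or_ge x δ with h2 | h2
  · exact h ⟨hx.1, h2⟩ hxS
  · exact absurd (hmin ⟨hxS, h2, hx.2.le.trans hw.2⟩) (not_le.2 hx.2)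

theorem exists_gap {x : ℝ} (hx : x ∈ Icc (0 : ℝ) 1) (hxS : x ∉ S) :
    ∃ u w, IsGap S u w ∧ x ∈ Ioo u w := by
  have hc : IsCompact (S ∩ Icc x 1) := isCompact_Icc.inter_left hS.isClosed
  have hc' : IsCompact (S ∩ Icc 0 x) := isCompact_Icc.inter_left hS.isClosed
  obtain ⟨w, ⟨hwS, hw⟩, hmin⟩ := hc.exists_isLeast ⟨1, hS.one_mem, hx.2, le_rfl⟩
  obtain ⟨u, ⟨huS, hu⟩, hmax⟩ := hc'.exists_isGreatest ⟨0, hS.zero_mem, le_rfl, hx.1⟩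
  have hux : u < x := lt_of_le_of_ne hu.2 fun h => hxS (h ▸ huS)
  have hxw : x < w := lt_of_le_of_ne hw.1 fun h => hxS (h ▸ hwS)
  refine ⟨u, w, ⟨hux.trans hxw, huS, hwS, fun y hy hyS => ?_⟩, hux, hxw⟩
  rcases le_total y x with h | h
  · exact absurd (hmax ⟨hyS, hu.1.trans hy.1.le, h⟩) (not_le.2 hy.1)
  · exact absurd (hmin ⟨hyS, h, hy.2.le.trans hw.2⟩) (not_le.2 hy.2)

/-- Every point of `[0, 1)` lies in a half-open gap. -/
theorem exists_gap_Ico {x : ℝ} (hx : x ∈ Ico (0 : ℝ) 1) : ∃ u w, IsGap S u w ∧ x ∈ Ico u w := by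
  by_cases hxS : x ∈ S
  · obtain ⟨w, hw⟩ := hS.exists_gap_right hxS hx.2
    exact ⟨x, w, hw, le_rfl, hw.lt⟩
  · obtain ⟨u, w, h, h1⟩ := hS.exists_gap ⟨hx.1, hx.2.le⟩ hxS
    exact ⟨u, w, h, h1.1.le, h1.2⟩

theorem countable : S.Countable := by
  refine ((countable_setOfPred_isolated_right_within (s := S)).union (countable_singleton 1)).mono ?_
  intro s hs
  rcases (hS.subset hs).2.eq_or_lt with h | h
  · exact Or.inr h
  · refine Or.inl ⟨hs, ?_⟩
    have h1 := hS.isolated s hs h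
    rw [inter_comm, nhdsWithin_inter', ← disjoint_iff]
    exact disjoint_principal_right.2 h1

theorem twistDomain_subset : twistDomain S ⊆ Ioo 0 1 := by
  rintro x ⟨r, h⟩
  obtain ⟨u, w, hg, hx, -⟩ := h.exists_gap
  exact ⟨(hS.subset hg.left_mem).1.trans_lt hx.1, hx.2.trans_le (hS.subset hg.right_mem).2⟩

/-- The points of `[0, 1]` that the twist does not move. -/
theorem cases_of_not_mem {x : ℝ} (hx : x ∈ Icc (0 : ℝ) 1) (hD : x ∉ twistDomain S) :
    x ∈ S ∨ ∃ u w n, IsGap S u w ∧ x ∈ Ioo u w ∧ (x = lowPoint u w n ∨ x = highPoint u w n) := by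
  by_cases hxS : x ∈ S
  · exact Or.inl hxS
  · obtain ⟨u, w, hg, h1⟩ := hS.exists_gap hx hxS
    obtain ⟨n, hn⟩ := hg.eq_or_eq h1 hD
    exact Or.inr ⟨u, w, n, hg, h1, hn⟩

theorem countable_diff : (Icc (0 : ℝ) 1 \ twistDomain S).Countable := by
  have h1 : ∀ f : ℝ → ℝ → ℕ → ℝ, (⋃ u ∈ S, ⋃ w ∈ S, ⋃ n, {f u w n}).Countable := fun f =>
    hS.countable.biUnion fun _ _ => hS.countable.biUnion fun _ _ =>
      countable_iUnion fun _ => countable_singleton _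
  refine (hS.countable.union ((h1 lowPoint).union (h1 highPoint))).mono ?_
  rintro x ⟨hx, hD⟩
  rcases hS.cases_of_not_mem hx hD with h | ⟨u, w, n, hg, -, h⟩
  · exact Or.inl h
  · refine Or.inr (h.imp (fun h => ?_) fun h => ?_) <;>
    · simp only [mem_iUnion]
      exact ⟨u, hg.left_mem, w, hg.right_mem, n, h⟩

/-- The twist preserves the halves of `[0, 1)`. -/
theorem twist_half {x : ℝ} (h : x ∈ twistDomain S) : 1 / 2 < twist S x ↔ 1 / 2 < x := by
  obtain ⟨r, h⟩ := h
  rw [h.twist_eq]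
  obtain ⟨u, w, hg, hx, hx'⟩ := h.exists_gap
  have h1 := fun h => hg.not_mem _ h hS.half_mem
  constructor <;> intro h2
  · by_contra! h3
    rcases h3.eq_or_lt with h4 | h4
    · exact h1 (h4 ▸ hx)
    · exact h1 ⟨hx.1.trans h4, h2.trans hx'.2⟩
  · by_contra! h3
    rcases h3.eq_or_lt with h4 | h4
    · exact h1 (h4 ▸ hx')
    · exact h1 ⟨hx'.1.trans h4, h2.trans hx.2⟩

/-- A continuous function which takes the same value at the two ends of every gap is constant. -/
theorem eq_of_gap {Y : Type*} [TopologicalSpace Y] [T2Space Y] {α : ℝ → Y} (hα : ContinuousOn α S)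
    (h : ∀ u w, IsGap S u w → α u = α w) {s : ℝ} (hs : s ∈ S) : α s = α 0 := by
  set A : Set ℝ := {x ∈ S | ∀ y ∈ S, y ≤ x → α y = α 0} with hA
  have h0 : (0 : ℝ) ∈ A := ⟨hS.zero_mem, fun y hy hy0 => by
    rw [le_antisymm hy0 (hS.subset hy).1]⟩
  have hb : BddAbove A := ⟨1, fun x hx => (hS.subset hx.1).2⟩
  have hl := isLUB_csSup ⟨0, h0⟩ hb
  set m := sSup A with hm
  have hmc : m ∈ closure A := hl.mem_closure ⟨0, h0⟩
  have hmS : m ∈ S := hS.isClosed.closure_subset_iff.2 (fun x hx => hx.1) hmc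
  have hlt : ∀ y ∈ S, y < m → α y = α 0 := by
    intro y hy hym
    obtain ⟨x, hx, hyx⟩ := (lt_isLUB_iff hl).1 hym
    exact hx.2 y hy hyx.le
  have hmα : α m = α 0 := by
    have hne : (𝓝[A] m).NeBot := mem_closure_iff_nhdsWithin_neBot.1 hmc
    have h1 : Tendsto α (𝓝[A] m) (𝓝 (α m)) :=
      (hα m hmS).tendsto.mono_left (nhdsWithin_mono _ fun x hx => hx.1)
    refine tendsto_nhds_unique_of_eventuallyEq h1 tendsto_const_nhds ?_
    exact eventually_nhdsWithin_of_forall fun x hx => hx.2 x hx.1 le_rfl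
  have hmA : ∀ y ∈ S, y ≤ m → α y = α 0 := by
    intro y hy hym
    rcases hym.eq_or_lt with rfl | h1
    · exact hmα
    · exact hlt y hy h1
  rcases (hS.subset hmS).2.eq_or_lt with h1 | h1
  · exact hmA s hs (h1 ▸ (hS.subset hs).2)
  · obtain ⟨w, hw⟩ := hS.exists_gap_right hmS h1
    have hwA : w ∈ A := by
      refine ⟨hw.right_mem, fun y hy hyw => ?_⟩
      rcases le_or_gt y m with h2 | h2
      · exact hmA y hy h2
      · rcases hyw.eq_or_lt with rfl | h3
        · rw [← h _ _ hw, hmα]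
        · exact absurd hy (hw.not_mem _ ⟨h2, h3⟩)
    exact absurd (hl.1 hwA) (not_le.2 hw.lt)

end IsGapSet

/-! ### Merging along the twist of a gap -/

theorem eq_of_alternating {Y : Type*} [TopologicalSpace Y] [T2Space Y] {a a' b b' : ℕ → Y} {x : Y}
    (ha : a 0 = a' 0) (hb : b 0 = b' 0) (h1 : ∀ n, a (n + 1) = b' n) (h2 : ∀ n, a n = b' (n + 1))
    (h3 : ∀ n, a' n = b (n + 1)) (h4 : ∀ n, a' (n + 1) = b n) (hx : Tendsto a atTop (𝓝 x)) (n : ℕ) :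
    a n = x ∧ a' n = x ∧ b n = x ∧ b' n = x := by
  have p : ∀ n, a (n + 2) = a n := fun n => by rw [h1, h2]
  have p0 : ∀ n, a (2 * n) = a 0 := by
    intro n
    induction n with
    | zero => rfl
    | succ n ih => rw [mul_add, mul_one, p, ih]
  have p1 : ∀ n, a (2 * n + 1) = a 1 := by
    intro n
    induction n with
    | zero => rfl
    | succ n ih => rw [show 2 * (n + 1) + 1 = (2 * n + 1) + 2 by ring, p, ih]
  have l0 : a 0 = x := by
    have h : Tendsto (fun n : ℕ => 2 * n) atTop atTop := tendsto_atTop_atTop.2 fun k => ⟨k, fun n hn => by omega⟩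
    refine tendsto_nhds_unique ?_ (hx.comp h)
    simp only [Function.comp_def, p0]
    exact tendsto_const_nhds
  have l1 : a 1 = x := by
    have h : Tendsto (fun n : ℕ => 2 * n + 1) atTop atTop :=
      tendsto_atTop_atTop.2 fun k => ⟨k, fun n hn => by omega⟩
    refine tendsto_nhds_unique ?_ (hx.comp h)
    simp only [Function.comp_def, p1]
    exact tendsto_const_nhds
  have A : ∀ n, a n = x := by
    intro n
    obtain ⟨k, rfl | rfl⟩ := Nat.even_or_odd' n
    · rw [p0, l0]
    · rw [p1, l1]
  have B' : ∀ n, b' n = x := fun n => by rw [← h1, A]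
  have A' : ∀ n, a' n = x := by
    intro n
    induction n using Nat.twoStepInduction with
    | zero => rw [← ha, A]
    | one => rw [h4, hb, B']
    | more n ih _ => rw [h4, ← h3, ih]
  exact ⟨A n, A' n, by rw [← h4, A'], B' n⟩

section Merge

variable {S : Set ℝ} {u w : ℝ}

theorem IsGap.lowPoint_mem (h : IsGap S u w) (n : ℕ) :
    lowPoint u w n ∈ Ioo u w ∧ lowPoint u w n ∉ twistDomain S := by
  obtain ⟨q1, q2⟩ := h.piece_le n
  have hx : lowPoint u w n ∈ Ioo u w := by rw [lowPoint]; constructor <;> linarith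
  refine ⟨hx, ?_⟩
  rintro ⟨r, a, l, ⟨u', w', m, hg, hl, hp⟩, h1, h2⟩
  obtain ⟨q1', q2'⟩ := hg.piece_le m
  rw [← hl] at q1' q2'
  have hx' : lowPoint u w n ∈ Ioo u' w' := by
    rcases hp with ⟨h3, -⟩ | ⟨h3, -⟩ <;> constructor <;> linarith
  obtain ⟨rfl, rfl⟩ := h.unique hg hx hx'
  have hL := sub_pos.2 h.lt
  rw [lowPoint] at h1 h2
  rcases hp with ⟨h3, -⟩ | ⟨h3, -⟩
  · have k1 : dyad m < 2 * dyad n := by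
      refine lt_of_mul_lt_mul_left (a := w - u) ?_ hL.le
      linarith
    have k2 : 2 * dyad n < 2 * dyad m := by
      refine lt_of_mul_lt_mul_left (a := w - u) ?_ hL.le
      linarith
    have k3 := dyad_unique k1 (by linarith [dyad_pos n])
    rw [k3] at k2
    exact lt_irrefl _ k2
  · linarith

theorem IsGap.highPoint_mem (h : IsGap S u w) (n : ℕ) :
    highPoint u w n ∈ Ioo u w ∧ highPoint u w n ∉ twistDomain S := by
  obtain ⟨q1, q2⟩ := h.piece_le n
  have hx : highPoint u w n ∈ Ioo u w := by rw [highPoint]; constructor <;> linarith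
  refine ⟨hx, ?_⟩
  rintro ⟨r, a, l, ⟨u', w', m, hg, hl, hp⟩, h1, h2⟩
  obtain ⟨q1', q2'⟩ := hg.piece_le m
  rw [← hl] at q1' q2'
  have hx' : highPoint u w n ∈ Ioo u' w' := by
    rcases hp with ⟨h3, -⟩ | ⟨h3, -⟩ <;> constructor <;> linarith
  obtain ⟨rfl, rfl⟩ := h.unique hg hx hx'
  have hL := sub_pos.2 h.lt
  rw [highPoint] at h1 h2
  rcases hp with ⟨h3, -⟩ | ⟨h3, -⟩
  · linarith
  · have k1 : dyad m < 2 * dyad n := by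
      refine lt_of_mul_lt_mul_left (a := w - u) ?_ hL.le
      linarith
    have k2 : 2 * dyad n < 2 * dyad m := by
      refine lt_of_mul_lt_mul_left (a := w - u) ?_ hL.le
      linarith
    have k3 := dyad_unique k1 (by linarith [dyad_pos n])
    rw [k3] at k2
    exact lt_irrefl _ k2

theorem IsGap.endpoints_not_mem (h : IsGap S u w) : u ∉ twistDomain S ∧ w ∉ twistDomain S := by
  constructor
  · rintro ⟨r, hr⟩
    obtain ⟨u', w', hg, h1, -⟩ := hr.exists_gap
    exact hg.not_mem _ h1 h.left_mem
  · rintro ⟨r, hr⟩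
    obtain ⟨u', w', hg, h1, -⟩ := hr.exists_gap
    exact hg.not_mem _ h1 h.right_mem

theorem IsGap.tendsto_lowPoint (h : IsGap S u w) :
    Tendsto (lowPoint u w) atTop (𝓝[Icc u w \ twistDomain S] u) := by
  refine tendsto_nhdsWithin_iff.2 ⟨?_, Eventually.of_forall fun n =>
    ⟨Ioo_subset_Icc_self (h.lowPoint_mem n).1, (h.lowPoint_mem n).2⟩⟩
  have := (((tendsto_dyad.const_mul 2).const_mul (w - u)).const_add u)
  rw [mul_zero, mul_zero, add_zero] at this
  exact this

theorem IsGap.tendsto_highPoint (h : IsGap S u w) :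
    Tendsto (highPoint u w) atTop (𝓝[Icc u w \ twistDomain S] w) := by
  refine tendsto_nhdsWithin_iff.2 ⟨?_, Eventually.of_forall fun n =>
    ⟨Ioo_subset_Icc_self (h.highPoint_mem n).1, (h.highPoint_mem n).2⟩⟩
  have := (((tendsto_dyad.const_mul 2).const_mul (w - u)).const_sub w)
  rw [mul_zero, mul_zero, sub_zero] at this
  exact this

/-- If the endpoints of the pieces of a gap are identified as the twist prescribes, then all of
them are identified. -/
theorem IsGap.merge (h : IsGap S u w) {Y : Type*} [TopologicalSpace Y] [T2Space Y] {α β : ℝ → Y}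
    (hα : ContinuousOn α (Icc u w \ twistDomain S)) (hβ : ContinuousOn β (Icc u w \ twistDomain S))
    (hp : ∀ a l r, IsPiece S a l r → a ∈ Ioo u w \ twistDomain S →
      a + l ∈ Ioo u w \ twistDomain S → a + r ∈ Ioo u w \ twistDomain S →
      a + r + l ∈ Ioo u w \ twistDomain S → α a = β (a + r) ∧ α (a + l) = β (a + r + l)) :
    ∀ x ∈ Icc u w \ twistDomain S, α x = α u ∧ β x = α u := by
  have hpiece : ∀ n, (α (lowPoint u w (n + 1)) = β (highPoint u w n) ∧
      α (lowPoint u w n) = β (highPoint u w (n + 1))) ∧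
      (α (highPoint u w n) = β (lowPoint u w (n + 1)) ∧
      α (highPoint u w (n + 1)) = β (lowPoint u w n)) := by
    intro n
    have hP : IsPiece S (u + (w - u) * dyad n) ((w - u) * dyad n)
      ((w - u) - 3 * ((w - u) * dyad n)) := ⟨u, w, n, h, rfl, Or.inl ⟨rfl, rfl⟩⟩
    have hP' := hP.neg
    have e1 : lowPoint u w (n + 1) = u + (w - u) * dyad n := by rw [lowPoint, dyad_succ]; ring
    have e2 : lowPoint u w n = u + (w - u) * dyad n + (w - u) * dyad n := by rw [lowPoint]; ring
    have e3 : highPoint u w (n + 1) = w - (w - u) * dyad n := by rw [highPoint, dyad_succ]; ring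
    have e4 : highPoint u w n = w - 2 * ((w - u) * dyad n) := by rw [highPoint]; ring
    have i1 : lowPoint u w (n + 1) ∈ Ioo u w \ twistDomain S := h.lowPoint_mem _
    have i2 : lowPoint u w n ∈ Ioo u w \ twistDomain S := h.lowPoint_mem _
    have i3 : highPoint u w n ∈ Ioo u w \ twistDomain S := h.highPoint_mem _
    have i4 : highPoint u w (n + 1) ∈ Ioo u w \ twistDomain S := h.highPoint_mem _
    have f3 : u + (w - u) * dyad n + ((w - u) - 3 * ((w - u) * dyad n)) = highPoint u w n := by
      rw [e4]; ring
    have f4 : highPoint u w n + (w - u) * dyad n = highPoint u w (n + 1) := by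
      rw [e3, e4]; ring
    rw [f3] at hP'
    have f5 : highPoint u w n + -((w - u) - 3 * ((w - u) * dyad n)) = lowPoint u w (n + 1) := by
      rw [e1, e4]; ring
    rw [← e1] at hP f3
    have f6 : lowPoint u w (n + 1) + (w - u) * dyad n = lowPoint u w n := by rw [e1, e2]
    have r1 := hp _ _ _ hP i1 (by rwa [f6]) (by rwa [f3]) (by rwa [f3, f4])
    have r2 := hp _ _ _ hP' i3 (by rwa [f4]) (by rwa [f5]) (by rwa [f5, f6])
    rw [f3, f4, f6] at r1
    rw [f4, f5, f6] at r2
    exact ⟨r1, r2⟩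
  have hu := h.endpoints_not_mem
  have h0 : lowPoint u w 0 = highPoint u w 0 := by
    rw [lowPoint, highPoint, dyad]; ring
  have tu : ∀ f : ℝ → Y, ContinuousOn f (Icc u w \ twistDomain S) →
      Tendsto (fun n => f (lowPoint u w n)) atTop (𝓝 (f u)) := fun f hf =>
    (hf u ⟨left_mem_Icc.2 h.lt.le, hu.1⟩).tendsto.comp h.tendsto_lowPoint
  have tw : ∀ f : ℝ → Y, ContinuousOn f (Icc u w \ twistDomain S) →
      Tendsto (fun n => f (highPoint u w n)) atTop (𝓝 (f w)) := fun f hf =>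
    (hf w ⟨right_mem_Icc.2 h.lt.le, hu.2⟩).tendsto.comp h.tendsto_highPoint
  have key := eq_of_alternating (a := fun n => α (lowPoint u w n))
    (a' := fun n => α (highPoint u w n)) (b := fun n => β (lowPoint u w n))
    (b' := fun n => β (highPoint u w n)) (x := α u) (congrArg α h0) (congrArg β h0)
    (fun n => (hpiece n).1.1) (fun n => (hpiece n).1.2) (fun n => (hpiece n).2.1)
    (fun n => (hpiece n).2.2) (tu α hα)
  have lim : ∀ {f : ℕ → Y} {y}, Tendsto f atTop (𝓝 y) → (∀ n, f n = α u) → y = α u :=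
    fun hf hc => tendsto_nhds_unique (hf.congr hc) tendsto_const_nhds
  rintro x ⟨hx, hD⟩
  rcases hx.1.eq_or_lt with rfl | h1
  · exact ⟨rfl, lim (tu β hβ) fun n => (key n).2.2.1⟩
  rcases hx.2.eq_or_lt with rfl | h2
  · exact ⟨lim (tw α hα) fun n => (key n).2.1, lim (tw β hβ) fun n => (key n).2.2.2⟩
  obtain ⟨n, rfl | rfl⟩ := h.eq_or_eq ⟨h1, h2⟩ hD
  · exact ⟨(key n).1, (key n).2.2.1⟩
  · exact ⟨(key n).2.1, (key n).2.2.2⟩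

end Merge

/-! ### Gluings from data on the four sides -/

/-- Identifications of open subsets of full measure of opposite sides of the square. -/
structure SideData where
  /-- the glued part of the upper side -/
  top : Set ℝ
  /-- the glued part of the lower side -/
  bot : Set ℝ
  /-- the glued part of the right side -/
  right : Set ℝ
  /-- the glued part of the left side -/
  left : Set ℝ
  /-- the identification of the upper side with the lower side -/
  horiz : ℝ → ℝ
  /-- the identification of the right side with the left side -/
  vert : ℝ → ℝ
  isOpen_top : IsOpen top
  isOpen_bot : IsOpen bot
  isOpen_right : IsOpen right
  isOpen_left : IsOpen left
  top_subset : top ⊆ Ioo 0 1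
  bot_subset : bot ⊆ Ioo 0 1
  right_subset : right ⊆ Ioo 0 1
  left_subset : left ⊆ Ioo 0 1
  countable_top : (Icc 0 1 \ top).Countable
  countable_bot : (Icc 0 1 \ bot).Countable
  countable_right : (Icc 0 1 \ right).Countable
  countable_left : (Icc 0 1 \ left).Countable
  horiz_bijOn : BijOn horiz top bot
  vert_bijOn : BijOn vert right left
  horiz_translation : ∀ x ∈ top, ∀ᶠ x' in 𝓝 x, horiz x' - horiz x = x' - x
  vert_translation : ∀ y ∈ right, ∀ᶠ y' in 𝓝 y, vert y' - vert y = y' - y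

namespace SideData

variable (d : SideData)

/-- The points of the boundary that are glued. -/
def glued : Set ℂ :=
  {z | 1 / 2 < z.im ∧ z.re ∈ d.top} ∪ {z | z.im < 1 / 2 ∧ z.re ∈ d.bot} ∪
    ({z | 1 / 2 < z.re ∧ z.im ∈ d.right} ∪ {z | z.re < 1 / 2 ∧ z.im ∈ d.left})

theorem isOpen_glued : IsOpen d.glued := by
  refine ((IsOpen.inter ?_ ?_).union (IsOpen.inter ?_ ?_)).union
    ((IsOpen.inter ?_ ?_).union (IsOpen.inter ?_ ?_))
  · exact isOpen_Ioi.preimage Complex.continuous_im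
  · exact d.isOpen_top.preimage Complex.continuous_re
  · exact isOpen_Iio.preimage Complex.continuous_im
  · exact d.isOpen_bot.preimage Complex.continuous_re
  · exact isOpen_Ioi.preimage Complex.continuous_re
  · exact d.isOpen_right.preimage Complex.continuous_im
  · exact isOpen_Iio.preimage Complex.continuous_re
  · exact d.isOpen_left.preimage Complex.continuous_im

/-- The points of the boundary that are not glued. -/
def removed : Set ℂ := frontier unitSquare \ d.glued

theorem mk_one_mem {x : ℝ} : Complex.mk x 1 ∈ d.removed ↔ x ∈ Icc (0 : ℝ) 1 ∧ x ∉ d.top := by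
  have h1 : (1 : ℝ) ∉ d.right := fun h => lt_irrefl _ (d.right_subset h).2
  have h2 : (1 : ℝ) ∉ d.left := fun h => lt_irrefl _ (d.left_subset h).2
  have h3 : ¬ (1 : ℝ) < 1 / 2 := by norm_num
  have h4 : (1 / 2 : ℝ) < 1 := by norm_num
  simp only [removed, glued, Set.mem_sdiff, mem_frontier_unitSquare, mem_union,
    mem_ofPred_eq, h1, h2, h3, h4, and_false, or_false, false_and, true_and]
  simp [unitSquare]

theorem mk_zero_mem {x : ℝ} : Complex.mk x 0 ∈ d.removed ↔ x ∈ Icc (0 : ℝ) 1 ∧ x ∉ d.bot := by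
  have h1 : (0 : ℝ) ∉ d.right := fun h => lt_irrefl _ (d.right_subset h).1
  have h2 : (0 : ℝ) ∉ d.left := fun h => lt_irrefl _ (d.left_subset h).1
  have h3 : ¬ 1 / 2 < (0 : ℝ) := by norm_num
  have h4 : (0 : ℝ) < 1 / 2 := by norm_num
  simp only [removed, glued, Set.mem_sdiff, mem_frontier_unitSquare, mem_union,
    mem_ofPred_eq, h1, h2, h3, h4, and_false, or_false, false_and, true_and, false_or]
  simp [unitSquare]

theorem one_mk_mem {y : ℝ} : Complex.mk 1 y ∈ d.removed ↔ y ∈ Icc (0 : ℝ) 1 ∧ y ∉ d.right := by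
  have h1 : (1 : ℝ) ∉ d.top := fun h => lt_irrefl _ (d.top_subset h).2
  have h2 : (1 : ℝ) ∉ d.bot := fun h => lt_irrefl _ (d.bot_subset h).2
  have h3 : ¬ (1 : ℝ) < 1 / 2 := by norm_num
  have h4 : (1 / 2 : ℝ) < 1 := by norm_num
  simp only [removed, glued, Set.mem_sdiff, mem_frontier_unitSquare, mem_union,
    mem_ofPred_eq, h1, h2, h3, h4, and_false, or_false, false_and, true_and, false_or]
  simp [unitSquare]

theorem zero_mk_mem {y : ℝ} : Complex.mk 0 y ∈ d.removed ↔ y ∈ Icc (0 : ℝ) 1 ∧ y ∉ d.left := by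
  have h1 : (0 : ℝ) ∉ d.top := fun h => lt_irrefl _ (d.top_subset h).1
  have h2 : (0 : ℝ) ∉ d.bot := fun h => lt_irrefl _ (d.bot_subset h).1
  have h3 : ¬ 1 / 2 < (0 : ℝ) := by norm_num
  have h4 : (0 : ℝ) < 1 / 2 := by norm_num
  simp only [removed, glued, Set.mem_sdiff, mem_frontier_unitSquare, mem_union,
    mem_ofPred_eq, h1, h2, h3, h4, and_false, or_false, false_and, true_and, false_or]
  simp [unitSquare]

theorem removed_cases {z : ℂ} (h : z ∈ d.removed) :
    (∃ x, (x ∈ Icc (0 : ℝ) 1 ∧ x ∉ d.top) ∧ z = Complex.mk x 1) ∨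
    (∃ x, (x ∈ Icc (0 : ℝ) 1 ∧ x ∉ d.bot) ∧ z = Complex.mk x 0) ∨
    (∃ y, (y ∈ Icc (0 : ℝ) 1 ∧ y ∉ d.right) ∧ z = Complex.mk 1 y) ∨
    (∃ y, (y ∈ Icc (0 : ℝ) 1 ∧ y ∉ d.left) ∧ z = Complex.mk 0 y) := by
  obtain ⟨-, h1⟩ := mem_frontier_unitSquare.1 h.1
  obtain ⟨x, y⟩ := z
  simp only at h1
  rcases h1 with h1 | h1 | h1 | h1 <;> subst h1
  · exact Or.inr (Or.inr (Or.inr ⟨y, d.zero_mk_mem.1 h, rfl⟩))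
  · exact Or.inr (Or.inr (Or.inl ⟨y, d.one_mk_mem.1 h, rfl⟩))
  · exact Or.inr (Or.inl ⟨x, d.mk_zero_mem.1 h, rfl⟩)
  · exact Or.inl ⟨x, d.mk_one_mem.1 h, rfl⟩

/-- The gluing of the square with the given identifications of its sides. -/
def gluing : SquareGluing where
  removed := d.removed
  removed_subset := sdiff_subset
  removed_countable := by
    refine (((d.countable_top.image fun x => Complex.mk x 1).union
      (d.countable_bot.image fun x => Complex.mk x 0)).union
      ((d.countable_right.image fun y => Complex.mk 1 y).union
      (d.countable_left.image fun y => Complex.mk 0 y))).mono fun z hz => ?_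
    rcases d.removed_cases hz with ⟨x, hx, rfl⟩ | ⟨x, hx, rfl⟩ | ⟨x, hx, rfl⟩ | ⟨x, hx, rfl⟩
    · exact Or.inl (Or.inl ⟨x, hx, rfl⟩)
    · exact Or.inl (Or.inr ⟨x, hx, rfl⟩)
    · exact Or.inr (Or.inl ⟨x, hx, rfl⟩)
    · exact Or.inr (Or.inr ⟨x, hx, rfl⟩)
  removed_closed := isClosed_frontier.sdiff d.isOpen_glued
  corners := by
    rintro ⟨x, y⟩ (h1 | h1) (h2 | h2) <;> simp only at h1 h2 <;> subst h1 h2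
    · exact d.mk_zero_mem.2 ⟨by simp, fun h => lt_irrefl _ (d.bot_subset h).1⟩
    · exact d.mk_one_mem.2 ⟨by simp, fun h => lt_irrefl _ (d.top_subset h).1⟩
    · exact d.mk_zero_mem.2 ⟨by simp, fun h => lt_irrefl _ (d.bot_subset h).2⟩
    · exact d.mk_one_mem.2 ⟨by simp, fun h => lt_irrefl _ (d.top_subset h).2⟩
  horiz := d.horiz
  horiz_bijOn := by
    convert d.horiz_bijOn using 1
    · ext x
      simp only [mem_ofPred_eq, d.mk_one_mem, not_and, not_not]
      exact ⟨fun h => h.2 (Ioo_subset_Icc_self h.1), fun h => ⟨d.top_subset h, fun _ => h⟩⟩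
    · ext x
      simp only [mem_ofPred_eq, d.mk_zero_mem, not_and, not_not]
      exact ⟨fun h => h.2 (Ioo_subset_Icc_self h.1), fun h => ⟨d.bot_subset h, fun _ => h⟩⟩
  horiz_translation := fun x hx h => d.horiz_translation x (by_contra fun h' =>
    h (d.mk_one_mem.2 ⟨Ioo_subset_Icc_self hx, h'⟩))
  vert := d.vert
  vert_bijOn := by
    convert d.vert_bijOn using 1
    · ext x
      simp only [mem_ofPred_eq, d.one_mk_mem, not_and, not_not]
      exact ⟨fun h => h.2 (Ioo_subset_Icc_self h.1), fun h => ⟨d.right_subset h, fun _ => h⟩⟩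
    · ext x
      simp only [mem_ofPred_eq, d.zero_mk_mem, not_and, not_not]
      exact ⟨fun h => h.2 (Ioo_subset_Icc_self h.1), fun h => ⟨d.left_subset h, fun _ => h⟩⟩
  vert_translation := fun y hy h => d.vert_translation y (by_contra fun h' =>
    h (d.one_mk_mem.2 ⟨Ioo_subset_Icc_self hy, h'⟩))

end SideData

/-! ### The gluing of an interval exchange -/

theorem eq_of_eventually_eq {T : Set ℝ} (hT : IsPreconnected T) {g : ℝ → ℝ}
    (h : ∀ x ∈ T, ∀ᶠ y in 𝓝 x, g y = g x) {x y : ℝ} (hx : x ∈ T) (hy : y ∈ T) : g x = g y := by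
  have hloc : IsLocallyConstant fun x : T => g x :=
    (IsLocallyConstant.iff_eventually_eq _).2 fun x =>
      continuous_subtype_val.continuousAt.eventually (h x x.2)
  have : PreconnectedSpace T := Subtype.preconnectedSpace hT
  exact hloc.apply_eq_of_preconnectedSpace ⟨x, hx⟩ ⟨y, hy⟩

theorem continuous_complex_mk {f g : ℝ → ℝ} (hf : Continuous f) (hg : Continuous g) :
    Continuous fun x => Complex.mk (f x) (g x) :=
  Complex.equivRealProdCLM.symm.continuous.comp (hf.prodMk hg)

theorem IsOpen.image_of_translation {D : Set ℝ} (hD : IsOpen D) {f : ℝ → ℝ}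
    (h : ∀ x ∈ D, ∀ᶠ y in 𝓝 x, f y - f x = y - x) : IsOpen (f '' D) := by
  refine isOpen_iff_mem_nhds.2 ?_
  rintro _ ⟨x, hx, rfl⟩
  have hc : Tendsto (fun z => z - f x + x) (𝓝 (f x)) (𝓝 x) := by
    have : Continuous fun z => z - f x + x := by fun_prop
    simpa using this.tendsto (f x)
  filter_upwards [hc.eventually (h x hx), hc.eventually (hD.mem_nhds hx)] with z h1 h2
  exact ⟨_, h2, by linarith⟩

/-- A bijection from `[0, 1)` to `(0, 1)` which is a translation on the right of every point,
together with the inverse of a slope. -/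
structure ExchangeData where
  /-- the slope of the flow is the inverse of `κ` -/
  κ : ℝ
  κ_pos : 0 < κ
  κ_le : κ ≤ 1
  /-- the exchange of intervals -/
  F : ℝ → ℝ
  bijOn : BijOn F (Ico 0 1) (Ioo 0 1)
  right : ∀ x ∈ Ico (0 : ℝ) 1, ∀ᶠ y in 𝓝[>] x, F y - F x = y - x

namespace ExchangeData

variable (E : ExchangeData)

/-- The points where the exchange is a translation, except `1/2`. -/
def regular : Set ℝ := {x | x ∈ Ioo (0 : ℝ) 1 ∧ x ≠ 1 / 2 ∧ ∀ᶠ y in 𝓝 x, E.F y - E.F x = y - x}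

/-- The break points of the exchange, together with `0`, `1/2` and `1`. -/
def breaks : Set ℝ := Icc 0 1 \ E.regular

theorem eventually_translation {x : ℝ} {l : Filter ℝ} (hl : ∀ᶠ y in l, ∀ᶠ z in 𝓝 y, E.F z - E.F x = z - x) :
    ∀ᶠ y in l, ∀ᶠ z in 𝓝 y, E.F z - E.F y = z - y := by
  filter_upwards [hl] with y hy
  filter_upwards [hy] with z hz
  linarith [hy.self_of_nhds]

theorem isOpen_regular : IsOpen E.regular := by
  refine isOpen_iff_mem_nhds.2 fun x ⟨h1, h2, h3⟩ => ?_
  filter_upwards [isOpen_Ioo.mem_nhds h1, isOpen_ne.mem_nhds h2,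
    E.eventually_translation h3.eventually_nhds] with y h4 h5 h6
  exact ⟨h4, h5, h6⟩

theorem isGapSet : IsGapSet E.breaks where
  isClosed := isClosed_Icc.sdiff E.isOpen_regular
  subset := sdiff_subset
  zero_mem := ⟨by simp, fun h => lt_irrefl _ h.1.1⟩
  half_mem := ⟨by norm_num, fun h => h.2.1 rfl⟩
  one_mem := ⟨by simp, fun h => lt_irrefl _ h.1.2⟩
  isolated := by
    intro s hs h1
    have h2 := E.right s ⟨hs.1.1, h1⟩
    have h3 : ∀ᶠ y in 𝓝[>] s, y ≠ 1 / 2 := by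
      rcases eq_or_ne s (1 / 2) with h | h
      · filter_upwards [self_mem_nhdsWithin] with y hy
        exact (h ▸ hy : (1 / 2 : ℝ) < y).ne'
      · exact nhdsWithin_le_nhds (isOpen_ne.mem_nhds h)
    have h4 : ∀ᶠ y in 𝓝[>] s, ∀ᶠ z in 𝓝 y, E.F z - E.F s = z - s :=
      (eventually_eventually_nhdsWithin.2 h2).mp (by
        filter_upwards [self_mem_nhdsWithin] with y hy h
        rwa [nhdsWithin_eq_nhds.2 (isOpen_Ioi.mem_nhds hy)] at h)
    filter_upwards [h3, E.eventually_translation h4, Ioo_mem_nhdsGT h1] with y h5 h6 h7 h8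
    exact h8.2 ⟨⟨hs.1.1.trans_lt h7.1, h7.2⟩, h5, h6⟩

theorem F_eq_of_gap {u w x : ℝ} (h : IsGap E.breaks u w) (hx : x ∈ Ico u w) :
    E.F x = x + (E.F u - u) := by
  have h0 := E.isGapSet.subset h.left_mem
  have h1 := E.isGapSet.subset h.right_mem
  have hreg : ∀ y ∈ Ioo u w, y ∈ E.regular := fun y hy => by
    by_contra hc
    exact h.not_mem y hy ⟨⟨h0.1.trans hy.1.le, hy.2.le.trans h1.2⟩, hc⟩
  have hloc : ∀ y ∈ Ioo u w, ∀ᶠ z in 𝓝 y, E.F z - z = E.F y - y := by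
    intro y hy
    filter_upwards [(hreg y hy).2.2] with z hz
    linarith
  obtain ⟨y, hy1, hy2⟩ := ((E.right u ⟨h0.1, h.lt.trans_le h1.2⟩).and (Ioo_mem_nhdsGT h.lt)).exists
  rcases hx.1.eq_or_lt with rfl | h2
  · ring
  · have := eq_of_eventually_eq isPreconnected_Ioo hloc hy2 ⟨h2, hx.2⟩
    linarith

/-- The points of the upper side that are glued. -/
abbrev top : Set ℝ := twistDomain E.breaks

theorem mem_regular_of_mem_top {x : ℝ} (hx : x ∈ E.top) : x ∈ E.regular := by
  have h1 := E.isGapSet.twistDomain_subset hx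
  obtain ⟨r, hr⟩ := hx
  obtain ⟨u, w, hg, h2, -⟩ := hr.exists_gap
  by_contra hc
  exact hg.not_mem x h2 ⟨Ioo_subset_Icc_self h1, hc⟩

theorem top_subset : E.top ⊆ Ioo 0 1 := E.isGapSet.twistDomain_subset

theorem top_subset_Ico : E.top ⊆ Ico 0 1 := fun _ hx => Ioo_subset_Ico_self (E.top_subset hx)

theorem isOpen_top : IsOpen E.top := isOpen_twistDomain

/-- The points of the lower side that are glued. -/
def bot : Set ℝ := E.F '' E.top

/-- The points of the right side that are glued. -/
def rightSide : Set ℝ := {y | 1 - y / E.κ ∈ E.top} ∪ Ioo E.κ 1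

/-- The points of the left side that are glued. -/
def leftSide : Set ℝ := {y | (1 - y) / E.κ ∈ E.top} ∪ Ioo 0 (1 - E.κ)

/-- The identification of the right side with the left side. -/
def vert (y : ℝ) : ℝ := if y < E.κ then 1 - E.κ * twist E.breaks (1 - y / E.κ) else y - E.κ

theorem mem_rightSide {x : ℝ} (hx : 0 ≤ x) : E.κ * (1 - x) ∈ E.rightSide ↔ x ∈ E.top := by
  have h := E.κ_pos
  have e : 1 - E.κ * (1 - x) / E.κ = x := by field_simp; ring
  rw [rightSide, mem_union, mem_ofPred_eq, e, or_iff_left]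
  intro h1
  nlinarith [h1.1]

theorem mem_leftSide {x : ℝ} (hx : x ≤ 1) : 1 - E.κ * x ∈ E.leftSide ↔ x ∈ E.top := by
  have h := E.κ_pos
  have e : (1 - (1 - E.κ * x)) / E.κ = x := by field_simp; ring
  rw [leftSide, mem_union, mem_ofPred_eq, e, or_iff_left]
  intro h1
  nlinarith [h1.2]

theorem rightSide_cases {y : ℝ} (hy : y ∈ E.rightSide) :
    (∃ x ∈ E.top, y = E.κ * (1 - x)) ∨ y ∈ Ioo E.κ 1 := by
  have h := E.κ_pos
  refine hy.imp_left fun hy => ⟨_, hy, ?_⟩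
  field_simp; ring

theorem leftSide_cases {y : ℝ} (hy : y ∈ E.leftSide) :
    (∃ x ∈ E.top, y = 1 - E.κ * x) ∨ y ∈ Ioo 0 (1 - E.κ) := by
  have h := E.κ_pos
  refine hy.imp_left fun hy => ⟨_, hy, ?_⟩
  field_simp; ring

theorem vert_apply {x : ℝ} (hx : 0 < x) : E.vert (E.κ * (1 - x)) = 1 - E.κ * twist E.breaks x := by
  have h := E.κ_pos
  have e : 1 - E.κ * (1 - x) / E.κ = x := by field_simp; ring
  rw [vert, e, if_pos (by nlinarith)]

theorem vert_of_lt {y : ℝ} (hy : E.κ < y) : E.vert y = y - E.κ := if_neg (not_lt.2 hy.le)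

theorem countable_top : (Icc 0 1 \ E.top).Countable := E.isGapSet.countable_diff

/-- The identifications of the sides of the square that belong to the exchange. -/
def sides : SideData where
  top := E.top
  bot := E.bot
  right := E.rightSide
  left := E.leftSide
  horiz := E.F ∘ twist E.breaks
  vert := E.vert
  isOpen_top := E.isOpen_top
  isOpen_bot := E.isOpen_top.image_of_translation fun x hx => (E.mem_regular_of_mem_top hx).2.2
  isOpen_right := (E.isOpen_top.preimage (by fun_prop)).union isOpen_Ioo
  isOpen_left := (E.isOpen_top.preimage (by fun_prop)).union isOpen_Ioo
  top_subset := E.top_subset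
  bot_subset := (image_mono E.top_subset_Ico).trans E.bijOn.mapsTo.image_subset
  right_subset := by
    intro y hy
    have h := E.κ_pos
    have h' := E.κ_le
    rcases E.rightSide_cases hy with ⟨x, hx, rfl⟩ | h1
    · have := E.top_subset hx
      constructor <;> nlinarith [this.1, this.2]
    · exact ⟨h.trans h1.1, h1.2⟩
  left_subset := by
    intro y hy
    have h := E.κ_pos
    have h' := E.κ_le
    rcases E.leftSide_cases hy with ⟨x, hx, rfl⟩ | h1
    · have := E.top_subset hx
      constructor <;> nlinarith [this.1, this.2]
    · exact ⟨h1.1, by linarith [h1.2]⟩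
  countable_top := E.countable_top
  countable_bot := by
    refine ((E.countable_top.image E.F).union
      ((countable_singleton (0 : ℝ)).union (countable_singleton 1))).mono ?_
    rintro y ⟨hy, hy'⟩
    rcases hy.1.eq_or_lt with h0 | h0
    · exact Or.inr (Or.inl h0.symm)
    rcases hy.2.eq_or_lt with h1 | h1
    · exact Or.inr (Or.inr h1)
    obtain ⟨x, hx, rfl⟩ := E.bijOn.surjOn ⟨h0, h1⟩
    exact Or.inl ⟨x, ⟨Ico_subset_Icc_self hx, fun h => hy' ⟨x, h, rfl⟩⟩, rfl⟩
  countable_right := by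
    have h := E.κ_pos
    refine ((E.countable_top.image fun x => E.κ * (1 - x)).union (countable_singleton 1)).mono ?_
    rintro y ⟨hy, hy'⟩
    rcases le_or_gt y E.κ with h1 | h1
    · refine Or.inl ⟨1 - y / E.κ, ⟨⟨sub_nonneg.2 ((div_le_one h).2 h1), ?_⟩,
        fun h2 => hy' (Or.inl h2)⟩, by field_simp; ring⟩
      exact sub_le_self _ (div_nonneg hy.1 h.le)
    · rcases hy.2.eq_or_lt with h2 | h2
      · exact Or.inr h2
      · exact (hy' (Or.inr ⟨h1, h2⟩)).elim
  countable_left := by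
    have h := E.κ_pos
    refine ((E.countable_top.image fun x => 1 - E.κ * x).union (countable_singleton 0)).mono ?_
    rintro y ⟨hy, hy'⟩
    rcases le_or_gt (1 - E.κ) y with h1 | h1
    · refine Or.inl ⟨(1 - y) / E.κ, ⟨⟨div_nonneg (by linarith [hy.2]) h.le, ?_⟩,
        fun h2 => hy' (Or.inl h2)⟩, by field_simp; ring⟩
      exact (div_le_one h).2 (by linarith)
    · rcases hy.1.eq_or_lt with h2 | h2
      · exact Or.inr h2.symm
      · exact (hy' (Or.inr ⟨h2, h1⟩)).elim
  horiz_bijOn := BijOn.comp ((E.bijOn.injOn.mono E.top_subset_Ico).bijOn_image) bijOn_twist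
  vert_bijOn := by
    have h := E.κ_pos
    refine ⟨?_, ?_, ?_⟩
    · intro y hy
      rcases E.rightSide_cases hy with ⟨x, hx, rfl⟩ | h1
      · rw [E.vert_apply (E.top_subset hx).1]
        exact (E.mem_leftSide (E.top_subset (twist_mem hx)).2.le).2 (twist_mem hx)
      · rw [E.vert_of_lt h1.1]
        exact Or.inr ⟨by linarith [h1.1], by linarith [h1.2]⟩
    · intro y hy y' hy' he
      rcases E.rightSide_cases hy with ⟨x, hx, rfl⟩ | h1 <;>
        rcases E.rightSide_cases hy' with ⟨x', hx', rfl⟩ | h1'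
      · rw [E.vert_apply (E.top_subset hx).1, E.vert_apply (E.top_subset hx').1] at he
        have h2 : twist E.breaks x = twist E.breaks x' :=
          mul_left_cancel₀ h.ne' (by linarith)
        rw [bijOn_twist.injOn hx hx' h2]
      · rw [E.vert_apply (E.top_subset hx).1, E.vert_of_lt h1'.1] at he
        have := (E.top_subset (twist_mem hx)).2
        nlinarith [h1'.2]
      · rw [E.vert_apply (E.top_subset hx').1, E.vert_of_lt h1.1] at he
        have := (E.top_subset (twist_mem hx')).2
        nlinarith [h1.2]
      · rw [E.vert_of_lt h1.1, E.vert_of_lt h1'.1] at he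
        linarith
    · intro y hy
      rcases E.leftSide_cases hy with ⟨x, hx, rfl⟩ | h1
      · refine ⟨E.κ * (1 - twist E.breaks x),
          (E.mem_rightSide (E.top_subset (twist_mem hx)).1.le).2 (twist_mem hx), ?_⟩
        rw [E.vert_apply (E.top_subset (twist_mem hx)).1, twist_twist hx]
      · refine ⟨y + E.κ, Or.inr ⟨by linarith [h1.1], by linarith [h1.2]⟩, ?_⟩
        rw [E.vert_of_lt (by linarith [h1.1])]
        ring
  horiz_translation := by
    intro x hx
    have h1 := (E.mem_regular_of_mem_top (twist_mem hx)).2.2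
    have h2 := twist_translation hx
    have hc : Tendsto (twist E.breaks) (𝓝 x) (𝓝 (twist E.breaks x)) := by
      have h3 : Tendsto (fun y => y - x + twist E.breaks x) (𝓝 x) (𝓝 (twist E.breaks x)) := by
        have : Continuous fun y => y - x + twist E.breaks x := by fun_prop
        simpa using this.tendsto x
      refine h3.congr' ?_
      filter_upwards [h2] with y hy
      linarith
    filter_upwards [h2, hc.eventually h1] with y h4 h5
    simp only [Function.comp_apply]
    linarith
  vert_translation := by
    intro y hy
    have h := E.κ_pos
    rcases E.rightSide_cases hy with ⟨x, hx, rfl⟩ | h1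
    · have h2 := twist_translation hx
      have hc : Tendsto (fun y => 1 - y / E.κ) (𝓝 (E.κ * (1 - x))) (𝓝 x) := by
        have : Continuous fun y => 1 - y / E.κ := by fun_prop
        convert this.tendsto (E.κ * (1 - x)) using 2
        field_simp; ring
      filter_upwards [hc.eventually h2, hc.eventually (isOpen_Ioi.mem_nhds (E.top_subset hx).1)]
        with y h3 h4
      have e : y = E.κ * (1 - (1 - y / E.κ)) := by field_simp; ring
      have h5 : E.vert y = 1 - E.κ * twist E.breaks (1 - y / E.κ) := by
        conv_lhs => rw [e]
        exact E.vert_apply h4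
      rw [h5, E.vert_apply (E.top_subset hx).1]
      have e' : E.κ * (1 - y / E.κ) = E.κ - y := by field_simp
      linear_combination (-E.κ) * h3 - e'
    · filter_upwards [isOpen_Ioi.mem_nhds h1.1] with y' h2
      rw [E.vert_of_lt h1.1, E.vert_of_lt h2]
      ring

/-- The gluing of the square that belongs to the exchange. -/
def gluing : SquareGluing := E.sides.gluing

theorem mk_one_mem {x : ℝ} : Complex.mk x 1 ∈ E.gluing.removed ↔ x ∈ Icc (0 : ℝ) 1 ∧ x ∉ E.top :=
  E.sides.mk_one_mem

theorem mk_zero_mem {x : ℝ} : Complex.mk x 0 ∈ E.gluing.removed ↔ x ∈ Icc (0 : ℝ) 1 ∧ x ∉ E.bot :=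
  E.sides.mk_zero_mem

theorem one_mk_mem {x : ℝ} (hx : x ∈ Icc (0 : ℝ) 1) :
    Complex.mk 1 (E.κ * (1 - x)) ∈ E.gluing.removed ↔ x ∉ E.top := by
  have h := E.κ_pos
  have h' := E.κ_le
  refine E.sides.one_mk_mem.trans ?_
  rw [and_iff_right ⟨mul_nonneg h.le (by linarith [hx.2]), by nlinarith [hx.1, hx.2]⟩]
  exact (E.mem_rightSide hx.1).not

theorem zero_mk_mem {x : ℝ} (hx : x ∈ Icc (0 : ℝ) 1) :
    Complex.mk 0 (1 - E.κ * x) ∈ E.gluing.removed ↔ x ∉ E.top := by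
  have h := E.κ_pos
  have h' := E.κ_le
  refine E.sides.zero_mk_mem.trans ?_
  rw [and_iff_right ⟨by nlinarith [hx.1, hx.2], by nlinarith [hx.1, hx.2]⟩]
  exact (E.mem_leftSide hx.2).not

theorem horiz_apply (x : ℝ) : E.gluing.horiz x = E.F (twist E.breaks x) := rfl

theorem gluing_vert {x : ℝ} (hx : 0 < x) :
    E.gluing.vert (E.κ * (1 - x)) = 1 - E.κ * twist E.breaks x := E.vert_apply hx

theorem F_not_mem_bot {x : ℝ} (hx : x ∈ Ico (0 : ℝ) 1) (h : x ∉ E.top) : E.F x ∉ E.bot := by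
  rintro ⟨y, hy, he⟩
  exact h (E.bijOn.injOn (E.top_subset_Ico hy) hx he ▸ hy)

end ExchangeData

namespace ExchangeData

variable (E : ExchangeData)

theorem gap_subset {u w : ℝ} (h : IsGap E.breaks u w) : Icc u w ⊆ Icc 0 1 :=
  Icc_subset_Icc (E.isGapSet.subset h.left_mem).1 (E.isGapSet.subset h.right_mem).2

theorem Ico_gap_subset {u w : ℝ} (h : IsGap E.breaks u w) : Ico u w ⊆ Ico 0 1 :=
  Ico_subset_Ico (E.isGapSet.subset h.left_mem).1 (E.isGapSet.subset h.right_mem).2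

theorem mk_F_zero_mem {x : ℝ} (hx : x ∈ Ico (0 : ℝ) 1) (h : x ∉ E.top) :
    Complex.mk (E.F x) 0 ∈ E.gluing.removed :=
  E.mk_zero_mem.2 ⟨Ioo_subset_Icc_self (E.bijOn.mapsTo hx), E.F_not_mem_bot hx h⟩

/-- The lower points that correspond to the removed points of a closed gap are removed. -/
theorem mk_add_zero_mem {u w : ℝ} (h : IsGap E.breaks u w) {x : ℝ} (hx : x ∈ Icc u w \ E.top) :
    Complex.mk (x + (E.F u - u)) 0 ∈ E.gluing.removed := by
  have key : ∀ y ∈ Ico u w, y ∉ E.top → Complex.mk (y + (E.F u - u)) 0 ∈ E.gluing.removed := by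
    intro y hy hyt
    rw [← E.F_eq_of_gap h hy]
    exact E.mk_F_zero_mem (E.Ico_gap_subset h hy) hyt
  rcases hx.1.2.eq_or_lt with h1 | h1
  · subst h1
    have hc : Continuous fun y : ℝ => Complex.mk (y + (E.F u - u)) 0 :=
      continuous_complex_mk (by fun_prop) (by fun_prop)
    have h2 := h.tendsto_highPoint.mono_right nhdsWithin_le_nhds
    exact E.gluing.removed_closed.mem_of_tendsto ((hc.tendsto x).comp h2) (Eventually.of_forall
      fun n => key _ (Ioo_subset_Ico_self (h.highPoint_mem n).1) (h.highPoint_mem n).2)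
  · exact key x ⟨hx.1.1, h1⟩ hx.2

theorem horiz_eq {u w : ℝ} (h : IsGap E.breaks u w) {x r : ℝ} (hm : Moves E.breaks x r)
    (hx : x ∈ Ioo u w) : E.gluing.horiz x = x + r + (E.F u - u) := by
  rw [E.horiz_apply, hm.twist_eq]
  refine E.F_eq_of_gap h ?_
  obtain ⟨u', w', hg, h1, h2⟩ := hm.exists_gap
  obtain ⟨rfl, rfl⟩ := h.unique hg hx h1
  exact Ioo_subset_Ico_self h2

theorem frequently_of_forall_Ioo {P : ℝ → Prop} {l : ℝ} (hl : 0 < l) (h : ∀ s ∈ Ioo 0 l, P s) :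
    ∃ᶠ s in 𝓝 (0 : ℝ), P s := by
  refine Frequently.filter_mono (f := 𝓝[>] 0) (Eventually.frequently ?_) nhdsWithin_le_nhds
  filter_upwards [Ioo_mem_nhdsGT hl] with s hs
  exact h s hs

theorem frequently_of_forall_Ioo_neg {P : ℝ → Prop} {l : ℝ} (hl : 0 < l)
    (h : ∀ s ∈ Ioo (-l) 0, P s) : ∃ᶠ s in 𝓝 (0 : ℝ), P s := by
  refine Frequently.filter_mono (f := 𝓝[<] 0) (Eventually.frequently ?_) nhdsWithin_le_nhds
  filter_upwards [Ioo_mem_nhdsLT (neg_lt_zero.2 hl)] with s hs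
  exact h s hs

variable {E} {Y : Type*} [TopologicalSpace Y] [T2Space Y] {φ : ℂ → Y}

theorem merge_horiz (hφ : ContinuousOn φ E.gluing.removed) (hg : E.gluing.GermInvariant φ) {u w : ℝ}
    (h : IsGap E.breaks u w) {x : ℝ} (hx : x ∈ Icc u w \ E.top) :
    φ (Complex.mk x 1) = φ (Complex.mk u 1) ∧
      φ (Complex.mk (x + (E.F u - u)) 0) = φ (Complex.mk u 1) := by
  set c := E.F u - u with hc
  have c1 : Continuous fun y : ℝ => Complex.mk y 1 :=
    continuous_complex_mk (by fun_prop) (by fun_prop)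
  have c2 : Continuous fun y : ℝ => Complex.mk (y + c) 0 :=
    continuous_complex_mk (by fun_prop) (by fun_prop)
  have mt : ∀ y ∈ Icc u w \ E.top, Complex.mk y 1 ∈ E.gluing.removed := fun y hy =>
    E.mk_one_mem.2 ⟨E.gap_subset h hy.1, hy.2⟩
  have mb : ∀ y ∈ Icc u w \ E.top, Complex.mk (y + c) 0 ∈ E.gluing.removed := fun y hy =>
    E.mk_add_zero_mem h hy
  refine h.merge (α := fun y => φ (Complex.mk y 1)) (β := fun y => φ (Complex.mk (y + c) 0))
    (hφ.comp c1.continuousOn mt) (hφ.comp c2.continuousOn mb) ?_ x hx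
  intro a l r hp h1 h2 h3 h4
  have hI : ∀ y ∈ Ioo u w \ E.top, y ∈ Icc u w \ E.top := fun y hy =>
    ⟨Ioo_subset_Icc_self hy.1, hy.2⟩
  have hglue : ∀ y ∈ Ioo a (a + l), y ∈ Ioo 0 1 ∧ Complex.mk y 1 ∉ E.gluing.removed ∧
      E.gluing.horiz y = y + r + c := by
    intro y hy
    have hm : Moves E.breaks y r := ⟨a, l, hp, hy⟩
    have ht : y ∈ E.top := ⟨r, hm⟩
    exact ⟨E.top_subset ht, fun h' => (E.mk_one_mem.1 h').2 ht,
      E.horiz_eq h hm ⟨h1.1.1.trans hy.1, hy.2.trans h2.1.2⟩⟩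
  constructor
  · refine hg.horiz _ _ (mt a (hI _ h1)) (mb _ (hI _ h3)) (frequently_of_forall_Ioo hp.pos ?_)
    intro s hs
    obtain ⟨q1, q2, q3⟩ := hglue (a + s) ⟨by linarith [hs.1], by linarith [hs.2]⟩
    exact ⟨q1, q2, q3.trans (by ring)⟩
  · refine hg.horiz _ _ (mt _ (hI _ h2)) (mb _ (hI _ h4)) (frequently_of_forall_Ioo_neg hp.pos ?_)
    intro s hs
    obtain ⟨q1, q2, q3⟩ := hglue (a + l + s) ⟨by linarith [hs.1], by linarith [hs.2]⟩
    exact ⟨q1, q2, q3.trans (by ring)⟩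

theorem merge_vert (hφ : ContinuousOn φ E.gluing.removed) (hg : E.gluing.GermInvariant φ) {u w : ℝ}
    (h : IsGap E.breaks u w) {x : ℝ} (hx : x ∈ Icc u w \ E.top) :
    φ (Complex.mk 1 (E.κ * (1 - x))) = φ (Complex.mk 1 (E.κ * (1 - u))) ∧
      φ (Complex.mk 0 (1 - E.κ * x)) = φ (Complex.mk 1 (E.κ * (1 - u))) := by
  have hκ := E.κ_pos
  have hκ' := E.κ_le
  have c1 : Continuous fun y : ℝ => Complex.mk 1 (E.κ * (1 - y)) :=
    continuous_complex_mk (by fun_prop) (by fun_prop)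
  have c2 : Continuous fun y : ℝ => Complex.mk 0 (1 - E.κ * y) :=
    continuous_complex_mk (by fun_prop) (by fun_prop)
  have mt : ∀ y ∈ Icc u w \ E.top, Complex.mk 1 (E.κ * (1 - y)) ∈ E.gluing.removed := fun y hy =>
    (E.one_mk_mem (E.gap_subset h hy.1)).2 hy.2
  have mb : ∀ y ∈ Icc u w \ E.top, Complex.mk 0 (1 - E.κ * y) ∈ E.gluing.removed := fun y hy =>
    (E.zero_mk_mem (E.gap_subset h hy.1)).2 hy.2
  refine h.merge (α := fun y => φ (Complex.mk 1 (E.κ * (1 - y))))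
    (β := fun y => φ (Complex.mk 0 (1 - E.κ * y)))
    (hφ.comp c1.continuousOn mt) (hφ.comp c2.continuousOn mb) ?_ x hx
  intro a l r hp h1 h2 h3 h4
  have hI : ∀ y ∈ Ioo u w \ E.top, y ∈ Icc u w \ E.top := fun y hy =>
    ⟨Ioo_subset_Icc_self hy.1, hy.2⟩
  have hglue : ∀ y ∈ Ioo a (a + l), E.κ * (1 - y) ∈ Ioo 0 1 ∧
      Complex.mk 1 (E.κ * (1 - y)) ∉ E.gluing.removed ∧
      E.gluing.vert (E.κ * (1 - y)) = 1 - E.κ * (y + r) := by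
    intro y hy
    have hm : Moves E.breaks y r := ⟨a, l, hp, hy⟩
    have ht : y ∈ E.top := ⟨r, hm⟩
    obtain ⟨h5, h6⟩ := E.top_subset ht
    refine ⟨⟨by nlinarith, by nlinarith⟩,
      fun h' => (E.one_mk_mem ⟨h5.le, h6.le⟩).1 h' ht, ?_⟩
    rw [E.gluing_vert h5, hm.twist_eq]
  have hκl := mul_pos hκ hp.pos
  constructor
  · refine hg.vert _ _ (mt a (hI _ h1)) (mb _ (hI _ h3)) (frequently_of_forall_Ioo_neg hκl ?_)
    intro s hs
    have e : E.κ * (1 - a) + s = E.κ * (1 - (a - s / E.κ)) := by field_simp; ring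
    have e' : E.κ * (s / E.κ) = s := by field_simp
    have hs1 : s / E.κ < 0 := div_neg_of_neg_of_pos hs.2 hκ
    have hs2 : -l < s / E.κ := by rw [lt_div_iff₀ hκ]; linarith [hs.1]
    rw [e]
    obtain ⟨q1, q2, q3⟩ := hglue (a - s / E.κ) ⟨by linarith, by linarith⟩
    exact ⟨q1, q2, q3.trans (by linear_combination e')⟩
  · refine hg.vert _ _ (mt _ (hI _ h2)) (mb _ (hI _ h4)) (frequently_of_forall_Ioo hκl ?_)
    intro s hs
    have e : E.κ * (1 - (a + l)) + s = E.κ * (1 - (a + l - s / E.κ)) := by field_simp; ring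
    have e' : E.κ * (s / E.κ) = s := by field_simp
    have hs1 : 0 < s / E.κ := div_pos hs.1 hκ
    have hs2 : s / E.κ < l := by rw [div_lt_iff₀ hκ]; linarith [hs.2]
    rw [e]
    obtain ⟨q1, q2, q3⟩ := hglue (a + l - s / E.κ) ⟨by linarith, by linarith⟩
    exact ⟨q1, q2, q3.trans (by linear_combination e')⟩

/-- A removed point of `[0, 1]` lies in a closed gap. -/
theorem exists_gap_of_mem_Icc {x : ℝ} (hx : x ∈ Icc (0 : ℝ) 1) :
    x = 1 ∨ ∃ u w, IsGap E.breaks u w ∧ x ∈ Ico u w := by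
  rcases hx.2.eq_or_lt with h | h
  · exact Or.inl h
  · exact Or.inr (E.isGapSet.exists_gap_Ico ⟨hx.1, h⟩)

theorem breaks_not_mem_top {s : ℝ} (hs : s ∈ E.breaks) : s ∉ E.top := fun h =>
  hs.2 (E.mem_regular_of_mem_top h)

theorem eq_top (hφ : ContinuousOn φ E.gluing.removed) (hg : E.gluing.GermInvariant φ) {x : ℝ}
    (hx : x ∈ Icc (0 : ℝ) 1 \ E.top) : φ (Complex.mk x 1) = φ (Complex.mk 0 1) := by
  have c1 : Continuous fun y : ℝ => Complex.mk y 1 :=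
    continuous_complex_mk (by fun_prop) (by fun_prop)
  have hS : ∀ s ∈ E.breaks, φ (Complex.mk s 1) = φ (Complex.mk 0 1) := fun s hs =>
    E.isGapSet.eq_of_gap (α := fun y => φ (Complex.mk y 1))
      (hφ.comp c1.continuousOn fun y hy =>
        E.mk_one_mem.2 ⟨E.isGapSet.subset hy, breaks_not_mem_top hy⟩)
      (fun u w h => (merge_horiz hφ hg h
        ⟨right_mem_Icc.2 h.lt.le, breaks_not_mem_top h.right_mem⟩).1.symm) hs
  rcases exists_gap_of_mem_Icc (E := E) hx.1 with rfl | ⟨u, w, h, hxu⟩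
  · exact hS 1 E.isGapSet.one_mem
  · rw [(merge_horiz hφ hg h ⟨Ico_subset_Icc_self hxu, hx.2⟩).1, hS u h.left_mem]

theorem eq_bot_of_gap (hφ : ContinuousOn φ E.gluing.removed) (hg : E.gluing.GermInvariant φ) {u w : ℝ}
    (h : IsGap E.breaks u w) {x : ℝ} (hx : x ∈ Icc u w \ E.top) :
    φ (Complex.mk (x + (E.F u - u)) 0) = φ (Complex.mk 0 1) := by
  rw [(merge_horiz hφ hg h hx).2]
  exact eq_top hφ hg ⟨E.isGapSet.subset h.left_mem, breaks_not_mem_top h.left_mem⟩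

theorem eq_bot (hφ : ContinuousOn φ E.gluing.removed) (hg : E.gluing.GermInvariant φ) {x : ℝ}
    (hx : x ∈ Icc (0 : ℝ) 1 \ E.bot) : φ (Complex.mk x 0) = φ (Complex.mk 0 1) := by
  set A : Set ℝ := {y | Complex.mk y 0 ∈ E.gluing.removed ∧
    φ (Complex.mk y 0) = φ (Complex.mk 0 1)} with hA
  have hcl : ∀ y, Complex.mk y 0 ∈ E.gluing.removed → y ∈ closure A → y ∈ A := by
    intro y hy hyA
    refine ⟨hy, ?_⟩
    have hne : (𝓝[A] y).NeBot := mem_closure_iff_nhdsWithin_neBot.1 hyA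
    have hc : Continuous fun y : ℝ => Complex.mk y 0 := Complex.continuous_ofReal
    have h1 : Tendsto (fun y : ℝ => φ (Complex.mk y 0)) (𝓝[A] y) (𝓝 (φ (Complex.mk y 0))) :=
      (hφ _ hy).tendsto.comp (tendsto_nhdsWithin_iff.2 ⟨(hc.tendsto y).mono_left nhdsWithin_le_nhds,
        eventually_nhdsWithin_of_forall fun z hz => hz.1⟩)
    exact tendsto_nhds_unique_of_eventuallyEq h1 tendsto_const_nhds
      (eventually_nhdsWithin_of_forall fun z hz => hz.2)
  have hgapA : ∀ {u w y : ℝ}, IsGap E.breaks u w → y ∈ Icc u w \ E.top → y + (E.F u - u) ∈ A :=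
    fun h hy => ⟨E.mk_add_zero_mem h hy, eq_bot_of_gap hφ hg h hy⟩
  have hnear : ∀ z ∈ Ioo (0 : ℝ) 1, ∃ a ∈ A, ∃ a' ∈ A, z ∈ Ico a a' ∧ 0 < a := by
    intro z hz
    obtain ⟨y, hy, rfl⟩ := E.bijOn.surjOn hz
    obtain ⟨u, w, h, hyu⟩ := E.isGapSet.exists_gap_Ico hy
    have hu := hgapA h ⟨left_mem_Icc.2 h.lt.le, breaks_not_mem_top h.left_mem⟩
    have hw := hgapA h ⟨right_mem_Icc.2 h.lt.le, breaks_not_mem_top h.right_mem⟩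
    refine ⟨_, hu, _, hw, ?_, ?_⟩
    · rw [E.F_eq_of_gap h hyu]
      exact ⟨by linarith [hyu.1], by linarith [hyu.2]⟩
    · rw [add_sub_cancel]
      exact (E.bijOn.mapsTo (E.Ico_gap_subset h ⟨le_rfl, h.lt⟩)).1
  have hxr : Complex.mk x 0 ∈ E.gluing.removed := E.mk_zero_mem.2 hx
  rcases hx.1.1.eq_or_lt with rfl | h0
  · refine (hcl 0 hxr (Metric.mem_closure_iff.2 fun ε hε => ?_)).2
    obtain ⟨a, ha, a', ha', h1, h2⟩ := hnear (min ε 1 / 2)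
      ⟨by positivity, by linarith [min_le_right ε 1]⟩
    refine ⟨a, ha, ?_⟩
    rw [dist_comm, Real.dist_eq, sub_zero, abs_of_pos h2]
    linarith [h1.1, min_le_left ε 1]
  rcases hx.1.2.eq_or_lt with rfl | h1
  · refine (hcl 1 hxr (Metric.mem_closure_iff.2 fun ε hε => ?_)).2
    obtain ⟨a, ha, a', ha', h1, h2⟩ := hnear (1 - min ε 1 / 2)
      ⟨by linarith [min_le_right ε 1], by linarith [lt_min hε one_pos]⟩
    refine ⟨a', ha', ?_⟩
    have h3 : a' ≤ 1 := (E.mk_zero_mem.1 ha'.1).1.2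
    rw [Real.dist_eq, abs_of_nonneg (by linarith)]
    linarith [h1.2, min_le_left ε 1]
  · obtain ⟨y, hy, rfl⟩ := E.bijOn.surjOn ⟨h0, h1⟩
    obtain ⟨u, w, h, hyu⟩ := E.isGapSet.exists_gap_Ico hy
    rw [E.F_eq_of_gap h hyu]
    exact eq_bot_of_gap hφ hg h ⟨Ico_subset_Icc_self hyu, fun h' => hx.2 ⟨y, h', rfl⟩⟩

theorem eq_right (hφ : ContinuousOn φ E.gluing.removed) (hg : E.gluing.GermInvariant φ) {x : ℝ}
    (hx : x ∈ Icc (0 : ℝ) 1 \ E.top) : φ (Complex.mk 1 (E.κ * (1 - x))) = φ (Complex.mk 0 1) ∧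
      φ (Complex.mk 0 (1 - E.κ * x)) = φ (Complex.mk 0 1) := by
  have c1 : Continuous fun y : ℝ => Complex.mk 1 (E.κ * (1 - y)) :=
    continuous_complex_mk (by fun_prop) (by fun_prop)
  have hS : ∀ s ∈ E.breaks, φ (Complex.mk 1 (E.κ * (1 - s))) = φ (Complex.mk 1 (E.κ * (1 - 0))) :=
    fun s hs => E.isGapSet.eq_of_gap (α := fun y => φ (Complex.mk 1 (E.κ * (1 - y))))
      (hφ.comp c1.continuousOn fun y hy =>
        (E.one_mk_mem (E.isGapSet.subset hy)).2 (breaks_not_mem_top hy))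
      (fun u w h => (merge_vert hφ hg h
        ⟨right_mem_Icc.2 h.lt.le, breaks_not_mem_top h.right_mem⟩).1.symm) hs
  have h1 : φ (Complex.mk 1 (E.κ * (1 - 0))) = φ (Complex.mk 0 1) := by
    rw [← hS 1 E.isGapSet.one_mem, sub_self, mul_zero]
    exact eq_bot hφ hg ⟨by simp, fun h => lt_irrefl _ (E.sides.bot_subset h).2⟩
  rcases exists_gap_of_mem_Icc (E := E) hx.1 with rfl | ⟨u, w, h, hxu⟩
  · refine ⟨by rw [hS 1 E.isGapSet.one_mem, h1], ?_⟩
    have h2 : ∀ s ∈ E.breaks, φ (Complex.mk 0 (1 - E.κ * s)) = φ (Complex.mk 0 (1 - E.κ * 0)) :=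
      fun s hs => E.isGapSet.eq_of_gap (α := fun y => φ (Complex.mk 0 (1 - E.κ * y)))
        (hφ.comp (continuous_complex_mk (by fun_prop) (by fun_prop)).continuousOn fun y hy =>
          (E.zero_mk_mem (E.isGapSet.subset hy)).2 (breaks_not_mem_top hy))
        (fun u w h => by
          rw [(merge_vert hφ hg h ⟨right_mem_Icc.2 h.lt.le, breaks_not_mem_top h.right_mem⟩).2,
            (merge_vert hφ hg h ⟨left_mem_Icc.2 h.lt.le, breaks_not_mem_top h.left_mem⟩).2]) hs
    rw [h2 1 E.isGapSet.one_mem, mul_zero, sub_zero]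
  · obtain ⟨h3, h4⟩ := merge_vert hφ hg h ⟨Ico_subset_Icc_self hxu, hx.2⟩
    rw [h3, h4, hS u h.left_mem, h1]
    exact ⟨rfl, rfl⟩

theorem isMerging (E : ExchangeData) : E.gluing.IsMerging := by
  intro Y _ _ φ hφ hg
  have hκ := E.κ_pos
  have hκ' := E.κ_le
  have key : ∀ r ∈ E.gluing.removed, φ r = φ (Complex.mk 0 1) := by
    intro r hr
    rcases E.sides.removed_cases hr with ⟨x, hx, rfl⟩ | ⟨x, hx, rfl⟩ | ⟨y, ⟨hy, hy'⟩, rfl⟩ |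
      ⟨y, ⟨hy, hy'⟩, rfl⟩
    · exact eq_top hφ hg hx
    · exact eq_bot hφ hg hx
    · rcases le_or_gt y E.κ with h | h
      · have h1 : 1 - y / E.κ ∈ Icc (0 : ℝ) 1 :=
          ⟨sub_nonneg.2 ((div_le_one hκ).2 h), sub_le_self _ (div_nonneg hy.1 hκ.le)⟩
        have e : y = E.κ * (1 - (1 - y / E.κ)) := by field_simp; ring
        have h2 : 1 - y / E.κ ∉ E.top := fun h' => hy' (Or.inl h')
        rw [e]
        exact (eq_right hφ hg ⟨h1, h2⟩).1
      · rcases hy.2.eq_or_lt with rfl | h1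
        · exact eq_top hφ hg ⟨by simp, fun h => lt_irrefl _ (E.top_subset h).2⟩
        · exact (hy' (Or.inr ⟨h, h1⟩)).elim
    · rcases le_or_gt (1 - E.κ) y with h | h
      · have h1 : (1 - y) / E.κ ∈ Icc (0 : ℝ) 1 :=
          ⟨div_nonneg (by linarith [hy.2]) hκ.le, (div_le_one hκ).2 (by linarith)⟩
        have e : y = 1 - E.κ * ((1 - y) / E.κ) := by field_simp; ring
        have h2 : (1 - y) / E.κ ∉ E.top := fun h' => hy' (Or.inl h')
        rw [e]
        exact (eq_right hφ hg ⟨h1, h2⟩).2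
      · rcases hy.1.eq_or_lt with rfl | h1
        · exact eq_bot hφ hg ⟨by simp, fun h => lt_irrefl _ (E.sides.bot_subset h).1⟩
        · exact (hy' (Or.inr ⟨h1, h⟩)).elim
  intro r hr r' hr'
  rw [key r hr, key r' hr']

theorem hasHandles (E : ExchangeData) : E.gluing.HasHandles := by
  intro η hη
  obtain ⟨w, h⟩ := E.isGapSet.exists_gap_right E.isGapSet.zero_mem one_pos
  have hw := h.lt
  have hw1 : w ≤ 1 := (E.isGapSet.subset h.right_mem).2
  have hlim := (tendsto_dyad.comp (tendsto_add_atTop_nat 2)).eventually (gt_mem_nhds hη)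
  obtain ⟨n, hn⟩ := hlim.exists
  simp only [Function.comp_apply] at hn
  set c := E.F 0 - 0 with hc
  set l := (w - 0) * dyad (n + 2) with hl
  have e1 : (w - 0) * dyad (n + 1) = 2 * l := by rw [hl, dyad_succ (n + 1)]; ring
  have e0 : (w - 0) * dyad n = 4 * l := by rw [hl, dyad_succ (n + 1), dyad_succ n]; ring
  have e3 : (w - 0) * dyad (n + 3) = l / 2 := by rw [hl, dyad_succ (n + 2)]; ring
  obtain ⟨q1, q2⟩ := h.piece_le n
  rw [e0] at q1 q2
  have hl0 : 0 < l := by linarith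
  have p2 : IsPiece E.breaks l l (w - 3 * l) :=
    ⟨0, w, n + 2, h, rfl, Or.inl ⟨by ring, by ring⟩⟩
  have p1 : IsPiece E.breaks (2 * l) (2 * l) (w - 6 * l) :=
    ⟨0, w, n + 1, h, e1.symm, Or.inl ⟨by ring, by ring⟩⟩
  have p0 : IsPiece E.breaks (4 * l) (4 * l) (w - 12 * l) :=
    ⟨0, w, n, h, e0.symm, Or.inl ⟨by ring, by ring⟩⟩
  have hp : ∀ {a k r : ℝ}, IsPiece E.breaks a k r → 0 ≤ a → a + k ≤ w → ∀ x ∈ Ioo a (a + k),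
      Complex.mk x 1 ∉ E.gluing.removed ∧ E.gluing.horiz x = x + r + c := by
    intro a k r hp h0 h1 x hx
    have hm : Moves E.breaks x r := ⟨a, k, hp, hx⟩
    exact ⟨fun h' => (E.mk_one_mem.1 h').2 ⟨r, hm⟩,
      E.horiz_eq h hm ⟨h0.trans_lt hx.1, hx.2.trans_le h1⟩⟩
  have hhigh : ∀ m y, y = highPoint 0 w m + c → Complex.mk y 0 ∈ E.gluing.removed := by
    rintro m y rfl
    exact E.mk_add_zero_mem h ⟨Ioo_subset_Icc_self (h.highPoint_mem m).1, (h.highPoint_mem m).2⟩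
  have r0 := hhigh n (c + w - 8 * l) (by rw [highPoint]; linear_combination 2 * e0)
  have r1 := hhigh (n + 1) (c + w - 8 * l + 4 * l) (by rw [highPoint]; linear_combination 2 * e1)
  have r2 := hhigh (n + 2) (c + w - 8 * l + 6 * l) (by rw [highPoint]; linear_combination -2 * hl)
  have r3 := hhigh (n + 3) (c + w - 8 * l + 7 * l) (by rw [highPoint]; linear_combination 2 * e3)
  refine ⟨l, c + w - 8 * l, l, ?_, hl0, hl0.le, by linarith, (E.mk_zero_mem.1 r0).1.1,
    (E.mk_zero_mem.1 r3).1.2, ?_, r0, r1, r2, ?_, ?_, ?_⟩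
  · refine lt_of_le_of_lt ?_ hn
    rw [hl, sub_zero]
    exact mul_le_of_le_one_left (dyad_pos _).le hw1
  · have : l = lowPoint 0 w (n + 3) := by rw [lowPoint]; linear_combination (-2) * e3
    rw [this]
    exact E.mk_one_mem.2 ⟨E.gap_subset h (Ioo_subset_Icc_self (h.lowPoint_mem _).1),
      (h.lowPoint_mem _).2⟩
  · intro x hx
    obtain ⟨a1, a2⟩ := hp p2 hl0.le (by linarith) x hx
    exact ⟨a1, a2.trans (by ring)⟩
  · intro x hx
    obtain ⟨a1, a2⟩ := hp p1 (by linarith) (by linarith) x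
      ⟨by linarith [hx.1], by linarith [hx.2]⟩
    exact ⟨a1, a2.trans (by ring)⟩
  · intro x hx
    obtain ⟨a1, a2⟩ := hp p0 (by linarith) (by linarith) x
      ⟨by linarith [hx.1], by linarith [hx.2]⟩
    exact ⟨a1, a2.trans (by ring)⟩

end ExchangeData

/-! ### The flow -/

namespace SquareGluing

variable {G : SquareGluing} {v : ℂ}

/-- The curve `c` moves with velocity `v` near the time `t`. -/
def FlowAt (v : ℂ) (c : ℝ → G.Surface) (t : ℝ) : Prop :=
  ∃ e ∈ atlas ℂ G.Surface, c t ∈ e.source ∧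
    ∀ᶠ s in 𝓝 t, c s ∈ e.source ∧ e (c s) = e (c t) + ((s - t : ℝ) : ℂ) * v

theorem FlowAt.continuousAt {c : ℝ → G.Surface} {t : ℝ} (h : FlowAt v c t) : ContinuousAt c t := by
  obtain ⟨e, he, ht, h⟩ := h
  have h1 : Tendsto (fun s : ℝ => e.symm (e (c t) + ((s - t : ℝ) : ℂ) * v)) (𝓝 t) (𝓝 (c t)) := by
    have h2 : Tendsto (fun s : ℝ => e (c t) + ((s - t : ℝ) : ℂ) * v) (𝓝 t) (𝓝 (e (c t))) := by
      have : Continuous fun s : ℝ => e (c t) + ((s - t : ℝ) : ℂ) * v := by fun_prop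
      simpa using this.tendsto t
    have h3 := e.continuousAt_symm (e.map_source ht)
    rw [ContinuousAt, e.left_inv ht] at h3
    exact h3.comp h2
  refine h1.congr' ?_
  filter_upwards [h] with s hs
  rw [← hs.2, e.left_inv hs.1]

theorem FlowAt.eventually_chart {c : ℝ → G.Surface} {t : ℝ} (h : FlowAt v c t)
    {e : OpenPartialHomeomorph G.Surface ℂ} (he : e ∈ atlas ℂ G.Surface) (ht : c t ∈ e.source) :
    ∀ᶠ s in 𝓝 t, c s ∈ e.source ∧ e (c s) = e (c t) + ((s - t : ℝ) : ℂ) * v := by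
  have hc := h.continuousAt
  obtain ⟨e', he', ht', h'⟩ := h
  filter_upwards [h', hc.eventually (chart_sub_chart he' he ht' ht),
    hc.eventually (e.open_source.mem_nhds ht)] with s h1 h2 h3
  refine ⟨h3, ?_⟩
  linear_combination h2 + h1.2

theorem FlowAt.eventually_eq {c c' : ℝ → G.Surface} {t : ℝ} (h : FlowAt v c t) (h' : FlowAt v c' t)
    (ht : c t = c' t) : ∀ᶠ s in 𝓝 t, c s = c' s := by
  have hs := mem_chart_source ℂ (c t)
  filter_upwards [h.eventually_chart (chart_mem_atlas ℂ (c t)) hs,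
    h'.eventually_chart (chart_mem_atlas ℂ (c t)) (ht ▸ hs)] with s h1 h2
  exact (chartAt ℂ (c t)).injOn h1.1 h2.1 (by rw [h1.2, h2.2, ht])

theorem FlowAt.congr {c c' : ℝ → G.Surface} {t : ℝ} (h : FlowAt v c t)
    (hcc' : ∀ᶠ s in 𝓝 t, c' s = c s) : FlowAt v c' t := by
  obtain ⟨e, he, ht, h⟩ := h
  have h0 := hcc'.self_of_nhds
  refine ⟨e, he, by rwa [h0], ?_⟩
  filter_upwards [h, hcc'] with s h1 h2
  rwa [h2, h0]

theorem FlowAt.eventually {c : ℝ → G.Surface} {t : ℝ} (h : FlowAt v c t) :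
    ∀ᶠ s in 𝓝 t, FlowAt v c s := by
  obtain ⟨e, he, ht, h⟩ := h
  filter_upwards [h.eventually_nhds] with s hs
  refine ⟨e, he, hs.self_of_nhds.1, hs.mono fun r hr => ⟨hr.1, ?_⟩⟩
  rw [hr.2, hs.self_of_nhds.2]
  push_cast; ring

theorem FlowAt.shift {c : ℝ → G.Surface} {t a : ℝ} (h : FlowAt v c (t + a)) :
    FlowAt v (fun s => c (s + a)) t := by
  obtain ⟨e, he, ht, h⟩ := h
  refine ⟨e, he, ht, ?_⟩
  have hc : Tendsto (fun s => s + a) (𝓝 t) (𝓝 (t + a)) := (continuous_add_const a).tendsto t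
  filter_upwards [hc.eventually h] with s hs
  refine ⟨hs.1, hs.2.trans ?_⟩
  congr 3
  ring

theorem eqOn_of_flowAt {c c' : ℝ → G.Surface} {T : Set ℝ} (hT : IsPreconnected T)
    (h : ∀ s ∈ T, FlowAt v c s) (h' : ∀ s ∈ T, FlowAt v c' s) {a b : ℝ} (ha : a ∈ T) (hb : b ∈ T)
    (hab : c a = c' a) : c b = c' b := by
  have hcl : IsClopen {s : T | c s = c' s} := by
    constructor
    · exact isClosed_eq
        (continuous_iff_continuousAt.2 fun s =>
          (h s s.2).continuousAt.comp continuous_subtype_val.continuousAt)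
        (continuous_iff_continuousAt.2 fun s =>
          (h' s s.2).continuousAt.comp continuous_subtype_val.continuousAt)
    · refine isOpen_iff_mem_nhds.2 fun s hs => ?_
      exact continuous_subtype_val.continuousAt.eventually ((h s s.2).eventually_eq (h' s s.2) hs)
  have : PreconnectedSpace T := Subtype.preconnectedSpace hT
  have := hcl.eq_univ ⟨⟨a, ha⟩, hab⟩
  exact (this ▸ mem_univ (⟨b, hb⟩ : T) : (⟨b, hb⟩ : T) ∈ {s : T | c s = c' s})

/-- The flow of velocity `v` moves `x` to `y` in the time `t`. -/
def Reaches (v : ℂ) (x : G.Surface) (t : ℝ) (y : G.Surface) : Prop :=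
  ∃ c : ℝ → G.Surface, (∀ s ∈ uIcc 0 t, FlowAt v c s) ∧ c 0 = x ∧ c t = y

theorem Reaches.unique {x y y' : G.Surface} {t : ℝ} (h : Reaches v x t y) (h' : Reaches v x t y') :
    y = y' := by
  obtain ⟨c, hc, h0, rfl⟩ := h
  obtain ⟨c', hc', h0', rfl⟩ := h'
  exact eqOn_of_flowAt isPreconnected_uIcc hc hc' left_mem_uIcc right_mem_uIcc (h0.trans h0'.symm)

theorem Reaches.symm {x y : G.Surface} {t : ℝ} (h : Reaches v x t y) : Reaches v y (-t) x := by
  obtain ⟨c, hc, h0, h1⟩ := h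
  refine ⟨fun s => c (s + t), fun s hs => (hc _ ?_).shift, by simpa using h1, by simpa using h0⟩
  have : s + t ∈ (fun r => r + t) '' uIcc 0 (-t) := ⟨s, hs, rfl⟩
  rw [image_add_const_uIcc] at this
  simpa [uIcc_comm] using this

theorem Reaches.trans {x y z : G.Surface} {s t : ℝ} (hs : 0 ≤ s) (ht : 0 ≤ t)
    (h : Reaches v x s y) (h' : Reaches v y t z) : Reaches v x (s + t) z := by
  obtain ⟨c, hc, h0, h1⟩ := h
  obtain ⟨c', hc', h0', h1'⟩ := h'
  rw [uIcc_of_le hs] at hc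
  rw [uIcc_of_le ht] at hc'
  have hsh : ∀ r ∈ Icc s (s + t), FlowAt v (fun r => c' (r + -s)) r := fun r hr =>
    (hc' _ ⟨by linarith [hr.1], by linarith [hr.2]⟩).shift
  have heq : ∀ᶠ r in 𝓝 s, c r = c' (r + -s) :=
    (hc s ⟨hs, le_rfl⟩).eventually_eq (hsh s ⟨le_rfl, by linarith⟩) (by
      rw [h1, add_neg_cancel, h0'])
  refine ⟨fun r => if r ≤ s then c r else c' (r + -s), fun r hr => ?_, ?_, ?_⟩
  · rw [uIcc_of_le (by linarith)] at hr
    rcases lt_trichotomy r s with h | rfl | h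
    · refine (hc r ⟨hr.1, h.le⟩).congr ?_
      filter_upwards [Iio_mem_nhds h] with r' hr'
      exact if_pos (le_of_lt hr')
    · refine (hc r ⟨hr.1, le_rfl⟩).congr ?_
      filter_upwards [heq] with r' hr'
      rw [← hr', ite_self]
    · refine (hsh r ⟨h.le, hr.2⟩).congr ?_
      filter_upwards [Ioi_mem_nhds h] with r' hr'
      exact if_neg (not_le.2 hr')
  · simp only [if_pos hs, h0]
  · rcases ht.eq_or_lt with rfl | ht
    · simp only [add_zero, le_refl, if_true, h1]
      rw [← h0', h1']
    · refine (if_neg (by linarith)).trans ?_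
      rw [← h1']
      congr 1
      ring

theorem Reaches.exists_of_mem {x y : G.Surface} {s t : ℝ} (h : Reaches v x t y)
    (hs : s ∈ uIcc 0 t) : ∃ z, Reaches v x s z := by
  obtain ⟨c, hc, h0, -⟩ := h
  exact ⟨c s, c, fun r hr => hc r (uIcc_subset_uIcc left_mem_uIcc hs hr), h0, rfl⟩

theorem _root_.IsFlowLine.reaches {c : ℝ → G.Surface} (h : IsFlowLine v c) (s t : ℝ) :
    Reaches v (c s) t (c (s + t)) :=
  ⟨fun r => c (r + s), fun r _ => FlowAt.shift (h (r + s)), by simp, by simp [add_comm]⟩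

theorem _root_.IsFlowLine.shift {c : ℝ → G.Surface} (h : IsFlowLine v c) (a : ℝ) :
    IsFlowLine v fun s => c (s + a) := fun t => FlowAt.shift (h (t + a))

theorem mem_flowDomain_of_reaches {x : G.Surface} (h : ∀ t, ∃ y, Reaches v x t y) :
    x ∈ flowDomain G.Surface v := by
  choose c hc using h
  refine ⟨c, fun t => ?_, ?_⟩
  · obtain ⟨γ, hγ, h0, h1⟩ := hc t
    have ht := hγ t right_mem_uIcc
    refine FlowAt.congr ht ?_
    obtain ⟨ε, hε, hball⟩ := Metric.eventually_nhds_iff_ball.1 ht.eventually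
    filter_upwards [Metric.ball_mem_nhds t hε] with s hs
    refine (hc s).unique ⟨γ, fun r hr => ?_, h0, rfl⟩
    rcases uIcc_subset_uIcc_union_uIcc (b := t) hr with h2 | h2
    · exact hγ r h2
    · refine hball r ?_
      rw [Real.ball_eq_Ioo, mem_Ioo] at hs ⊢
      rw [mem_uIcc] at h2
      rcases h2 with h2 | h2 <;> constructor <;> linarith
  · obtain ⟨γ, -, h0, h1⟩ := hc 0
    exact h1.symm.trans h0

end SquareGluing

namespace SquareGluing

variable {G : SquareGluing} {v : ℂ}

/-- A segment of direction `v` in the punctured square is a part of a flow line. -/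
theorem reaches_segment {z w : G.Points} {a : ℝ} (ha : 0 < a)
    (hm : ∀ r ∈ Icc 0 a, z.1 + r * v ∈ unitSquare \ G.removed) (hw : w.1 = z.1 + a * v) :
    Reaches v (G.proj z) a (G.proj w) := by
  set e₀ := chartAt ℂ (G.proj z) with he₀
  set e₁ := chartAt ℂ (G.proj w) with he₁
  have hs₀ : G.proj z ∈ e₀.source := mem_chart_source ℂ _
  have hs₁ : G.proj w ∈ e₁.source := mem_chart_source ℂ _
  set γ : ℝ → G.Surface := fun r => G.projC (z.1 + r * v) with hγ
  have hγ0 : γ 0 = G.proj z := by simp [hγ, projC_coe]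
  have hγa : γ a = G.proj w := by simp [hγ, ← hw, projC_coe]
  -- inside the square, the curve moves with velocity `v`
  have hmid : ∀ r ∈ Icc 0 a, ∀ e ∈ atlas ℂ G.Surface, γ r ∈ e.source →
      ∀ᶠ s in 𝓝[Icc 0 a] r, γ s ∈ e.source ∧ e (γ s) = e (γ r) + ((s - r : ℝ) : ℂ) * v := by
    intro r hr e he hre
    have hc : ContinuousWithinAt γ (Icc 0 a) r := by
      have h1 : Continuous fun r : ℝ => z.1 + r * v := by fun_prop
      exact (continuousOn_projC.comp h1.continuousOn hm) r hr
    have hre' : G.proj ⟨_, hm r hr⟩ ∈ e.source := by rwa [← projC_of_mem]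
    have h2 := G.isInherited e he ⟨_, hm r hr⟩ hre'
    rw [nhds_subtype_eq_comap, eventually_comap] at h2
    have h3 : Tendsto (fun s : ℝ => z.1 + s * v) (𝓝[Icc 0 a] r) (𝓝 (z.1 + r * v)) := by
      have h1 : Continuous fun r : ℝ => z.1 + r * v := by fun_prop
      exact (h1.tendsto r).mono_left nhdsWithin_le_nhds
    filter_upwards [h3.eventually h2, hc.eventually (e.open_source.mem_nhds hre),
      self_mem_nhdsWithin] with s h4 h5 h6
    refine ⟨h5, ?_⟩
    have h7 := h4 ⟨_, hm s h6⟩ rfl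
    simp only [hγ]
    rw [projC_of_mem (hm s h6), projC_of_mem (hm r hr)]
    push_cast
    linear_combination h7
  have hend : ∀ (e : OpenPartialHomeomorph G.Surface ℂ) (m : G.Surface) (b : ℝ), m ∈ e.source →
      ∀ᶠ s : ℝ in 𝓝 b, e.symm (e m + ((s - b : ℝ) : ℂ) * v) ∈ e.source ∧
        e (e.symm (e m + ((s - b : ℝ) : ℂ) * v)) = e m + ((s - b : ℝ) : ℂ) * v := by
    intro e m b hme
    have h1 : Tendsto (fun s : ℝ => e m + ((s - b : ℝ) : ℂ) * v) (𝓝 b) (𝓝 (e m)) := by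
      have : Continuous fun s : ℝ => e m + ((s - b : ℝ) : ℂ) * v := by fun_prop
      simpa using this.tendsto b
    filter_upwards [h1.eventually (e.open_target.mem_nhds (e.map_source hme))] with s hs
    exact ⟨e.map_target hs, e.right_inv hs⟩
  set c : ℝ → G.Surface := fun s =>
    if s < 0 then e₀.symm (e₀ (G.proj z) + ((s - 0 : ℝ) : ℂ) * v)
    else if s ≤ a then γ s else e₁.symm (e₁ (G.proj w) + ((s - a : ℝ) : ℂ) * v) with hc
  have hcm : ∀ s ∈ Icc 0 a, c s = γ s := fun s hs => by
    simp only [hc, if_neg (not_lt.2 hs.1), if_pos hs.2]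
  have c0 : c 0 = G.proj z := by rw [hcm 0 ⟨le_rfl, ha.le⟩, hγ0]
  have ca : c a = G.proj w := by rw [hcm a ⟨ha.le, le_rfl⟩, hγa]
  refine ⟨c, fun r hr => ?_, c0, ca⟩
  rw [uIcc_of_le ha.le] at hr
  rcases hr.1.eq_or_lt with rfl | h0
  · refine ⟨e₀, chart_mem_atlas ℂ _, by rwa [c0], ?_⟩
    have h1 := hmid 0 hr e₀ (chart_mem_atlas ℂ _) (by rwa [hγ0])
    rw [eventually_nhdsWithin_iff] at h1
    filter_upwards [h1, hend e₀ _ 0 hs₀, Iio_mem_nhds ha] with s h2 h3 h4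
    rcases lt_or_ge s 0 with h5 | h5
    · have : c s = e₀.symm (e₀ (G.proj z) + ((s - 0 : ℝ) : ℂ) * v) := if_pos h5
      rwa [this, c0]
    · rw [hcm s ⟨h5, h4.le⟩, c0, ← hγ0]
      exact h2 ⟨h5, h4.le⟩
  rcases hr.2.eq_or_lt with rfl | h1
  · refine ⟨e₁, chart_mem_atlas ℂ _, by rwa [ca], ?_⟩
    have h1 := hmid r hr e₁ (chart_mem_atlas ℂ _) (by rwa [hγa])
    rw [eventually_nhdsWithin_iff] at h1
    filter_upwards [h1, hend e₁ _ r hs₁, Ioi_mem_nhds ha] with s h2 h3 h4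
    rcases le_or_gt s r with h5 | h5
    · rw [hcm s ⟨h4.le, h5⟩, ca, ← hγa]
      exact h2 ⟨h4.le, h5⟩
    · have : c s = e₁.symm (e₁ (G.proj w) + ((s - r : ℝ) : ℂ) * v) := by
        simp only [hc, if_neg (not_lt.2 (h0.trans h5).le), if_neg (not_le.2 h5)]
      rwa [this, ca]
  · have hs := mem_chart_source ℂ (γ r)
    refine ⟨chartAt ℂ (γ r), chart_mem_atlas ℂ _, by rwa [hcm r hr], ?_⟩
    have h2 := hmid r hr _ (chart_mem_atlas ℂ _) hs
    rw [nhdsWithin_eq_nhds.2 (Icc_mem_nhds h0 h1)] at h2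
    filter_upwards [h2, Icc_mem_nhds h0 h1] with s h3 h4
    rwa [hcm s h4, hcm r hr]

theorem flowLine_eq_of_segment {c : ℝ → G.Surface} (hc : IsFlowLine v c) {b : ℝ} {z : G.Points}
    (hz : c b = G.proj z) {a : ℝ} (ha : 0 ≤ a)
    (hm : ∀ r ∈ Icc 0 a, z.1 + r * v ∈ unitSquare \ G.removed) :
    c (b + a) = G.projC (z.1 + a * v) := by
  have hw := hm a ⟨ha, le_rfl⟩
  rw [projC_of_mem hw]
  rcases ha.eq_or_lt with rfl | ha
  · simp [hz]
  · have h1 := hc.reaches b a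
    rw [hz] at h1
    exact h1.unique (reaches_segment ha hm rfl)

/-- A flow line which is defined for all times does not run into a removed point. -/
theorem not_mem_removed_of_flowLine {c : ℝ → G.Surface} (hc : IsFlowLine v c) {b : ℝ} {z : G.Points}
    (hz : c b = G.proj z) {a : ℝ} (ha : 0 < a)
    (hm : ∀ r ∈ Ico 0 a, z.1 + r * v ∈ unitSquare \ G.removed) : z.1 + a * v ∉ G.removed := by
  have hcc : Continuous c := continuous_iff_continuousAt.2 fun t => FlowAt.continuousAt (hc t)
  have hK := isCompact_preimage_proj ((isCompact_Icc (a := b) (b := b + a)).image hcc)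
  have hmem : ∀ r ∈ Ico 0 a, z.1 + r * v ∈
      Subtype.val '' (G.proj ⁻¹' (c '' Icc b (b + a))) := by
    intro r hr
    refine ⟨⟨_, hm r hr⟩, ⟨b + r, ⟨by linarith [hr.1], by linarith [hr.2]⟩, ?_⟩, rfl⟩
    rw [flowLine_eq_of_segment hc hz hr.1 fun s hs => hm s ⟨hs.1, hs.2.trans_lt hr.2⟩,
      projC_of_mem (hm r hr)]
  have hlim : Tendsto (fun r : ℝ => z.1 + r * v) (𝓝[<] a) (𝓝 (z.1 + a * v)) := by
    have : Continuous fun r : ℝ => z.1 + r * v := by fun_prop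
    exact (this.tendsto a).mono_left nhdsWithin_le_nhds
  have hin := hK.isClosed.mem_of_tendsto hlim (by
    filter_upwards [Ioo_mem_nhdsLT ha] with r hr
    exact hmem r ⟨hr.1.le, hr.2⟩)
  obtain ⟨w, -, hw⟩ := hin
  rw [← hw]
  exact w.2.2

end SquareGluing

/-! ### The flow on the gluing of an exchange -/

namespace ExchangeData

variable {E : ExchangeData} {v : ℂ}

/-- The time in which the flow returns to the lower side. -/
def returnTime (E : ExchangeData) (v : ℂ) (x : ℝ) : ℝ := (1 - x) / v.re + twist E.breaks x / v.re

/-- The point of the surface given by a point of the lower side. -/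
def lower (E : ExchangeData) (x : ℝ) : E.gluing.Surface := E.gluing.projC (Complex.mk x 0)

theorem mem_bot_iff {x : ℝ} : x ∈ E.bot ↔ x ∈ Ioo (0 : ℝ) 1 ∧ Complex.mk x 0 ∉ E.gluing.removed := by
  rw [E.mk_zero_mem]
  exact ⟨fun h => ⟨E.sides.bot_subset h, fun h' => h'.2 h⟩,
    fun h => by_contra fun h' => h.2 ⟨Ioo_subset_Icc_self h.1, h'⟩⟩

theorem lower_mem {x : ℝ} (hx : x ∈ E.bot) : Complex.mk x 0 ∈ unitSquare \ E.gluing.removed := by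
  obtain ⟨h1, h2⟩ := mem_bot_iff.1 hx
  exact ⟨⟨Ioo_subset_Icc_self h1, by simp⟩, h2⟩

theorem lower_injOn : InjOn E.lower E.bot := by
  intro x hx y hy h
  rw [lower, lower, SquareGluing.projC_of_mem (lower_mem hx),
    SquareGluing.projC_of_mem (lower_mem hy), SquareGluing.proj_eq_iff] at h
  have hx' := (mem_bot_iff.1 hx).1
  have hy' := (mem_bot_iff.1 hy).1
  rcases h with h | (⟨h, -⟩ | ⟨h, -⟩) | (⟨h, -⟩ | ⟨h, -⟩)
  · exact congrArg (fun z : E.gluing.Points => z.1.re) h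
  · simp at h
  · exact absurd h hx'.2.ne
  · simp at h
  · exact absurd h hy'.2.ne

variable (hv : 0 < v.re) (hκ : v.im = E.κ * v.re)

include hv hκ

theorem first_leg_interior {x r : ℝ} (hx : x ∈ Ioo (0 : ℝ) 1) (hr : r ∈ Ioo 0 ((1 - x) / v.re)) :
    Complex.mk x 0 + r * v ∈ interior unitSquare := by
  have h1 := E.κ_pos
  have h2 := E.κ_le
  have h3 := mul_pos hr.1 hv
  have h4 := (lt_div_iff₀ hv).1 hr.2
  refine mem_interior_unitSquare.2 ⟨⟨?_, ?_⟩, ?_, ?_⟩ <;> simp [hκ] <;> nlinarith [hx.1, hx.2]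

theorem first_leg_end {x : ℝ} :
    Complex.mk x 0 + (((1 - x) / v.re : ℝ) : ℂ) * v = Complex.mk 1 (E.κ * (1 - x)) := by
  apply Complex.ext
  · simp [-Complex.ofReal_div]
    field_simp; ring
  · simp [-Complex.ofReal_div, hκ]
    field_simp

theorem second_leg_interior {y r : ℝ} (hy : y ∈ Ioo (0 : ℝ) 1) (hr : r ∈ Ioo 0 (y / v.re)) :
    Complex.mk 0 (1 - E.κ * y) + r * v ∈ interior unitSquare := by
  have h1 := E.κ_pos
  have h2 := E.κ_le
  have h3 := mul_pos hr.1 hv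
  have h4 := (lt_div_iff₀ hv).1 hr.2
  refine mem_interior_unitSquare.2 ⟨⟨?_, ?_⟩, ?_, ?_⟩ <;> simp [hκ] <;> nlinarith [hy.1, hy.2]

theorem second_leg_end {y : ℝ} :
    Complex.mk 0 (1 - E.κ * y) + ((y / v.re : ℝ) : ℂ) * v = Complex.mk y 1 := by
  apply Complex.ext
  · simp [-Complex.ofReal_div]
    field_simp
  · simp [-Complex.ofReal_div, hκ]
    field_simp; ring

omit hv hκ in
theorem vert_glue {x : ℝ} (hx : x ∈ E.top) :
    Complex.mk 1 (E.κ * (1 - x)) ∈ unitSquare \ E.gluing.removed ∧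
      Complex.mk 0 (1 - E.κ * twist E.breaks x) ∈ unitSquare \ E.gluing.removed ∧
      E.gluing.projC (Complex.mk 1 (E.κ * (1 - x))) =
        E.gluing.projC (Complex.mk 0 (1 - E.κ * twist E.breaks x)) := by
  have h1 := E.top_subset hx
  have h2 := E.κ_pos
  have h3 := E.κ_le
  have := SquareGluing.projC_vert (G := E.gluing) (y := E.κ * (1 - x))
    ⟨by nlinarith [h1.2], by nlinarith [h1.1]⟩
    (fun h => (E.one_mk_mem (Ioo_subset_Icc_self h1)).1 h hx)
  rwa [E.gluing_vert h1.1] at this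

omit hv hκ in
theorem horiz_glue {x : ℝ} (hx : x ∈ E.top) :
    Complex.mk (twist E.breaks x) 1 ∈ unitSquare \ E.gluing.removed ∧
      E.gluing.projC (Complex.mk (twist E.breaks x) 1) = E.lower (E.F x) := by
  have h1 := twist_mem hx
  obtain ⟨h2, h3, h4⟩ := SquareGluing.projC_horiz (G := E.gluing) (E.top_subset h1)
    (fun h => (E.mk_one_mem.1 h).2 h1)
  rw [E.horiz_apply, twist_twist hx] at h4
  exact ⟨h2, h4⟩

theorem first_leg_mem {x : ℝ} (hb : x ∈ E.bot) :
    ∀ r ∈ Ico 0 ((1 - x) / v.re), Complex.mk x 0 + r * v ∈ unitSquare \ E.gluing.removed := by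
  intro r hr
  rcases hr.1.eq_or_lt with rfl | h
  · simpa using lower_mem hb
  · exact E.gluing.interior_subset_diff
      (first_leg_interior hv hκ (mem_bot_iff.1 hb).1 ⟨h, hr.2⟩)

theorem first_leg_mem' {x : ℝ} (hb : x ∈ E.bot) (ht : x ∈ E.top) :
    ∀ r ∈ Icc 0 ((1 - x) / v.re), Complex.mk x 0 + r * v ∈ unitSquare \ E.gluing.removed := by
  intro r hr
  rcases hr.2.eq_or_lt with rfl | h
  · rw [first_leg_end hv hκ]
    exact (vert_glue ht).1
  · exact first_leg_mem hv hκ hb r ⟨hr.1, h⟩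

theorem second_leg_mem {x : ℝ} (ht : x ∈ E.top) :
    ∀ r ∈ Icc 0 (twist E.breaks x / v.re),
      Complex.mk 0 (1 - E.κ * twist E.breaks x) + r * v ∈ unitSquare \ E.gluing.removed := by
  intro r hr
  rcases hr.2.eq_or_lt with rfl | h
  · rw [second_leg_end hv hκ]
    exact (horiz_glue ht).1
  rcases hr.1.eq_or_lt with rfl | h'
  · simpa using (vert_glue ht).2.1
  · exact E.gluing.interior_subset_diff
      (second_leg_interior hv hκ (E.top_subset (twist_mem ht)) ⟨h', h⟩)

theorem reaches_lower {x : ℝ} (hb : x ∈ E.bot) (ht : x ∈ E.top) :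
    SquareGluing.Reaches v (E.lower x) (E.returnTime v x) (E.lower (E.F x)) := by
  have h0 := E.top_subset ht
  have h1 := E.top_subset (twist_mem ht)
  obtain ⟨g1, g2, g3⟩ := vert_glue ht
  obtain ⟨g4, g5⟩ := horiz_glue ht
  have a1 : 0 < (1 - x) / v.re := div_pos (by linarith [h0.2]) hv
  have a2 : 0 < twist E.breaks x / v.re := div_pos h1.1 hv
  have r1 := SquareGluing.reaches_segment (z := ⟨_, lower_mem hb⟩) (w := ⟨_, g1⟩) a1
    (first_leg_mem' hv hκ hb ht) (first_leg_end hv hκ).symm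
  have r2 := SquareGluing.reaches_segment (z := ⟨_, g2⟩) (w := ⟨_, g4⟩) a2
    (second_leg_mem hv hκ ht) (second_leg_end hv hκ).symm
  rw [← SquareGluing.projC_of_mem, ← SquareGluing.projC_of_mem] at r1 r2
  rw [g3] at r1
  rw [g5] at r2
  exact r1.trans a1.le a2.le r2

omit hκ in
theorem returnTime_ge {x : ℝ} (ht : x ∈ E.top) : 1 / 2 / v.re ≤ E.returnTime v x := by
  have h0 := E.top_subset ht
  have h1 := E.top_subset (twist_mem ht)
  rw [returnTime, ← add_div]
  refine div_le_div_of_nonneg_right ?_ hv.le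
  rcases le_or_gt x (1 / 2) with h | h
  · linarith [h1.1]
  · linarith [(E.isGapSet.twist_half ht).2 h, h0.2]

omit hκ in
theorem returnTime_pos {x : ℝ} (ht : x ∈ E.top) : 0 < E.returnTime v x :=
  lt_of_lt_of_le (by positivity) (returnTime_ge hv ht)

omit hv hκ in
theorem lower_ne_of_interior {y : ℝ} (hy : y ∈ E.bot) {z : ℂ} (hz : z ∈ interior unitSquare) :
    E.gluing.projC z ≠ E.lower y := by
  intro h
  rw [lower, SquareGluing.projC_of_mem (lower_mem hy),
    SquareGluing.projC_of_mem (E.gluing.interior_subset_diff hz)] at h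
  refine SquareGluing.not_mem_interior_of_proj_eq h (fun he => ?_) hz
  have : z = Complex.mk y 0 := congrArg Subtype.val he
  rw [this] at hz
  exact lt_irrefl _ (mem_interior_unitSquare.1 hz).2.1

omit hv hκ in
theorem lower_ne_of_vert {x y : ℝ} (hy : y ∈ E.bot) (hx : x ∈ E.top) :
    E.gluing.projC (Complex.mk 1 (E.κ * (1 - x))) ≠ E.lower y := by
  intro h
  have h1 := E.top_subset hx
  have h2 := E.κ_pos
  have h3 := E.κ_le
  have hy' := (mem_bot_iff.1 hy).1
  rw [lower, SquareGluing.projC_of_mem (lower_mem hy),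
    SquareGluing.projC_of_mem (vert_glue hx).1, SquareGluing.proj_eq_iff] at h
  rcases h with h | (⟨h, -⟩ | ⟨-, h⟩) | (⟨h, -⟩ | ⟨h, -⟩)
  · exact hy'.2.ne (congrArg (fun z : E.gluing.Points => z.1.re) h).symm
  · simp only at h
    nlinarith [h1.1]
  · exact hy'.1.ne (congrArg Complex.re h).symm
  · simp at h
  · exact hy'.2.ne h

/-- A flow line which is defined for all times meets the upper side in a glued point, and its next
intersection with the lower side is given by the exchange. -/
theorem flowLine_return {c : ℝ → E.gluing.Surface} (hc : IsFlowLine v c) {x : ℝ} (hb : x ∈ E.bot)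
    (h0 : c 0 = E.lower x) :
    x ∈ E.top ∧ c (E.returnTime v x) = E.lower (E.F x) ∧
      ∀ t ∈ Ioo 0 (E.returnTime v x), ∀ y ∈ E.bot, c t ≠ E.lower y := by
  have hx := (mem_bot_iff.1 hb).1
  have hz : c 0 = E.gluing.proj ⟨_, lower_mem hb⟩ := by
    rw [h0, lower, SquareGluing.projC_of_mem]
  have a1 : 0 < (1 - x) / v.re := div_pos (by linarith [hx.2]) hv
  have ht : x ∈ E.top := by
    have h1 := SquareGluing.not_mem_removed_of_flowLine hc hz a1 (first_leg_mem hv hκ hb)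
    rw [first_leg_end hv hκ, E.one_mk_mem (Ioo_subset_Icc_self hx), not_not] at h1
    exact h1
  have h1 := E.top_subset (twist_mem ht)
  obtain ⟨g1, g2, g3⟩ := vert_glue ht
  have c1 : ∀ r ∈ Icc 0 ((1 - x) / v.re), c r = E.gluing.projC (Complex.mk x 0 + r * v) := by
    intro r hr
    have := SquareGluing.flowLine_eq_of_segment hc hz hr.1 fun s hs =>
      first_leg_mem' hv hκ hb ht s ⟨hs.1, hs.2.trans hr.2⟩
    rwa [zero_add] at this
  have hz' : c ((1 - x) / v.re) = E.gluing.proj ⟨_, g2⟩ := by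
    rw [c1 _ ⟨a1.le, le_rfl⟩, first_leg_end hv hκ, g3, SquareGluing.projC_of_mem]
  have c2 : ∀ r ∈ Icc 0 (twist E.breaks x / v.re), c ((1 - x) / v.re + r) =
      E.gluing.projC (Complex.mk 0 (1 - E.κ * twist E.breaks x) + r * v) := fun r hr =>
    SquareGluing.flowLine_eq_of_segment hc hz' hr.1 fun s hs =>
      second_leg_mem hv hκ ht s ⟨hs.1, hs.2.trans hr.2⟩
  refine ⟨ht, ?_, ?_⟩
  · rw [returnTime, c2 _ ⟨div_nonneg h1.1.le hv.le, le_rfl⟩, second_leg_end hv hκ,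
      (horiz_glue ht).2]
  · intro t htm y hy
    rcases lt_trichotomy t ((1 - x) / v.re) with h | rfl | h
    · rw [c1 t ⟨htm.1.le, h.le⟩]
      exact lower_ne_of_interior hy (first_leg_interior hv hκ hx ⟨htm.1, h⟩)
    · rw [c1 _ ⟨htm.1.le, le_rfl⟩, first_leg_end hv hκ]
      exact lower_ne_of_vert hy ht
    · have h2 : t - (1 - x) / v.re ∈ Ioo 0 (twist E.breaks x / v.re) :=
        ⟨sub_pos.2 h, by have := htm.2; rw [returnTime] at this; linarith⟩
      have h3 := c2 _ (Ioo_subset_Icc_self h2)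
      rw [add_sub_cancel] at h3
      rw [h3]
      exact lower_ne_of_interior hy (second_leg_interior hv hκ h1 h2)

omit hv hκ in
/-- The points whose orbits under the exchange are not defined or meet points that are not glued. -/
def exceptional (E : ExchangeData) : Set ℝ :=
  {x | x ∈ Ico (0 : ℝ) 1 ∧ ∃ m n : ℕ, ∃ z ∈ insert 0 (Icc 0 1 \ E.top), E.F^[m] x = E.F^[n] z}

omit hv hκ in
theorem mapsTo_F : MapsTo E.F (Ico 0 1) (Ico 0 1) := fun _ hx =>
  Ioo_subset_Ico_self (E.bijOn.mapsTo hx)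

omit hv hκ in
theorem countable_exceptional : E.exceptional.Countable := by
  have h1 : (⋃ m : ℕ, ⋃ n : ℕ, ⋃ z ∈ insert 0 (Icc 0 1 \ E.top),
      {x | x ∈ Ico (0 : ℝ) 1 ∧ E.F^[m] x = E.F^[n] z}).Countable := by
    refine countable_iUnion fun m => countable_iUnion fun n =>
      (E.countable_top.insert 0).biUnion fun z _ => Set.Subsingleton.countable ?_
    intro x hx y hy
    exact (E.bijOn.injOn.iterate mapsTo_F m) hx.1 hy.1 (hx.2.trans hy.2.symm)
  refine h1.mono ?_
  rintro x ⟨hx, m, n, z, hz, h⟩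
  simp only [mem_iUnion]
  exact ⟨m, n, z, hz, hx, h⟩

omit hv hκ in
theorem mem_top_of_not_exceptional {x : ℝ} (hx : x ∈ Ico 0 1 \ E.exceptional) : x ∈ E.top :=
  by_contra fun h => hx.2 ⟨hx.1, 0, 0, x, Or.inr ⟨Ico_subset_Icc_self hx.1, h⟩, rfl⟩

omit hv hκ in
theorem F_not_exceptional {x : ℝ} (hx : x ∈ Ico 0 1 \ E.exceptional) :
    E.F x ∈ Ico 0 1 \ E.exceptional := by
  refine ⟨mapsTo_F hx.1, ?_⟩
  rintro ⟨-, m, n, z, hz, h⟩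
  exact hx.2 ⟨hx.1, m + 1, n, z, hz, h⟩

omit hv hκ in
theorem exists_F_eq {x : ℝ} (hx : x ∈ Ico 0 1 \ E.exceptional) :
    ∃ y ∈ Ico 0 1 \ E.exceptional, E.F y = x := by
  have h0 : x ≠ 0 := by
    rintro rfl
    exact hx.2 ⟨hx.1, 0, 0, 0, Or.inl rfl, rfl⟩
  obtain ⟨y, hy, rfl⟩ := E.bijOn.surjOn ⟨lt_of_le_of_ne hx.1.1 h0.symm, hx.1.2⟩
  refine ⟨y, ⟨hy, ?_⟩, rfl⟩
  rintro ⟨-, m, n, z, hz, h⟩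
  refine hx.2 ⟨hx.1, m, n + 1, z, hz, ?_⟩
  rw [← Function.iterate_succ_apply, Function.iterate_succ_apply', h,
    Function.iterate_succ_apply']

omit hv hκ in
theorem mem_bot_of_not_exceptional {x : ℝ} (hx : x ∈ Ico 0 1 \ E.exceptional) : x ∈ E.bot := by
  obtain ⟨y, hy, rfl⟩ := exists_F_eq hx
  exact ⟨y, mem_top_of_not_exceptional hy, rfl⟩

theorem reaches_forward (n : ℕ) : ∀ x ∈ Ico 0 1 \ E.exceptional, ∃ t, n * (1 / 2 / v.re) ≤ t ∧
    ∃ y ∈ Ico 0 1 \ E.exceptional, SquareGluing.Reaches v (E.lower x) t (E.lower y) := by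
  induction n with
  | zero =>
    intro x hx
    obtain ⟨m, hm⟩ := (reaches_lower hv hκ (mem_bot_of_not_exceptional hx)
      (mem_top_of_not_exceptional hx)).exists_of_mem left_mem_uIcc
    have h := hm
    obtain ⟨c, -, h0, h1⟩ := hm
    rw [← h1, h0] at h
    exact ⟨0, by simp, x, hx, h⟩
  | succ n ih =>
    intro x hx
    have ht := mem_top_of_not_exceptional hx
    have h1 := reaches_lower hv hκ (mem_bot_of_not_exceptional hx) ht
    obtain ⟨t, h2, y, hy, h3⟩ := ih _ (F_not_exceptional hx)
    have h4 : 0 ≤ t := le_trans (by positivity) h2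
    refine ⟨_, ?_, y, hy, h1.trans (returnTime_pos hv ht).le h4 h3⟩
    push_cast
    linarith [returnTime_ge hv ht]

theorem reaches_backward (n : ℕ) : ∀ x ∈ Ico 0 1 \ E.exceptional, ∃ t, n * (1 / 2 / v.re) ≤ t ∧
    ∃ y ∈ Ico 0 1 \ E.exceptional, SquareGluing.Reaches v (E.lower y) t (E.lower x) := by
  induction n with
  | zero =>
    intro x hx
    obtain ⟨m, hm⟩ := (reaches_lower hv hκ (mem_bot_of_not_exceptional hx)
      (mem_top_of_not_exceptional hx)).exists_of_mem left_mem_uIcc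
    have h := hm
    obtain ⟨c, -, h0, h1⟩ := hm
    rw [← h1, h0] at h
    exact ⟨0, by simp, x, hx, h⟩
  | succ n ih =>
    intro x hx
    obtain ⟨x', hx', rfl⟩ := exists_F_eq hx
    have ht := mem_top_of_not_exceptional hx'
    have h1 := reaches_lower hv hκ (mem_bot_of_not_exceptional hx') ht
    obtain ⟨t, h2, y, hy, h3⟩ := ih _ hx'
    have h4 : 0 ≤ t := le_trans (by positivity) h2
    refine ⟨_, ?_, y, hy, h3.trans h4 (returnTime_pos hv ht).le h1⟩
    push_cast
    linarith [returnTime_ge hv ht]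

theorem lower_mem_flowDomain {x : ℝ} (hx : x ∈ Ico 0 1 \ E.exceptional) :
    E.lower x ∈ flowDomain E.gluing.Surface v := by
  refine SquareGluing.mem_flowDomain_of_reaches fun t => ?_
  have hd : 0 < 1 / 2 / v.re := by positivity
  obtain ⟨n, hn⟩ := exists_nat_ge (|t| / (1 / 2 / v.re))
  rw [div_le_iff₀ hd] at hn
  rcases le_total 0 t with h | h
  · obtain ⟨T, hT, y, -, hr⟩ := reaches_forward hv hκ n x hx
    rw [abs_of_nonneg h] at hn
    exact hr.exists_of_mem (mem_uIcc.2 (Or.inl ⟨h, hn.trans hT⟩))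
  · obtain ⟨T, hT, y, -, hr⟩ := reaches_backward hv hκ n x hx
    rw [abs_of_nonpos h] at hn
    exact hr.symm.exists_of_mem (mem_uIcc.2 (Or.inr ⟨by linarith, h⟩))

end ExchangeData

/-! ### The rotated odometer -/

/-- Every point is the left end of an interval on which `f` is a translation. -/
def IsRightTranslation (f : Ico (0 : ℝ) 1 → Ico (0 : ℝ) 1) : Prop :=
  ∀ x : Ico (0 : ℝ) 1, ∃ δ > 0, ∀ y : Ico (0 : ℝ) 1, (x : ℝ) ≤ y → (y : ℝ) < x + δ →
    (f y : ℝ) - f x = (y : ℝ) - x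

theorem IsRightTranslation.comp {f g : Ico (0 : ℝ) 1 → Ico (0 : ℝ) 1} (hg : IsRightTranslation g)
    (hf : IsRightTranslation f) : IsRightTranslation (g ∘ f) := by
  intro x
  obtain ⟨δ, hδ, h⟩ := hf x
  obtain ⟨δ', hδ', h'⟩ := hg (f x)
  refine ⟨min δ δ', lt_min hδ hδ', fun y h1 h2 => ?_⟩
  have h3 := h y h1 (h2.trans_le (add_le_add_right (min_le_left _ _) _))
  have h4 := h2.trans_le (add_le_add_right (min_le_right δ δ') _)
  have h5 := h' (f y) (by linarith) (by linarith)
  rw [Function.comp_apply, Function.comp_apply, h5, h3]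

theorem vonNeumannKakutani_mem {x : Ico (0 : ℝ) 1} {m : ℕ} (h1 : 1 - (1 / 2) ^ m ≤ (x : ℝ))
    (h2 : (x : ℝ) < 1 - (1 / 2) ^ (m + 1)) :
    (1 / 2 : ℝ) ^ (m + 1) ≤ vonNeumannKakutani x ∧ (vonNeumannKakutani x : ℝ) < (1 / 2) ^ m := by
  rw [vonNeumannKakutani_apply m x h1 h2]
  rw [pow_succ] at h2 ⊢
  constructor <;> linarith

theorem vonNeumannKakutani_injective : Function.Injective vonNeumannKakutani := by
  intro x y h
  obtain ⟨m, -, h1, h2⟩ := dyadicIndex_spec x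
  obtain ⟨n, -, h3, h4⟩ := dyadicIndex_spec y
  obtain ⟨h5, h6⟩ := vonNeumannKakutani_mem h1 h2
  obtain ⟨h7, h8⟩ := vonNeumannKakutani_mem h3 h4
  have hmn : m = n := by
    rw [h] at h5 h6
    have k1 := (pow_lt_pow_iff_right_of_lt_one₀ (by norm_num : (0 : ℝ) < 1 / 2) (by norm_num)).1
      (h5.trans_lt h8)
    have k2 := (pow_lt_pow_iff_right_of_lt_one₀ (by norm_num : (0 : ℝ) < 1 / 2) (by norm_num)).1
      (h7.trans_lt h6)
    omega
  subst hmn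
  have h9 := congrArg Subtype.val h
  rw [vonNeumannKakutani_apply m x h1 h2, vonNeumannKakutani_apply m y h3 h4] at h9
  exact Subtype.ext (by linarith)

theorem vonNeumannKakutani_pos (x : Ico (0 : ℝ) 1) : (0 : ℝ) < vonNeumannKakutani x := by
  obtain ⟨m, -, h1, h2⟩ := dyadicIndex_spec x
  exact lt_of_lt_of_le (by positivity) (vonNeumannKakutani_mem h1 h2).1

theorem exists_vonNeumannKakutani_eq {y : ℝ} (hy : y ∈ Ioo (0 : ℝ) 1) :
    ∃ x, (vonNeumannKakutani x : ℝ) = y := by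
  obtain ⟨m, h1, h2⟩ : ∃ m : ℕ, (1 / 2 : ℝ) ^ (m + 1) ≤ y ∧ y < (1 / 2) ^ m := by
    obtain ⟨n, h1, h2⟩ := exists_nat_pow_near_of_lt_one hy.1 hy.2.le
      (by norm_num : (0 : ℝ) < 1 / 2) (by norm_num)
    rcases h2.eq_or_lt with h3 | h3
    · rcases n with _ | k
      · rw [pow_zero] at h3
        exact absurd h3 hy.2.ne
      · refine ⟨k, h3.ge, ?_⟩
        rw [h3, pow_succ]
        have : (0 : ℝ) < (1 / 2) ^ k := by positivity
        linarith
    · exact ⟨n, h1.le, h3⟩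
  have h3 : ((1 : ℝ) / 2) ^ m ≤ 1 := pow_le_one₀ (by norm_num) (by norm_num)
  have h4 : (0 : ℝ) < (1 / 2) ^ m := by positivity
  rw [pow_succ] at h1
  have h5 : y + (1 - 3 * (1 / 2) ^ (m + 1)) ∈ Ico (0 : ℝ) 1 := by
    rw [pow_succ]
    constructor <;> linarith
  refine ⟨⟨_, h5⟩, ?_⟩
  rw [vonNeumannKakutani_apply m] <;> simp only [pow_succ] <;> linarith

theorem isRightTranslation_vonNeumannKakutani : IsRightTranslation vonNeumannKakutani := by
  intro x
  obtain ⟨m, -, h1, h2⟩ := dyadicIndex_spec x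
  refine ⟨1 - (1 / 2) ^ (m + 1) - x, by linarith, fun y h3 h4 => ?_⟩
  rw [vonNeumannKakutani_apply m x h1 h2,
    vonNeumannKakutani_apply m y (h1.trans h3) (by linarith)]
  ring

section Permutation

variable {q : ℕ} (π : Equiv.Perm (Fin q))

theorem intervalPermutation_apply (k : Fin q) (x : Ico (0 : ℝ) 1) (h1 : (k : ℝ) ≤ q * x)
    (h2 : (q : ℝ) * x < k + 1) :
    (intervalPermutation π x : ℝ) = x + (((π k : ℕ) : ℝ) - k) / q := by
  have h : ⌊(q : ℝ) * x⌋₊ = k := by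
    rw [Nat.floor_eq_iff (le_trans (Nat.cast_nonneg _) h1)]
    exact ⟨h1, h2⟩
  have hlt : ⌊(q : ℝ) * x⌋₊ < q := h ▸ k.2
  have hk : (⟨⌊(q : ℝ) * x⌋₊, hlt⟩ : Fin q) = k := Fin.ext h
  rw [intervalPermutation, dif_pos hlt]
  simp only [h]

theorem exists_index (hq : 0 < q) (x : Ico (0 : ℝ) 1) :
    ∃ k : Fin q, (k : ℝ) ≤ q * x ∧ (q : ℝ) * x < k + 1 := by
  have hq' : (0 : ℝ) < q := by exact_mod_cast hq
  have h0 : (0 : ℝ) ≤ q * x := mul_nonneg hq'.le x.2.1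
  refine ⟨⟨⌊(q : ℝ) * x⌋₊, ?_⟩, Nat.floor_le h0, Nat.lt_floor_add_one _⟩
  rw [Nat.floor_lt h0]
  nlinarith [x.2.2]

theorem intervalPermutation_symm (hq : 0 < q) (x : Ico (0 : ℝ) 1) :
    intervalPermutation π.symm (intervalPermutation π x) = x := by
  obtain ⟨k, h1, h2⟩ := exists_index hq x
  have hq' : (0 : ℝ) < q := by exact_mod_cast hq
  have h3 := intervalPermutation_apply π k x h1 h2
  have h4 : (q : ℝ) * (intervalPermutation π x : ℝ) = q * x + ((π k : ℕ) : ℝ) - k := by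
    rw [h3]; field_simp; ring
  apply Subtype.ext
  rw [intervalPermutation_apply π.symm (π k) _ (by rw [h4]; linarith) (by rw [h4]; linarith), h3,
    Equiv.symm_apply_apply]
  ring

theorem intervalPermutation_bijective (hq : 0 < q) : Function.Bijective (intervalPermutation π) :=
  ⟨Function.LeftInverse.injective (intervalPermutation_symm π hq),
    Function.RightInverse.surjective (g := intervalPermutation π.symm)
      (intervalPermutation_symm π.symm hq)⟩

theorem isRightTranslation_intervalPermutation (hq : 0 < q) :
    IsRightTranslation (intervalPermutation π) := by
  intro x
  obtain ⟨k, h1, h2⟩ := exists_index hq x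
  have hq' : (0 : ℝ) < q := by exact_mod_cast hq
  refine ⟨(k + 1) / q - x, sub_pos.2 ((lt_div_iff₀' hq').2 h2), fun y h3 h4 => ?_⟩
  rw [add_sub_cancel, lt_div_iff₀' hq'] at h4
  rw [intervalPermutation_apply π k x h1 h2, intervalPermutation_apply π k y _ h4]
  · ring
  · exact h1.trans (mul_le_mul_of_nonneg_left h3 hq'.le)

open Classical in
/-- The rotated odometer as a function of a real variable. -/
def realOdometer (x : ℝ) : ℝ := if h : x ∈ Ico (0 : ℝ) 1 then rotatedOdometer π ⟨x, h⟩ else 0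

theorem realOdometer_of_mem {x : ℝ} (h : x ∈ Ico (0 : ℝ) 1) :
    realOdometer π x = rotatedOdometer π ⟨x, h⟩ := dif_pos h

/-- The rotated odometer and a slope `q / p ≤ 1`. -/
def odometerData (hq : 0 < q) (p : ℕ) (hp : q ≤ p) : ExchangeData where
  κ := q / p
  κ_pos := div_pos (by exact_mod_cast hq) (by exact_mod_cast hq.trans_le hp)
  κ_le := div_le_one_of_le₀ (by exact_mod_cast hp) (Nat.cast_nonneg _)
  F := realOdometer π
  bijOn := by
    refine ⟨fun x hx => ?_, fun x hx y hy h => ?_, fun y hy => ?_⟩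
    · rw [realOdometer_of_mem π hx]
      exact ⟨vonNeumannKakutani_pos _, (rotatedOdometer π ⟨x, hx⟩).2.2⟩
    · rw [realOdometer_of_mem π hx, realOdometer_of_mem π hy] at h
      exact congrArg Subtype.val ((intervalPermutation_bijective π hq).1
        (vonNeumannKakutani_injective (Subtype.ext h)))
    · obtain ⟨z, hz⟩ := exists_vonNeumannKakutani_eq hy
      obtain ⟨x, rfl⟩ := (intervalPermutation_bijective π hq).2 z
      refine ⟨x, x.2, ?_⟩
      rw [realOdometer_of_mem π x.2]
      exact hz
  right := by
    intro x hx
    obtain ⟨δ, hδ, h⟩ := (isRightTranslation_vonNeumannKakutani.comp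
      (isRightTranslation_intervalPermutation π hq)) ⟨x, hx⟩
    filter_upwards [Ioo_mem_nhdsGT hx.2, Ioo_mem_nhdsGT (lt_add_of_pos_right x hδ)] with y h1 h2
    have hy : y ∈ Ico (0 : ℝ) 1 := ⟨hx.1.trans h1.1.le, h1.2⟩
    rw [realOdometer_of_mem π hx, realOdometer_of_mem π hy]
    exact h ⟨y, hy⟩ h1.1.le h2.2

end Permutation

/-! ### The first return map -/

namespace ExchangeData

variable {E : ExchangeData} {v : ℂ}

theorem mem_sectionCoords_iff {x : ℝ} : x ∈ E.gluing.sectionCoords v ↔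
    x ∈ E.bot ∧ E.lower x ∈ flowDomain E.gluing.Surface v := by
  have key : ∀ hx : x ∈ Ioo (0 : ℝ) 1 ∧ Complex.mk x 0 ∉ E.gluing.removed,
      E.gluing.proj (E.gluing.lowerPoint x hx) = E.lower x := fun hx =>
    (SquareGluing.projC_of_mem (lower_mem (mem_bot_iff.2 hx))).symm
  constructor
  · rintro ⟨hx, h⟩
    exact ⟨mem_bot_iff.2 hx, by rwa [← key hx]⟩
  · rintro ⟨hx, h⟩
    exact ⟨mem_bot_iff.1 hx, by rwa [key (mem_bot_iff.1 hx)]⟩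

theorem sectionParam_eq (x : E.gluing.sectionCoords v) : E.gluing.sectionParam v x = E.lower x :=
  (SquareGluing.projC_of_mem (lower_mem (mem_sectionCoords_iff.1 x.2).1)).symm

theorem mem_horizontalSection_iff {m : E.gluing.Surface} : m ∈ E.gluing.horizontalSection v ↔
    ∃ x ∈ E.gluing.sectionCoords v, E.lower x = m := by
  constructor
  · rintro ⟨x, rfl⟩
    exact ⟨x, x.2, (sectionParam_eq x).symm⟩
  · rintro ⟨x, hx, rfl⟩
    exact ⟨⟨x, hx⟩, sectionParam_eq _⟩

theorem sectionCoords_subset : E.gluing.sectionCoords v ⊆ Ico 0 1 := fun _ hx =>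
  Ioo_subset_Ico_self (mem_bot_iff.1 (mem_sectionCoords_iff.1 hx).1).1

theorem sectionParam_injective : Function.Injective (E.gluing.sectionParam v) := by
  intro x y h
  rw [sectionParam_eq, sectionParam_eq] at h
  exact Subtype.ext (lower_injOn (mem_sectionCoords_iff.1 x.2).1 (mem_sectionCoords_iff.1 y.2).1 h)

theorem continuous_sectionParam : Continuous (E.gluing.sectionParam v) := by
  have h : Continuous fun x : E.gluing.sectionCoords v => Complex.mk x 0 :=
    Complex.continuous_ofReal.comp continuous_subtype_val
  have h1 : ∀ x : E.gluing.sectionCoords v, Complex.mk x 0 ∈ unitSquare \ E.gluing.removed :=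
    fun x => lower_mem (mem_sectionCoords_iff.1 x.2).1
  exact SquareGluing.continuous_proj.comp (h.subtype_mk h1)

variable (hv : 0 < v.re) (hκ : v.im = E.κ * v.re)

include hv hκ

theorem countable_diff_sectionCoords : (Ico 0 1 \ E.gluing.sectionCoords v).Countable := by
  refine (countable_exceptional (E := E)).mono fun x hx => by_contra fun h => hx.2 ?_
  exact mem_sectionCoords_iff.2
    ⟨mem_bot_of_not_exceptional ⟨hx.1, h⟩, lower_mem_flowDomain hv hκ ⟨hx.1, h⟩⟩

theorem measurableSet_sectionCoords : MeasurableSet (E.gluing.sectionCoords v) := by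
  have h := (measurableSet_Ico (a := (0 : ℝ)) (b := 1)).diff (countable_diff_sectionCoords hv hκ).measurableSet
  rwa [sdiff_sdiff_cancel_left sectionCoords_subset] at h

theorem measurableEmbedding_sectionParam : MeasurableEmbedding (E.gluing.sectionParam v) := by
  have := (measurableSet_sectionCoords hv hκ).standardBorel
  exact continuous_sectionParam.measurable.measurableEmbedding sectionParam_injective

theorem F_mem_sectionCoords {x : ℝ} (hx : x ∈ E.gluing.sectionCoords v) :
    E.F x ∈ E.gluing.sectionCoords v := by
  obtain ⟨hb, c, hc, h0⟩ := mem_sectionCoords_iff.1 hx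
  obtain ⟨ht, h1, -⟩ := flowLine_return hv hκ hc hb h0
  refine mem_sectionCoords_iff.2 ⟨⟨x, ht, rfl⟩, _, hc.shift (E.returnTime v x), ?_⟩
  rw [← h1, zero_add]

theorem isFirstReturn {x : ℝ} (hx : x ∈ E.gluing.sectionCoords v) :
    IsFirstReturn v (E.gluing.horizontalSection v) (E.lower x) (E.lower (E.F x)) := by
  obtain ⟨hb, c, hc, h0⟩ := mem_sectionCoords_iff.1 hx
  obtain ⟨ht, h1, h2⟩ := flowLine_return hv hκ hc hb h0
  refine ⟨c, E.returnTime v x, hc, h0, returnTime_pos hv ht, h1,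
    mem_horizontalSection_iff.2 ⟨_, F_mem_sectionCoords hv hκ hx, rfl⟩, fun t htm hP => ?_⟩
  obtain ⟨y, hy, he⟩ := mem_horizontalSection_iff.1 hP
  exact h2 t htm y (mem_sectionCoords_iff.1 hy).1 he.symm

/-- The first return map of the flow to the horizontal section is the exchange. -/
theorem exists_firstReturnMap : ∃ F : E.gluing.horizontalSection v → E.gluing.horizontalSection v,
    (∀ m : E.gluing.horizontalSection v, IsFirstReturn v (E.gluing.horizontalSection v) m (F m)) ∧
    ∀ x ∈ E.gluing.sectionCoords v, ∀ m : E.gluing.horizontalSection v, (m : E.gluing.Surface) = E.lower x →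
      (F m : E.gluing.Surface) = E.lower (E.F x) := by
  have h : ∀ m : E.gluing.horizontalSection v, ∃ m' : E.gluing.horizontalSection v,
      IsFirstReturn v (E.gluing.horizontalSection v) (m : E.gluing.Surface) m' ∧
      ∀ x ∈ E.gluing.sectionCoords v, (m : E.gluing.Surface) = E.lower x →
        (m' : E.gluing.Surface) = E.lower (E.F x) := by
    rintro ⟨m, hm⟩
    obtain ⟨x, hx, rfl⟩ := mem_horizontalSection_iff.1 hm
    refine ⟨⟨E.lower (E.F x),
      mem_horizontalSection_iff.2 ⟨_, F_mem_sectionCoords hv hκ hx, rfl⟩⟩,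
      isFirstReturn hv hκ hx, fun y hy he => ?_⟩
    have hxy := lower_injOn (mem_sectionCoords_iff.1 hx).1 (mem_sectionCoords_iff.1 hy).1 he
    exact congrArg (fun z => E.lower (E.F z)) hxy
  choose F hF hF' using h
  exact ⟨F, hF, fun x hx m hm => hF' m x hx hm⟩

end ExchangeData

/-- A subset of `[0, 1)`, as a set of real numbers and as a set of points of the interval. -/
def icoEquiv {A : Set ℝ} (hA : A ⊆ Ico 0 1) : {x : Ico (0 : ℝ) 1 | (x : ℝ) ∈ A} ≃ᵐ A where
  toFun x := ⟨x.1.1, x.2⟩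
  invFun x := ⟨⟨x.1, hA x.2⟩, x.2⟩
  left_inv _ := rfl
  right_inv _ := rfl
  measurable_toFun := (measurable_subtype_coe.comp measurable_subtype_coe).subtype_mk
  measurable_invFun := (measurable_subtype_coe.subtype_mk).subtype_mk

theorem measurePreserving_icoEquiv {A : Set ℝ} (hA : A ⊆ Ico 0 1) (hm : MeasurableSet A) :
    MeasurePreserving (icoEquiv hA) (lebesgueIco.comap Subtype.val)
      ((volume : Measure ℝ).comap Subtype.val) := by
  refine ⟨(icoEquiv hA).measurable, Measure.ext fun s _ => ?_⟩
  have hB : MeasurableSet {x : Ico (0 : ℝ) 1 | (x : ℝ) ∈ A} := measurable_subtype_coe hm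
  rw [(icoEquiv hA).map_apply, (MeasurableEmbedding.subtype_coe hB).comap_apply, lebesgueIco,
    (MeasurableEmbedding.subtype_coe measurableSet_Ico).comap_apply,
    (MeasurableEmbedding.subtype_coe hm).comap_apply]
  congr 1
  ext x
  constructor
  · rintro ⟨_, ⟨y, hy, rfl⟩, rfl⟩
    exact ⟨_, hy, rfl⟩
  · rintro ⟨y, hy, rfl⟩
    exact ⟨_, ⟨⟨⟨y.1, hA y.2⟩, y.2⟩, hy, rfl⟩, rfl⟩

namespace ExchangeData

variable {E : ExchangeData} {v : ℂ}

theorem measurablyIsomorphic_of_firstReturnMap (hv : 0 < v.re) (hκ : v.im = E.κ * v.re)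
    {F : E.gluing.horizontalSection v → E.gluing.horizontalSection v}
    (hF : ∀ x ∈ E.gluing.sectionCoords v, ∀ m : E.gluing.horizontalSection v,
      (m : E.gluing.Surface) = E.lower x → (F m : E.gluing.Surface) = E.lower (E.F x))
    {T : Ico (0 : ℝ) 1 → Ico (0 : ℝ) 1} (hT : ∀ x : Ico (0 : ℝ) 1, (T x : ℝ) = E.F x) :
    MeasurablyIsomorphic F (E.gluing.sectionMeasure v) T lebesgueIco := by
  have hm := measurableSet_sectionCoords hv hκ
  have he := measurableEmbedding_sectionParam hv hκ
  set ψ : E.gluing.sectionCoords v ≃ᵐ E.gluing.horizontalSection v := he.equivRange with hψ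
  have hψv : ∀ x, (ψ x : E.gluing.Surface) = E.lower x := fun x => by
    rw [← sectionParam_eq]; exact congrArg Subtype.val (he.equivRange_apply x)
  have hψm : MeasurePreserving ψ ((volume : Measure ℝ).comap Subtype.val)
      (E.gluing.sectionMeasure v) := by
    refine ⟨ψ.measurable, ?_⟩
    rw [SquareGluing.sectionMeasure]
    congr 1
    ext x
    exact (hψv x).trans (sectionParam_eq x).symm
  set χ := icoEquiv (sectionCoords_subset (E := E) (v := v)) with hχ
  have hχm := measurePreserving_icoEquiv (sectionCoords_subset (E := E) (v := v)) hm
  have hu : MeasurePreserving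
      (MeasurableEquiv.Set.univ (E.gluing.horizontalSection v))
      ((E.gluing.sectionMeasure v).comap Subtype.val) (E.gluing.sectionMeasure v) := by
    have := measurePreserving_subtype_coe (μa := E.gluing.sectionMeasure v) MeasurableSet.univ
    rwa [Measure.restrict_univ] at this
  have hB : MapsTo T {x | (x : ℝ) ∈ E.gluing.sectionCoords v}
      {x | (x : ℝ) ∈ E.gluing.sectionCoords v} := fun x hx => by
    change (T x : ℝ) ∈ E.gluing.sectionCoords v
    rw [hT]
    exact F_mem_sectionCoords hv hκ hx
  refine ⟨univ, {x | (x : ℝ) ∈ E.gluing.sectionCoords v}, mapsTo_univ _ _, hB,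
    ((MeasurableEquiv.Set.univ _).trans ψ.symm).trans χ.symm, MeasurableSet.univ,
    measurable_subtype_coe hm, by simp, ?_, ?_, ?_⟩
  · rw [lebesgueIco, (MeasurableEmbedding.subtype_coe measurableSet_Ico).comap_apply]
    refine Set.Countable.measure_zero ((countable_diff_sectionCoords hv hκ).mono ?_) _
    rintro _ ⟨x, hx, rfl⟩
    exact ⟨x.2, hx⟩
  · exact (hχm.symm χ).comp ((hψm.symm ψ).comp hu)
  · rintro ⟨m, -⟩
    obtain ⟨x, rfl⟩ := ψ.surjective m
    have h1 : F (ψ x) = ψ ⟨E.F x, F_mem_sectionCoords hv hκ x.2⟩ := by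
      apply Subtype.ext
      rw [hF x x.2 _ (hψv x), hψv]
    apply Subtype.ext
    apply Subtype.ext
    change ((ψ.symm (F (ψ x)) : E.gluing.sectionCoords v) : ℝ) = T ⟨(ψ.symm (ψ x)).1, _⟩
    rw [h1, hT]
    simp

end ExchangeData

end

theorem theorem1p1 (q : ℕ) (hq : 2 ≤ q) (π : Equiv.Perm (Fin q)) (p : ℕ) (hp : q ≤ p)
    (v : ℂ) (hv : v = Complex.mk p q / ‖Complex.mk p q‖) :
    ∃ (G : SquareGluing) (_ : ChartedSpace ℂ G.Surface),
      IsTranslationSurface G.Surface ∧ G.IsInherited ∧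
      (∃ μ : Measure G.Surface, IsAreaMeasure μ ∧ μ univ < ⊤) ∧
      (∃! e : TopEnd G.Surface, ¬ e.IsPlanar) ∧
      {e : TopEnd G.Surface | e.IsPlanar}.Finite ∧
      (∃ C : MetricCompletion G.Surface,
        (∃! σ, C.IsWildSingularity σ) ∧
        {σ | C.IsConeSingularity σ}.Finite ∧
        ∀ σ ∈ C.singularities, C.IsWildSingularity σ ∨ C.IsConeSingularity σ) ∧
      ∃ F : G.horizontalSection v → G.horizontalSection v,
        (∀ x : G.horizontalSection v, IsFirstReturn v (G.horizontalSection v) x (F x)) ∧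
        MeasurablyIsomorphic F (G.sectionMeasure v) (rotatedOdometer π) lebesgueIco := by
  have hq0 : 0 < q := by omega
  have hq' : (0 : ℝ) < q := by exact_mod_cast hq0
  have hp' : (0 : ℝ) < p := by exact_mod_cast hq0.trans_le hp
  set E := odometerData π hq0 p hp with hE
  have hN : 0 < ‖Complex.mk p q‖ := norm_pos_iff.2 fun h => hp'.ne' (congrArg Complex.re h)
  have hre : v.re = p / ‖Complex.mk p q‖ := by rw [hv, Complex.div_ofReal_re]
  have him : v.im = q / ‖Complex.mk p q‖ := by rw [hv, Complex.div_ofReal_im]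
  have hv0 : 0 < v.re := by rw [hre]; positivity
  have hκ : v.im = E.κ * v.re := by
    have : E.κ = q / p := rfl
    rw [hre, him, this]
    field_simp
  obtain ⟨F, hF, hF'⟩ := ExchangeData.exists_firstReturnMap hv0 hκ
  exact ⟨E.gluing, inferInstance, SquareGluing.isTranslationSurface _, SquareGluing.isInherited _,
    SquareGluing.exists_isAreaMeasure _,
    SquareGluing.existsUnique_nonplanar_end E.isMerging E.hasHandles,
    SquareGluing.finite_planar_ends E.isMerging E.hasHandles,
    ⟨SquareGluing.completion _,
      SquareGluing.singularities_classified E.isMerging E.hasHandles _⟩,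
    F, hF, ExchangeData.measurablyIsomorphic_of_firstReturnMap hv0 hκ hF'
      fun x => (realOdometer_of_mem π x.2).symm⟩
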